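/- Work in homotopy type theory: intensional Martin-Löf type theory with $\Pi$-, $\Sigma$-, sum and identity types, the empty type, the unit type and the type of natural numbers, with a cumulative hierarchy of universes $\mathcal U_0:\mathcal U_1:\cdots$ which all satisfy function extensionality and Voevodsky's univalence axiom, and with the circle $S^1:\mathcal U_0$, the higher inductive type generated by a point $\mathrm{base}:S^1$ and a path $\mathrm{loop}:\mathrm{base}=\mathrm{base}$. For types $A,B$, let $A\simeq B$ denote the type of equivalences from $A$ to $B$. Theorem. The type of self-identifications of the circle is equivalent to two disjoint copies of the circle: for every universe $\mathcal U$ of the hierarchy, writing $S^1=S^1$ for the type of identifications of $S^1$ with itself as elements of $\mathcal U$, there is an equivalence $$(S^1 = S^1)\;\simeq\; S^1+S^1 ,$$ that is, a closed term of this type is derivable in the theory. -/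

import Mathlib

/-!
# A formal system for homotopy type theory

Intensional Martin-Löf type theory with `Π`, `Σ`, `+`, `𝟎`, `𝟏`, `ℕ` and identity types, a cumulative
hierarchy of universes, function extensionality and univalence for every universe, and the circle as a
higher inductive type.  Raw terms are lambda terms over primitive constants, with de Bruijn indices;
convertibility is generated by the computation rules; typing is the derivability relation `Typed`.
There is no judgmental eta rule, and no computation rule for the axioms.
-/

namespace HoTT

/-- The primitive constants. -/
inductive Const : Type
  /- dependent pair types -/
  | Sigma | pair | sigmaInd
  /- binary sums -/
  | Sum | inl | inr | sumInd
  /- the empty type, the unit type and the natural numbers -/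
  | Empty | emptyInd
  | Unit | star | unitInd
  | Nat | zero | succ | natInd
  /- identity types -/
  | Id | refl | idInd
  /- the circle -/
  | S1 | base | loop | s1Ind | s1LoopComp
  /- the two axioms -/
  | funext | univalence
  deriving DecidableEq

/-- Raw terms: `var n` is the variable bound by the `n`-th enclosing binder, `univ i` is the `i`-th
universe, `pi A B` is `∏ (x : A), B` and `lam A b` is `λ (x : A), b` (both bind one variable in their
second argument). -/
inductive Tm : Type
  | var (n : ℕ)
  | univ (i : ℕ)
  | pi (A B : Tm)
  | lam (A b : Tm)
  | app (f a : Tm)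
  | const (c : Const)
  deriving DecidableEq

infixl:100 " ⬝ " => Tm.app

namespace Tm

/-- Extend a renaming under a binder. -/
def upRen (ρ : ℕ → ℕ) : ℕ → ℕ
  | 0 => 0
  | n + 1 => ρ n + 1

/-- Renaming of the free variables. -/
def rename : (ℕ → ℕ) → Tm → Tm
  | ρ, var n => var (ρ n)
  | _, univ i => univ i
  | ρ, pi A B => pi (rename ρ A) (rename (upRen ρ) B)
  | ρ, lam A b => lam (rename ρ A) (rename (upRen ρ) b)
  | ρ, app f a => app (rename ρ f) (rename ρ a)
  | _, const c => const c

/-- Weakening by `k` new innermost variables. -/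
def lift (k : ℕ) (t : Tm) : Tm := rename (fun n => n + k) t

/-- Extend a substitution under a binder. -/
def upSub (σ : ℕ → Tm) : ℕ → Tm
  | 0 => var 0
  | n + 1 => lift 1 (σ n)

/-- Simultaneous capture-avoiding substitution. -/
def subst : (ℕ → Tm) → Tm → Tm
  | σ, var n => σ n
  | _, univ i => univ i
  | σ, pi A B => pi (subst σ A) (subst (upSub σ) B)
  | σ, lam A b => lam (subst σ A) (subst (upSub σ) b)
  | σ, app f a => app (subst σ f) (subst σ a)
  | _, const c => const c

/-- The substitution that replaces the innermost variable by `a` and lowers all the others. -/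
def single (a : Tm) : ℕ → Tm
  | 0 => a
  | n + 1 => var n

/-- `inst b a` is `b[a/x]`, where `x` is the innermost variable of `b`. -/
def inst (b a : Tm) : Tm := subst (single a) b

end Tm

open Tm (var univ pi lam lift)

/-! ### Derived notions

In the following definitions the arguments are terms in a common context, except those which are said
to be a body: these live in that context extended by one variable. -/

/-- The type `A → B`. -/
def arr (A B : Tm) : Tm := pi A (lift 1 B)

/-- The type `∑ (x : A), B`, where `B` is a body. -/
def sig (A B : Tm) : Tm := Tm.const .Sigma ⬝ A ⬝ lam A B

/-- The pair `(a, b) : ∑ (x : A), B`, where `B` is a body. -/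
def mkPair (A B a b : Tm) : Tm := Tm.const .pair ⬝ A ⬝ lam A B ⬝ a ⬝ b

/-- The type `A × B`. -/
def prod (A B : Tm) : Tm := sig A (lift 1 B)

/-- The type `A + B`. -/
def sum (A B : Tm) : Tm := Tm.const .Sum ⬝ A ⬝ B

/-- The identity type `a =_A b`. -/
def idt (A a b : Tm) : Tm := Tm.const .Id ⬝ A ⬝ a ⬝ b

/-- The reflexivity path `refl_a : a =_A a`. -/
def rfl' (A a : Tm) : Tm := Tm.const .refl ⬝ A ⬝ a

/-- The circle. -/
def circle : Tm := Tm.const .S1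

/-- For `C : A → U` and `p : x =_A y` and `u : C x`, the transport `p_* u : C y`, defined by path
induction. -/
def transport (A C x y p u : Tm) : Tm :=
  Tm.const .idInd ⬝ A
    ⬝ lam A (lam (lift 1 A) (lam (idt (lift 2 A) (var 1) (var 0))
        (arr (lift 3 C ⬝ var 2) (lift 3 C ⬝ var 1))))
    ⬝ lam A (lam (lift 1 C ⬝ var 0) (var 0))
    ⬝ x ⬝ y ⬝ p ⬝ u

/-- For `C : A → U` and `f : ∏ (x : A), C x` and `p : x =_A y`, the dependent application
`apd_f p : p_* (f x) =_{C y} f y`, defined by path induction. -/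
def apd (A C f x y p : Tm) : Tm :=
  Tm.const .idInd ⬝ A
    ⬝ lam A (lam (lift 1 A) (lam (idt (lift 2 A) (var 1) (var 0))
        (idt (lift 3 C ⬝ var 1)
          (transport (lift 3 A) (lift 3 C) (var 2) (var 1) (var 0) (lift 3 f ⬝ var 2))
          (lift 3 f ⬝ var 1))))
    ⬝ lam A (rfl' (lift 1 C ⬝ var 0) (lift 1 f ⬝ var 0))
    ⬝ x ⬝ y ⬝ p

/-- For `f : A → B`, the type of homotopy sections of `f`: `∑ (g : B → A), ∏ (y : B), f (g y) = y`. -/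
def rinv (A B f : Tm) : Tm :=
  sig (arr B A) (pi (lift 1 B) (idt (lift 2 B) (lift 2 f ⬝ (var 1 ⬝ var 0)) (var 0)))

/-- For `f : A → B`, the type of homotopy retractions of `f`: `∑ (h : B → A), ∏ (x : A), h (f x) = x`. -/
def linv (A B f : Tm) : Tm :=
  sig (arr B A) (pi (lift 1 A) (idt (lift 2 A) (var 1 ⬝ (lift 2 f ⬝ var 0)) (var 0)))

/-- For `f : A → B`, the type `isequiv f`. -/
def isEquiv (A B f : Tm) : Tm := prod (rinv A B f) (linv A B f)

/-- The type `A ≃ B` of equivalences. -/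
def equiv (A B : Tm) : Tm := sig (arr A B) (isEquiv (lift 1 A) (lift 1 B) (var 0))

/-- The identity equivalence `A ≃ A`. -/
def idEquiv (A : Tm) : Tm :=
  let i : Tm := lam A (var 0)
  let r : Tm := lam A (rfl' (lift 1 A) (var 0))
  mkPair (arr A A) (isEquiv (lift 1 A) (lift 1 A) (var 0)) i
    (mkPair (rinv A A i) (lift 1 (linv A A i))
      (mkPair (arr A A)
        (pi (lift 1 A) (idt (lift 2 A) (lift 2 i ⬝ (var 1 ⬝ var 0)) (var 0))) i r)
      (mkPair (arr A A)
        (pi (lift 1 A) (idt (lift 2 A) (var 1 ⬝ (lift 2 i ⬝ var 0)) (var 0))) i r))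

/-- For `A B : U_i`, the function `idtoeqv : (A =_{U_i} B) → (A ≃ B)`, defined by path induction. -/
def idToEquiv (i : ℕ) (A B : Tm) : Tm :=
  lam (idt (univ i) A B)
    (Tm.const .idInd ⬝ univ i
      ⬝ lam (univ i) (lam (univ i) (lam (idt (univ i) (var 1) (var 0)) (equiv (var 2) (var 1))))
      ⬝ lam (univ i) (idEquiv (var 0))
      ⬝ lift 1 A ⬝ lift 1 B ⬝ var 0)

/-- For `B : A → U`, the type `∏ (x : A), B x`. -/
def piFam (A B : Tm) : Tm := pi A (lift 1 B ⬝ var 0)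

/-- For `B : A → U` and `f g : ∏ (x : A), B x`, the type of homotopies `∏ (x : A), f x = g x`. -/
def homotopy (A B f g : Tm) : Tm :=
  pi A (idt (lift 1 B ⬝ var 0) (lift 1 f ⬝ var 0) (lift 1 g ⬝ var 0))

/-- For `B : A → U` and `f g : ∏ (x : A), B x`, the function
`happly : (f = g) → ∏ (x : A), f x = g x`, defined by path induction. -/
def happly (A B f g : Tm) : Tm :=
  lam (idt (piFam A B) f g)
    (Tm.const .idInd ⬝ piFam (lift 1 A) (lift 1 B)
      ⬝ lam (piFam (lift 1 A) (lift 1 B)) (lam (piFam (lift 2 A) (lift 2 B))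
          (lam (idt (piFam (lift 3 A) (lift 3 B)) (var 1) (var 0))
            (homotopy (lift 4 A) (lift 4 B) (var 2) (var 1))))
      ⬝ lam (piFam (lift 1 A) (lift 1 B))
          (lam (lift 2 A) (rfl' (lift 3 B ⬝ var 0) (var 1 ⬝ var 0)))
      ⬝ lift 1 f ⬝ lift 1 g ⬝ var 0)

/-! ### The types of the constants -/

/-- The (closed) type of each constant.  A constant has one such type for all universe levels `i`
(of the types it is about) and `j` (of the family into which an induction principle eliminates). -/
def Const.type (i j : ℕ) : Const → Tm
  /- `∏ (A : U_i), (A → U_i) → U_i` -/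
  | .Sigma => pi (univ i) (arr (arr (var 0) (univ i)) (univ i))
  /- `∏ (A : U_i) (B : A → U_i) (a : A), B a → ∑ (x : A), B x` -/
  | .pair => pi (univ i) (pi (arr (var 0) (univ i)) (pi (var 1)
      (arr (var 1 ⬝ var 0) (Tm.const .Sigma ⬝ var 2 ⬝ var 1))))
  /- `∏ (A : U_i) (B : A → U_i) (C : (∑ (x : A), B x) → U_j),
      (∏ (a : A) (b : B a), C (a, b)) → ∏ p, C p` -/
  | .sigmaInd => pi (univ i) (pi (arr (var 0) (univ i))
      (pi (arr (Tm.const .Sigma ⬝ var 1 ⬝ var 0) (univ j))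
        (arr
          (pi (var 2) (pi (var 2 ⬝ var 0)
            (var 2 ⬝ (Tm.const .pair ⬝ var 4 ⬝ var 3 ⬝ var 1 ⬝ var 0))))
          (pi (Tm.const .Sigma ⬝ var 2 ⬝ var 1) (var 1 ⬝ var 0)))))
  /- `U_i → U_i → U_i` -/
  | .Sum => arr (univ i) (arr (univ i) (univ i))
  /- `∏ (A B : U_i), A → A + B` -/
  | .inl => pi (univ i) (pi (univ i) (arr (var 1) (sum (var 1) (var 0))))
  /- `∏ (A B : U_i), B → A + B` -/
  | .inr => pi (univ i) (pi (univ i) (arr (var 0) (sum (var 1) (var 0))))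
  /- `∏ (A B : U_i) (C : A + B → U_j),
      (∏ (a : A), C (inl a)) → (∏ (b : B), C (inr b)) → ∏ s, C s` -/
  | .sumInd => pi (univ i) (pi (univ i) (pi (arr (sum (var 1) (var 0)) (univ j))
      (arr (pi (var 2) (var 1 ⬝ (Tm.const .inl ⬝ var 3 ⬝ var 2 ⬝ var 0)))
        (arr (pi (var 1) (var 1 ⬝ (Tm.const .inr ⬝ var 3 ⬝ var 2 ⬝ var 0)))
          (pi (sum (var 2) (var 1)) (var 1 ⬝ var 0))))))
  | .Empty => univ 0
  /- `∏ (C : 𝟎 → U_j) (x : 𝟎), C x` -/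
  | .emptyInd => pi (arr (Tm.const .Empty) (univ j)) (pi (Tm.const .Empty) (var 1 ⬝ var 0))
  | .Unit => univ 0
  | .star => Tm.const .Unit
  /- `∏ (C : 𝟏 → U_j), C ⋆ → ∏ (x : 𝟏), C x` -/
  | .unitInd => pi (arr (Tm.const .Unit) (univ j)) (arr (var 0 ⬝ Tm.const .star)
      (pi (Tm.const .Unit) (var 1 ⬝ var 0)))
  | .Nat => univ 0
  | .zero => Tm.const .Nat
  | .succ => arr (Tm.const .Nat) (Tm.const .Nat)
  /- `∏ (C : ℕ → U_j), C 0 → (∏ (n : ℕ), C n → C (n + 1)) → ∏ (n : ℕ), C n` -/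
  | .natInd => pi (arr (Tm.const .Nat) (univ j)) (arr (var 0 ⬝ Tm.const .zero)
      (arr (pi (Tm.const .Nat) (arr (var 1 ⬝ var 0) (var 1 ⬝ (Tm.const .succ ⬝ var 0))))
        (pi (Tm.const .Nat) (var 1 ⬝ var 0))))
  /- `∏ (A : U_i), A → A → U_i` -/
  | .Id => pi (univ i) (arr (var 0) (arr (var 0) (univ i)))
  /- `∏ (A : U_i) (a : A), a = a` -/
  | .refl => pi (univ i) (pi (var 0) (idt (var 1) (var 0) (var 0)))
  /- `∏ (A : U_i) (C : ∏ (x y : A), x = y → U_j),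
      (∏ (x : A), C x x refl_x) → ∏ (x y : A) (p : x = y), C x y p` -/
  | .idInd => pi (univ i)
      (pi (pi (var 0) (pi (var 1) (arr (idt (var 2) (var 1) (var 0)) (univ j))))
        (arr (pi (var 1) (var 1 ⬝ var 0 ⬝ var 0 ⬝ rfl' (var 2) (var 0)))
          (pi (var 1) (pi (var 2) (pi (idt (var 3) (var 1) (var 0))
            (var 3 ⬝ var 2 ⬝ var 1 ⬝ var 0))))))
  | .S1 => univ 0
  | .base => circle
  | .loop => idt circle (Tm.const .base) (Tm.const .base)
  /- `∏ (C : S¹ → U_j) (b : C base) (l : loop_* b = b) (x : S¹), C x` -/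
  | .s1Ind => pi (arr circle (univ j)) (pi (var 0 ⬝ Tm.const .base)
      (pi (idt (var 1 ⬝ Tm.const .base)
          (transport circle (var 1) (Tm.const .base) (Tm.const .base) (Tm.const .loop) (var 0))
          (var 0))
        (pi circle (var 3 ⬝ var 0))))
  /- `∏ (C : S¹ → U_j) (b : C base) (l : loop_* b = b), apd_{s1Ind C b l} loop = l` -/
  | .s1LoopComp => pi (arr circle (univ j)) (pi (var 0 ⬝ Tm.const .base)
      (pi (idt (var 1 ⬝ Tm.const .base)
          (transport circle (var 1) (Tm.const .base) (Tm.const .base) (Tm.const .loop) (var 0))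
          (var 0))
        (idt
          (idt (var 2 ⬝ Tm.const .base)
            (transport circle (var 2) (Tm.const .base) (Tm.const .base) (Tm.const .loop) (var 1))
            (var 1))
          (apd circle (var 2) (Tm.const .s1Ind ⬝ var 2 ⬝ var 1 ⬝ var 0)
            (Tm.const .base) (Tm.const .base) (Tm.const .loop))
          (var 0))))
  /- `∏ (A : U_i) (B : A → U_i) (f g : ∏ (x : A), B x), isequiv (happly f g)` -/
  | .funext => pi (univ i) (pi (arr (var 0) (univ i))
      (pi (piFam (var 1) (var 0)) (pi (piFam (var 2) (var 1))
        (isEquiv (idt (piFam (var 3) (var 2)) (var 1) (var 0))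
          (homotopy (var 3) (var 2) (var 1) (var 0))
          (happly (var 3) (var 2) (var 1) (var 0))))))
  /- `∏ (A B : U_i), isequiv (idtoeqv A B)` -/
  | .univalence => pi (univ i) (pi (univ i)
      (isEquiv (idt (univ i) (var 1) (var 0)) (equiv (var 1) (var 0))
        (idToEquiv i (var 1) (var 0))))

/-! ### Convertibility and typing -/

/-- Convertibility: the least congruence containing the computation rules. -/
inductive Conv : Tm → Tm → Prop
  | refl (t : Tm) : Conv t t
  | symm {t u : Tm} : Conv t u → Conv u t
  | trans {t u v : Tm} : Conv t u → Conv u v → Conv t v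
  | pi {A A' B B' : Tm} : Conv A A' → Conv B B' → Conv (pi A B) (pi A' B')
  | lam {A A' b b' : Tm} : Conv A A' → Conv b b' → Conv (lam A b) (lam A' b')
  | app {f f' a a' : Tm} : Conv f f' → Conv a a' → Conv (f ⬝ a) (f' ⬝ a')
  | beta (A b a : Tm) : Conv (lam A b ⬝ a) (b.inst a)
  | sigmaInd (A B C g A' B' a b : Tm) :
      Conv (Tm.const .sigmaInd ⬝ A ⬝ B ⬝ C ⬝ g ⬝ (Tm.const .pair ⬝ A' ⬝ B' ⬝ a ⬝ b)) (g ⬝ a ⬝ b)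
  | sumInd_inl (A B C l r A' B' a : Tm) :
      Conv (Tm.const .sumInd ⬝ A ⬝ B ⬝ C ⬝ l ⬝ r ⬝ (Tm.const .inl ⬝ A' ⬝ B' ⬝ a)) (l ⬝ a)
  | sumInd_inr (A B C l r A' B' b : Tm) :
      Conv (Tm.const .sumInd ⬝ A ⬝ B ⬝ C ⬝ l ⬝ r ⬝ (Tm.const .inr ⬝ A' ⬝ B' ⬝ b)) (r ⬝ b)
  | unitInd (C c : Tm) : Conv (Tm.const .unitInd ⬝ C ⬝ c ⬝ Tm.const .star) c
  | natInd_zero (C z s : Tm) : Conv (Tm.const .natInd ⬝ C ⬝ z ⬝ s ⬝ Tm.const .zero) z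
  | natInd_succ (C z s n : Tm) :
      Conv (Tm.const .natInd ⬝ C ⬝ z ⬝ s ⬝ (Tm.const .succ ⬝ n))
        (s ⬝ n ⬝ (Tm.const .natInd ⬝ C ⬝ z ⬝ s ⬝ n))
  | idInd (A C c x y A' z : Tm) :
      Conv (Tm.const .idInd ⬝ A ⬝ C ⬝ c ⬝ x ⬝ y ⬝ (Tm.const .refl ⬝ A' ⬝ z)) (c ⬝ z)
  | s1Ind (C b l : Tm) : Conv (Tm.const .s1Ind ⬝ C ⬝ b ⬝ l ⬝ Tm.const .base) b

/-- The judgment `Γ ⊢ t : A`.  A context is the list of the types of its variables, innermost first;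
each of these types lives in the context formed by the rest of the list. -/
inductive Typed : List Tm → Tm → Tm → Prop
  | univ (i : ℕ) : Typed [] (univ i) (univ (i + 1))
  | const (c : Const) (i j : ℕ) : Typed [] (Tm.const c) (c.type i j)
  | var {Γ : List Tm} {A : Tm} {i : ℕ} :
      Typed Γ A (univ i) → Typed (A :: Γ) (var 0) (lift 1 A)
  | weaken {Γ : List Tm} {A t B : Tm} {i : ℕ} :
      Typed Γ A (univ i) → Typed Γ t B → Typed (A :: Γ) (lift 1 t) (lift 1 B)
  | pi {Γ : List Tm} {A B : Tm} {i : ℕ} :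
      Typed Γ A (univ i) → Typed (A :: Γ) B (univ i) → Typed Γ (pi A B) (univ i)
  | lam {Γ : List Tm} {A b B : Tm} {i : ℕ} :
      Typed Γ (pi A B) (univ i) → Typed (A :: Γ) b B → Typed Γ (lam A b) (pi A B)
  | app {Γ : List Tm} {f a A B : Tm} :
      Typed Γ f (pi A B) → Typed Γ a A → Typed Γ (f ⬝ a) (B.inst a)
  | conv {Γ : List Tm} {t A B : Tm} {i : ℕ} :
      Typed Γ t A → Typed Γ B (univ i) → Conv A B → Typed Γ t B
  | cumul {Γ : List Tm} {A : Tm} {i : ℕ} : Typed Γ A (univ i) → Typed Γ A (univ (i + 1))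

/-- A closed type is inhabited if some closed term has it. -/
def IsInhabited (A : Tm) : Prop := ∃ t : Tm, Typed [] t A

end HoTT

/-!
# Self-identifications of the circle

The theorem is proved by reflection.  A type checker for terms with universe annotations and references to
global declarations is shown to be sound for the judgment `Typed`; the equivalence is developed in a
typed syntax for such terms, and the checker is run on the development inside the kernel.  The
universe `U_i` is reached from `U_0` by shifting all universes.
-/

namespace HoTT
open Tm (var univ pi lam lift)

/-! ### Substitution -/

namespace Tm

/-! By univalence an identification of the circle with itself is a self-equivalence, so the task is
to classify self-maps. A map `f` out of the circle is determined by the point `x = f base` and the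
loop `ap f loop` at `x`. The circle has a distinguished loop `ell x` at each point, because `loop`
commutes with itself and hence extends along the circle. Encode-decode for the universal cover
(`powEnc`, `encPow`) shows that every loop at `base` is a power of `loop` with a unique integer
exponent. As the circle is connected, every loop at `x` is then a power of `ell x` with a unique
exponent (`degDef`). So `f` is homotopic to the standard map `rot n x`, where `n` is its degree
(`rotUnique`).

If `g` is a left inverse of `rot n x`, then `ell (g x)` is the `n`-th power of `ap g (ell x)`. At
the base point this says that `loop` is an `n`-th power, which forces `n = 1` or `n = -1`
(`unitOfIsEqv`). Conversely `rot 1 base` is homotopic to the identity and `rot (-1) base` is an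
involution; being an equivalence is a proposition, so connectedness gives the same for every `x`.
Thus a self-equivalence amounts to a sign and a point, and `classify` and `realize` are inverse to
each other. Univalence enters three times: it builds the cover, it shows that being an equivalence
is a proposition (`isPropIsEqv`), and it shows that identifications with homotopic coercions agree
(`eqOfCoe`).

The passage from an accepted term to a derivation is `tc_sound`. It rests on the substitution lemma
and on inversion for products; confluence, normalization and subject reduction are avoided, since
recursion depth is bounded and types produced by reduction are checked again where needed. The
development takes place over `U_0`; `Typed.shift` carries the resulting derivation to `U_i`. -/

theorem upRen_comp (ρ ρ' : ℕ → ℕ) : upRen ρ ∘ upRen ρ' = upRen (ρ ∘ ρ') := by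
  funext n; cases n <;> rfl

theorem rename_rename (ρ ρ' : ℕ → ℕ) (t : Tm) : rename ρ (rename ρ' t) = rename (ρ ∘ ρ') t := by
  induction t generalizing ρ ρ' <;> simp_all [rename, upRen_comp]

theorem upSub_comp_upRen (σ : ℕ → Tm) (ρ : ℕ → ℕ) : upSub σ ∘ upRen ρ = upSub (σ ∘ ρ) := by
  funext n; cases n <;> rfl

theorem subst_rename (σ : ℕ → Tm) (ρ : ℕ → ℕ) (t : Tm) : subst σ (rename ρ t) = subst (σ ∘ ρ) t := by
  induction t generalizing σ ρ <;> simp_all [rename, subst, upSub_comp_upRen]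

theorem rename_upRen_lift (ρ : ℕ → ℕ) (t : Tm) : rename (upRen ρ) (lift 1 t) = lift 1 (rename ρ t) := by
  simp only [lift, rename_rename]; rfl

theorem rename_comp_upSub (ρ : ℕ → ℕ) (σ : ℕ → Tm) :
    rename (upRen ρ) ∘ upSub σ = upSub (rename ρ ∘ σ) := by
  funext n; cases n
  · rfl
  · exact rename_upRen_lift _ _

theorem rename_subst (ρ : ℕ → ℕ) (σ : ℕ → Tm) (t : Tm) :
    rename ρ (subst σ t) = subst (rename ρ ∘ σ) t := by
  induction t generalizing σ ρ <;> simp_all [rename, subst, rename_comp_upSub]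

theorem subst_upSub_lift (σ : ℕ → Tm) (t : Tm) : subst (upSub σ) (lift 1 t) = lift 1 (subst σ t) := by
  simp only [lift, subst_rename, rename_subst]; rfl

theorem subst_comp_upSub (τ σ : ℕ → Tm) : subst (upSub τ) ∘ upSub σ = upSub (subst τ ∘ σ) := by
  funext n; cases n
  · rfl
  · exact subst_upSub_lift _ _

theorem subst_subst (τ σ : ℕ → Tm) (t : Tm) : subst τ (subst σ t) = subst (subst τ ∘ σ) t := by
  induction t generalizing σ τ <;> simp_all [subst, subst_comp_upSub]

theorem upSub_var : upSub var = var := by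
  funext n; cases n <;> rfl

theorem subst_var (t : Tm) : subst var t = t := by
  induction t <;> simp_all [subst, upSub_var]

theorem rename_eq_subst (ρ : ℕ → ℕ) (t : Tm) : rename ρ t = subst (var ∘ ρ) t := by
  rw [← subst_rename, subst_var]

theorem subst_lift (σ : ℕ → Tm) (k : ℕ) (t : Tm) : subst σ (lift k t) = subst (fun n => σ (n + k)) t :=
  subst_rename _ _ _

theorem inst_lift (t a : Tm) : (lift 1 t).inst a = t := by
  rw [inst, subst_lift]; exact subst_var t

theorem subst_inst (σ : ℕ → Tm) (b a : Tm) :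
    subst σ (b.inst a) = (subst (upSub σ) b).inst (subst σ a) := by
  rw [inst, inst, subst_subst, subst_subst]
  congr 1; funext n; cases n
  · rfl
  · exact (inst_lift _ _).symm

end Tm

open Tm

theorem Const.subst_type (σ : ℕ → Tm) (i j : ℕ) (c : Const) : subst σ (c.type i j) = c.type i j := by
  cases c <;> rfl

theorem Conv.subst {t u : Tm} (h : Conv t u) (σ : ℕ → Tm) : Conv (subst σ t) (subst σ u) := by
  induction h generalizing σ with
  | refl t => exact .refl _
  | symm _ ih => exact .symm (ih σ)
  | trans _ _ ih ih' => exact .trans (ih σ) (ih' σ)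
  | pi _ _ ih ih' => exact .pi (ih _) (ih' _)
  | lam _ _ ih ih' => exact .lam (ih _) (ih' _)
  | app _ _ ih ih' => exact .app (ih _) (ih' _)
  | beta A b a => rw [subst_inst]; exact .beta _ _ _
  | sigmaInd => exact .sigmaInd ..
  | sumInd_inl => exact .sumInd_inl ..
  | sumInd_inr => exact .sumInd_inr ..
  | unitInd => exact .unitInd ..
  | natInd_zero => exact .natInd_zero ..
  | natInd_succ => exact .natInd_succ ..
  | idInd => exact .idInd ..
  | s1Ind => exact .s1Ind ..

/-! ### Admissible rules -/

/-- Well-formed contexts. -/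
inductive Wf : List Tm → Prop
  | nil : Wf []
  | cons {Γ : List Tm} {A : Tm} {i : ℕ} : Wf Γ → Typed Γ A (univ i) → Wf (A :: Γ)

theorem Typed.wf {Γ : List Tm} {t A : Tm} (h : Typed Γ t A) : Wf Γ := by
  induction h with
  | univ | const => exact .nil
  | var h ih | weaken h _ ih => exact .cons ih h
  | pi _ _ ih | lam _ _ ih | app _ _ ih | conv _ _ _ ih | cumul _ ih => exact ih

/-- The rules for universes and constants are stated in the empty context only. Weakening once per
variable brings them to `Γ`, and each weakening is a substitution, which fixes the closed terms. -/
theorem Wf.typed_of_closed {Γ : List Tm} (h : Wf Γ) {t A : Tm} (ht : Typed [] t A)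
    (hct : ∀ σ, subst σ t = t) (hcA : ∀ σ, subst σ A = A) : Typed Γ t A := by
  induction h with
  | nil => exact ht
  | cons _ hA ih =>
    have := Typed.weaken hA ih
    rwa [lift, lift, rename_eq_subst, rename_eq_subst, hct, hcA] at this

/-- `σ` is a substitution from the context `Γ` to the context `Δ`. -/
def SubTyped (Δ : List Tm) (σ : ℕ → Tm) (Γ : List Tm) : Prop :=
  ∀ n A, Γ[n]? = some A → Typed Δ (σ n) (subst σ (lift (n + 1) A))

theorem SubTyped.tail {Δ Γ : List Tm} {σ : ℕ → Tm} {A : Tm} (h : SubTyped Δ σ (A :: Γ)) :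
    SubTyped Δ (fun n => σ (n + 1)) Γ := by
  intro n B hB
  have := h (n + 1) B (by simpa using hB)
  rw [subst_lift] at this ⊢
  exact this

theorem SubTyped.up {Δ Γ : List Tm} {σ : ℕ → Tm} {A : Tm} {i : ℕ} (h : SubTyped Δ σ Γ)
    (hA : Typed Δ (subst σ A) (univ i)) : SubTyped (subst σ A :: Δ) (upSub σ) (A :: Γ) := by
  intro n B hB
  cases n with
  | zero =>
    obtain rfl : A = B := by simpa using hB
    rw [subst_upSub_lift]
    exact .var hA
  | succ n =>
    have := Typed.weaken hA (h n B (by simpa using hB))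
    rw [← subst_upSub_lift] at this
    have e : lift 1 (lift (n + 1) B) = lift (n + 1 + 1) B := by
      simp only [lift, rename_rename]; rfl
    rwa [e] at this

/-- The rule for abstractions has the typing of the product as premise, but going under the binder
requires the domain to be a type after substitution. Inversion for products is itself derived from
substitution, so the induction carries the statement about domains along. -/
theorem Typed.subst_aux {Γ : List Tm} {t A : Tm} (h : Typed Γ t A) :
    ∀ {Δ : List Tm} {σ : ℕ → Tm}, Wf Δ → SubTyped Δ σ Γ →
      Typed Δ (Tm.subst σ t) (Tm.subst σ A) ∧
        ∀ C D, t = Tm.pi C D → ∃ i, Typed Δ (Tm.subst σ C) (Tm.univ i) := by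
  induction h with
  | univ i => exact fun hΔ _ => ⟨hΔ.typed_of_closed (.univ i) (fun _ => rfl) (fun _ => rfl), by simp⟩
  | const c i j =>
    refine fun hΔ _ => ⟨?_, by simp⟩
    rw [Const.subst_type]
    exact hΔ.typed_of_closed (.const c i j) (fun _ => rfl) (fun _ => Const.subst_type ..)
  | var => exact fun _ hσ => ⟨hσ 0 _ rfl, by simp⟩
  | @weaken _ _ t _ _ _ _ _ ih =>
    intro Δ σ hΔ hσ
    obtain ⟨h₁, h₂⟩ := ih hΔ hσ.tail
    rw [subst_lift, subst_lift]
    refine ⟨h₁, fun C D e => ?_⟩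
    cases t <;> simp only [lift, rename, reduceCtorEq, Tm.pi.injEq] at e
    obtain ⟨rfl, rfl⟩ := e
    rw [subst_rename]
    exact h₂ _ _ rfl
  | pi _ _ ih ih' =>
    intro Δ σ hΔ hσ
    have hA := (ih hΔ hσ).1
    refine ⟨.pi hA (ih' (.cons hΔ hA) (hσ.up hA)).1, fun C D e => ?_⟩
    cases e
    exact ⟨_, hA⟩
  | lam _ _ ih ih' =>
    intro Δ σ hΔ hσ
    obtain ⟨i, hA⟩ := (ih hΔ hσ).2 _ _ rfl
    exact ⟨.lam (ih hΔ hσ).1 (ih' (.cons hΔ hA) (hσ.up hA)).1, by simp⟩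
  | app _ _ ih ih' =>
    intro Δ σ hΔ hσ
    rw [subst_inst]
    exact ⟨.app (ih hΔ hσ).1 (ih' hΔ hσ).1, by simp⟩
  | conv _ _ hc ih ih' =>
    exact fun hΔ hσ => ⟨.conv (ih hΔ hσ).1 (ih' hΔ hσ).1 (hc.subst _), (ih hΔ hσ).2⟩
  | cumul _ ih => exact fun hΔ hσ => ⟨.cumul (ih hΔ hσ).1, (ih hΔ hσ).2⟩

/-- The substitution lemma. -/
theorem Typed.subst {Γ Δ : List Tm} {t A : Tm} {σ : ℕ → Tm} (h : Typed Γ t A) (hΔ : Wf Δ)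
    (hσ : SubTyped Δ σ Γ) : Typed Δ (Tm.subst σ t) (Tm.subst σ A) :=
  (h.subst_aux hΔ hσ).1

theorem Wf.subTyped_var {Γ : List Tm} (h : Wf Γ) : SubTyped Γ Tm.var Γ := by
  induction h with
  | nil => intro n A h; simp at h
  | cons hΓ hA ih =>
    have := ih.up (A := _) (by rw [subst_var]; exact hA)
    rwa [upSub_var, subst_var] at this

theorem Typed.inst {Γ : List Tm} {A b B a : Tm} (hb : Typed (A :: Γ) b B) (ha : Typed Γ a A) :
    Typed Γ (b.inst a) (B.inst a) := by
  refine hb.subst ha.wf fun n C hC => ?_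
  cases n with
  | zero =>
    obtain rfl : A = C := by simpa using hC
    rw [show Tm.subst a.single (lift (0 + 1) A) = A from inst_lift A a]
    exact ha
  | succ n =>
    have := ha.wf.subTyped_var n C (by simpa using hC)
    rw [subst_lift] at this ⊢
    exact this

/-- A derivation for a product ends in the formation rule, up to weakening, conversion and
cumulativity. Only weakening needs work: the codomain has one more variable, over which weakening is
the substitution lifted by `upSub`, and the substitution lemma applies. -/
theorem Typed.pi_inv {Γ : List Tm} {t T : Tm} (h : Typed Γ t T) {A B : Tm} (e : t = Tm.pi A B) :
    (∃ i, Typed Γ A (Tm.univ i)) ∧ ∃ i, Typed (A :: Γ) B (Tm.univ i) := by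
  induction h generalizing A B with
  | univ | const | var | lam | app => simp at e
  | @weaken Γ C t _ _ hC _ _ ih =>
    cases t <;> simp only [lift, rename, reduceCtorEq, Tm.pi.injEq] at e
    obtain ⟨rfl, rfl⟩ := e
    obtain ⟨⟨i, hA⟩, ⟨j, hB⟩⟩ := ih rfl
    have hA' := Typed.weaken hC hA
    have e (t : Tm) : Tm.subst (fun n => Tm.var (n + 1)) t = lift 1 t := (rename_eq_subst _ _).symm
    have hs : SubTyped (C :: Γ) (fun n => Tm.var (n + 1)) Γ :=
      (Wf.subTyped_var (.cons hC.wf hC)).tail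
    have := hB.subst (.cons (.cons hC.wf hC) (by rw [e]; exact hA')) (hs.up (by rw [e]; exact hA'))
    rw [e] at this
    refine ⟨⟨i, hA'⟩, j, ?_⟩
    have e' : Tm.var ∘ upRen (fun n => n + 1) = upSub fun n => Tm.var (n + 1) := by
      funext n; cases n <;> rfl
    rw [rename_eq_subst (upRen _), e']
    exact this
  | pi hA hB => cases e; exact ⟨⟨_, hA⟩, _, hB⟩
  | conv _ _ _ ih | cumul _ ih => exact ih e

/-- The free variables of a typed term are among those of its context. In the empty context this
makes substitution trivial (`subst_closed`), so that references can stand for closed terms under any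
number of binders. -/
theorem Typed.subst_congr {Γ : List Tm} {t A : Tm} (h : Typed Γ t A) :
    ∀ {σ τ : ℕ → Tm}, (∀ n < Γ.length, σ n = τ n) → Tm.subst σ t = Tm.subst τ t := by
  have up {n : ℕ} {σ τ : ℕ → Tm} (h : ∀ k < n, σ k = τ k) : ∀ k < n + 1, upSub σ k = upSub τ k := by
    intro k hk
    cases k with
    | zero => rfl
    | succ k => simp [upSub, h k (by omega)]
  induction h with
  | univ | const => intros; rfl
  | var => exact fun h => h 0 (by simp)
  | weaken _ _ _ ih =>
    intro σ τ h
    rw [subst_lift, subst_lift]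
    exact ih fun n hn => h (n + 1) (by simpa using hn)
  | pi _ _ ih ih' => intro σ τ h; simp only [Tm.subst]; rw [ih h, ih' (up h)]
  | lam _ _ ih ih' =>
    intro σ τ h
    -- The product is a premise of the rule and its domain is not, so agreement on the domain is
    -- read off from agreement on the product.
    have := ih h
    simp only [Tm.subst, Tm.pi.injEq, Tm.lam.injEq] at this ⊢
    exact ⟨this.1, ih' (up h)⟩
  | app _ _ ih ih' => intro σ τ h; simp only [Tm.subst]; rw [ih h, ih' h]
  | conv _ _ _ ih | cumul _ ih => exact ih

theorem Typed.subst_closed {t A : Tm} (h : Typed [] t A) (σ : ℕ → Tm) : Tm.subst σ t = t := by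
  rw [h.subst_congr (τ := Tm.var) (by simp), subst_var]

theorem Typed.cumul_le {Γ : List Tm} {A : Tm} {i j : ℕ} (h : Typed Γ A (Tm.univ i)) (hij : i ≤ j) :
    Typed Γ A (Tm.univ j) := by
  induction hij with
  | refl => exact h
  | step _ ih => exact ih.cumul

theorem Wf.univ {Γ : List Tm} (h : Wf Γ) (i : ℕ) : Typed Γ (Tm.univ i) (Tm.univ (i + 1)) :=
  h.typed_of_closed (.univ i) (fun _ => rfl) (fun _ => rfl)

/-! ### Shifting universes -/

namespace Tm

/-- Raise all universes by `k`. -/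
def shift (k : ℕ) : Tm → Tm
  | var n => var n
  | univ i => univ (i + k)
  | pi A B => pi (shift k A) (shift k B)
  | lam A b => lam (shift k A) (shift k b)
  | app f a => app (shift k f) (shift k a)
  | const c => const c

theorem shift_rename (k : ℕ) (ρ : ℕ → ℕ) (t : Tm) : shift k (rename ρ t) = rename ρ (shift k t) := by
  induction t generalizing ρ <;> simp_all [rename, shift]

theorem shift_comp_upSub (k : ℕ) (σ : ℕ → Tm) : shift k ∘ upSub σ = upSub (shift k ∘ σ) := by
  funext n; cases n
  · rfl
  · exact shift_rename _ _ _

theorem shift_subst (k : ℕ) (σ : ℕ → Tm) (t : Tm) :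
    shift k (subst σ t) = subst (shift k ∘ σ) (shift k t) := by
  induction t generalizing σ <;> simp_all [subst, shift, shift_comp_upSub]

theorem shift_inst (k : ℕ) (b a : Tm) : shift k (b.inst a) = (shift k b).inst (shift k a) := by
  rw [inst, shift_subst, inst]
  congr 1; funext n; cases n <;> rfl

end Tm

theorem Conv.shift {t u : Tm} (h : Conv t u) (k : ℕ) : Conv (t.shift k) (u.shift k) := by
  induction h with
  | refl t => exact .refl _
  | symm _ ih => exact .symm ih
  | trans _ _ ih ih' => exact .trans ih ih'
  | pi _ _ ih ih' => exact .pi ih ih'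
  | lam _ _ ih ih' => exact .lam ih ih'
  | app _ _ ih ih' => exact .app ih ih'
  | beta A b a => rw [shift_inst]; exact .beta _ _ _
  | sigmaInd => exact .sigmaInd ..
  | sumInd_inl => exact .sumInd_inl ..
  | sumInd_inr => exact .sumInd_inr ..
  | unitInd => exact .unitInd ..
  | natInd_zero => exact .natInd_zero ..
  | natInd_succ => exact .natInd_succ ..
  | idInd => exact .idInd ..
  | s1Ind => exact .s1Ind ..

/-- The types of the constants are uniform in the levels, so shifting only changes `i` and `j`. The
four basic types are the exception: they are declared in `U_0` and reach `U_k` by cumulativity. -/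
theorem Const.typed_shift (k : ℕ) (c : Const) (i j : ℕ) :
    Typed [] (Tm.const c) ((c.type i j).shift k) := by
  have h := Typed.const c (i + k) (j + k)
  have h₀ := Typed.const c i j
  cases c
  case Empty | Unit | Nat | S1 => exact h₀.cumul_le (Nat.zero_le _)
  all_goals exact h

theorem Typed.shift {Γ : List Tm} {t A : Tm} (h : Typed Γ t A) (k : ℕ) :
    Typed (Γ.map (Tm.shift k)) (t.shift k) (A.shift k) := by
  induction h with
  | univ i =>
    have := Typed.univ (i + k)
    rwa [Nat.add_right_comm] at this
  | const c i j => exact c.typed_shift k i j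
  | var _ ih => rw [lift, shift_rename]; exact .var ih
  | weaken _ _ ih ih' => rw [lift, lift, shift_rename, shift_rename]; exact .weaken ih ih'
  | pi _ _ ih ih' => exact .pi ih ih'
  | lam _ _ ih ih' => exact .lam ih ih'
  | app _ _ ih ih' => rw [shift_inst]; exact .app ih ih'
  | conv _ _ h ih ih' => exact .conv ih ih' (h.shift k)
  | cumul _ ih =>
    have := ih.cumul
    simp only [Tm.shift] at this ⊢
    rwa [Nat.add_right_comm]

end HoTT

namespace HoTT
noncomputable section

/-! ### The type checker

The functions which the kernel evaluates most often are written with recursors. -/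

/-- Terms with levels at the constants and references to global declarations. -/
inductive Ex : Type
  | var (n : ℕ)
  | univ (i : ℕ)
  | pi (A B : Ex)
  | lam (A b : Ex)
  | app (f a : Ex)
  | const (c : Const) (i j : ℕ)
  | ref (k : ℕ)

namespace Ex

/-- `liftAt k t c` adds `k` to the variables of `t` from `c` on. -/
def liftAt (k : ℕ) (t : Ex) : ℕ → Ex :=
  Ex.rec (motive := fun _ => ℕ → Ex)
    (fun n c => bif Nat.blt n c then var n else var (Nat.add n k))
    (fun i _ => univ i)
    (fun _ _ A B c => pi (A c) (B (Nat.succ c)))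
    (fun _ _ A B c => lam (A c) (B (Nat.succ c)))
    (fun _ _ A B c => app (A c) (B c))
    (fun c i j _ => const c i j)
    (fun r _ => ref r) t

/-- `instAt s t c` replaces the variable `c` of `t` by `s` and lowers the later ones. -/
def instAt (s : Ex) (t : Ex) : ℕ → Ex :=
  Ex.rec (motive := fun _ => ℕ → Ex)
    (fun n c => bif Nat.blt n c then var n else bif Nat.beq n c then liftAt c s 0 else var (Nat.pred n))
    (fun i _ => univ i)
    (fun _ _ A B c => pi (A c) (B (Nat.succ c)))
    (fun _ _ A B c => lam (A c) (B (Nat.succ c)))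
    (fun _ _ A B c => app (A c) (B c))
    (fun c i j _ => const c i j)
    (fun r _ => ref r) t

/-- Syntactic equality up to the levels of constants. -/
def eqb (a : Ex) : Ex → Bool :=
  Ex.rec (motive := fun _ => Ex → Bool)
    (fun n b => match b with | var m => Nat.beq n m | _ => false)
    (fun n b => match b with | univ m => Nat.beq n m | _ => false)
    (fun _ _ A B b => match b with | pi A' B' => A A' && B B' | _ => false)
    (fun _ _ A B b => match b with | lam A' B' => A A' && B B' | _ => false)
    (fun _ _ A B b => match b with | app A' B' => A A' && B B' | _ => false)
    (fun c _ _ b => match b with | const c' _ _ => Nat.beq c.ctorIdx c'.ctorIdx | _ => false)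
    (fun n b => match b with | ref m => Nat.beq n m | _ => false) a

/-- The level at which the families in the type of `c` are typed. -/
def famLevel (i j : ℕ) : Const → ℕ
  | .pair => i
  | .sigmaInd => i
  | .s1LoopComp => j
  | _ => 1

/-- Annotate the constants of a term with levels: `l` for those which take a family as a variable. -/
def ofTm (l : ℕ) : Tm → Ex
  | .var n => var n
  | .univ i => univ i
  | .pi A B => pi (ofTm l A) (ofTm l B)
  | .lam A B => lam (ofTm l A) (ofTm l B)
  | .app A B => app (ofTm l A) (ofTm l B)
  | .const .Sigma => const .Sigma l l
  | .const .pair => const .pair l l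
  | .const .s1Ind => const .s1Ind l l
  | .const c => const c 1 1

/-- Application to a list of arguments. -/
def apps : Ex → List Ex → Ex
  | h, [] => h
  | h, a :: l => apps (app h a) l

end Ex

/-- A global declaration; it is never unfolded if `opq` is set. -/
structure Decl where
  id : ℕ
  opq : Bool
  ty : Ex
  tm : Ex

/-- A global environment: the number of known constants, and the declarations, latest first. -/
structure Env where
  consts : ℕ
  decls : List Decl

/-- The declaration with the given number. -/
def lookupDecl : List Decl → ℕ → Option Decl
  | [], _ => none
  | d :: l, k => bif Nat.beq d.id k then some d else lookupDecl l k

/-- The definition of a transparent reference. -/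
def unfoldRef (E : Env) (k : ℕ) : Option Ex :=
  match lookupDecl E.decls k with
  | none => none
  | some d => bif d.opq then none else some d.tm

open Ex

/-- One computation step of an eliminator applied to `st`, where `w` computes weak head normal forms. -/
def iota (c : Const) (st : List Ex) (w : Ex → List Ex → Ex × List Ex) : Option (Ex × List Ex) :=
  match c with
  | .sigmaInd => match st with
    | _ :: _ :: _ :: g :: p :: r => match w p [] with
      | (.const .pair _ _, [_, _, a, b]) => some (g, a :: b :: r)
      | _ => none
    | _ => none
  | .sumInd => match st with
    | _ :: _ :: _ :: f :: g :: p :: r => match w p [] with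
      | (.const .inl _ _, [_, _, a]) => some (f, a :: r)
      | (.const .inr _ _, [_, _, a]) => some (g, a :: r)
      | _ => none
    | _ => none
  | .unitInd => match st with
    | _ :: c :: p :: r => match w p [] with
      | (.const .star _ _, []) => some (c, r)
      | _ => none
    | _ => none
  | .natInd => match st with
    | C :: z :: s :: p :: r => match w p [] with
      | (.const .zero _ _, []) => some (z, r)
      -- The levels `0 0` of the recursive call are arbitrary: convertibility concerns erased terms,
      -- which carry no levels.
      | (.const .succ _ _, [n]) =>
        some (s, n :: app (app (app (app (const .natInd 0 0) C) z) s) n :: r)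
      | _ => none
    | _ => none
  | .idInd => match st with
    | _ :: _ :: c :: _ :: _ :: p :: r => match w p [] with
      | (.const .refl _ _, [_, z]) => some (c, z :: r)
      | _ => none
    | _ => none
  | .s1Ind => match st with
    | _ :: b :: _ :: p :: r => match w p [] with
      | (.const .base _ _, []) => some (b, r)
      | _ => none
    | _ => none
  | _ => none

/-- Weak head reduction of `h` applied to `st`, with `w` for the recursive calls; references are unfolded
if `δ` is set. -/
def whnfStep (E : Env) (w : Bool → Ex → List Ex → Ex × List Ex) (δ : Bool) (h : Ex)
    (st : List Ex) : Ex × List Ex :=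
  match h with
  | .app f a => w δ f (a :: st)
  | .lam A b => match st with
    | [] => (.lam A b, [])
    | a :: st => w δ (instAt a b 0) st
  | .ref k => bif δ then (match unfoldRef E k with
      | some t => w δ t st
      | none => (.ref k, st)) else (.ref k, st)
  | .const c i j => match iota c st (w true) with
    | some (h', st') => w δ h' st'
    | none => (.const c i j, st)
  | h => (h, st)

/-- Weak head reduction with at most `n` steps. -/
def whnf (E : Env) (n : ℕ) : Bool → Ex → List Ex → Ex × List Ex :=
  Nat.rec (motive := fun _ => Bool → Ex → List Ex → Ex × List Ex) (fun _ h st => (h, st))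
    (fun _ w => whnfStep E w) n

/-- Pointwise comparison of lists of the same length. -/
def all2 (r : Ex → Ex → Bool) : List Ex → List Ex → Bool
  | [], [] => true
  | a :: l, b :: m => r a b && all2 r l m
  | _, _ => false

/-- Convertibility of `a` and `b`, with `r` for the recursive calls. -/
def convStep (E : Env) (r : Ex → Ex → Bool) (a b : Ex) : Bool :=
  eqb a b ||
  match whnf E 200 false a [], whnf E 200 false b [] with
  | (h, s), (h', s') =>
    match h, h' with
    | .lam A b, .lam A' b' => r A A' && r b b' && all2 (r) s s'
    | .pi A b, .pi A' b' => r A A' && r b b' && all2 (r) s s'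
    | .univ i, .univ j => Nat.beq i j && all2 (r) s s'
    | .var i, .var j => Nat.beq i j && all2 (r) s s'
    | .const i _ _, .const j _ _ => Nat.beq i.ctorIdx j.ctorIdx && all2 (r) s s'
    | .ref k, .ref k' =>
      bif Nat.beq k k' then all2 (r) s s' ||
        (match unfoldRef E k with
          | some t => r (apps t s) (apps t s')
          | none => false)
      -- A later declaration may mention an earlier one but not conversely, so the later one is
      -- unfolded first.
      else bif Nat.blt k k' then
        (match unfoldRef E k' with
          | some t => r (apps h s) (apps t s')
          | none => match unfoldRef E k with
            | some t => r (apps t s) (apps h' s')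
            | none => false)
      else
        (match unfoldRef E k with
          | some t => r (apps t s) (apps h' s')
          | none => match unfoldRef E k' with
            | some t => r (apps h s) (apps t s')
            | none => false)
    | .ref k, _ => match unfoldRef E k with
          | some t => r (apps t s) (apps h' s')
          | none => false
    | _, .ref k' => match unfoldRef E k' with
          | some t => r (apps h s) (apps t s')
          | none => false
    | _, _ => false

/-- Convertibility, with recursion depth `n`. -/
def conv (E : Env) (n : ℕ) : Ex → Ex → Bool :=
  Nat.rec (motive := fun _ => Ex → Ex → Bool) (fun _ _ => false) (fun _ r => convStep E r) n

/-- Reduce `T` to a product; the flag tells whether a reduction was needed. -/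
def toPi (E : Env) (T : Ex) : Option (Bool × Ex × Ex) :=
  match T with
  | .pi A B => some (false, A, B)
  | T => match whnf E 200 true T [] with
    | (.pi A B, []) => some (true, A, B)
    | _ => none

/-- Reduce `T` to a universe. -/
def toUniv (E : Env) (T : Ex) : Option ℕ :=
  match T with
  | .univ i => some i
  | T => match whnf E 200 true T [] with
    | (.univ i, []) => some i
    | _ => none

/-- `A` is convertible to `B` or a smaller universe. -/
def sub (E : Env) (A B : Ex) : Bool :=
  match A, B with
  | .univ i, .univ j => Nat.ble i j
  | A, B => conv E 200 A B

/-- The type of the `n`-th variable, lifted by `l` more than its position requires. -/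
def lookupVar : List Ex → ℕ → ℕ → Option Ex
  | [], _, _ => none
  | A :: _, 0, l => some (liftAt (Nat.succ l) A 0)
  | _ :: Γ, n + 1, l => lookupVar Γ n (Nat.succ l)

/-- The constant `c` is known, and its levels are in the range for which constants are checked. -/
def constOk (E : Env) (c : Const) (i j : ℕ) : Bool :=
  Nat.blt c.ctorIdx E.consts && Nat.ble i 1 && Nat.ble j 1 &&
    -- Univalence for `U_1` would need `Id` at level `2`, outside the range of checked levels.
    (match c with | .univalence => Nat.beq i 0 | _ => true)

/-- Infer the type of `t` (for `none`) or check it against `T` (for `some T`), with `r` for the recursive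
calls. -/
def tcStep (E : Env) (r : List Ex → Ex → Option Ex → Option Ex) (Γ : List Ex) (t : Ex)
    (T : Option Ex) : Option Ex :=
  match T with
  | some T =>
    match t with
    | .lam A b => match toPi E T with
      | none => none
      | some (fresh, A', B') =>
        -- Without subject reduction, a product found by reducing a type is not known to be a type,
        -- so it is checked again.
        match (bif fresh then r Γ (.pi A' B') none else some T) with
        | none => none
        | some _ =>
          match (bif eqb A A' then some T else match r Γ A none with
              | none => none
              | some V => match toUniv E V with
                | none => none
                | some _ => bif conv E 200 A A' then some T else none) with
          | none => none
          | some _ => match r (A :: Γ) b (some B') with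
            | none => none
            | some _ => some T
    | t => match r Γ t none with
      | none => none
      | some T' => bif sub E T' T then some T else none
  | none =>
    match t with
    | .var k => lookupVar Γ k 0
    | .univ i => some (.univ (Nat.succ i))
    | .pi A B => match r Γ A none with
      | none => none
      | some V => match toUniv E V with
        | none => none
        | some i => match r (A :: Γ) B none with
          | none => none
          | some W => match toUniv E W with
            | none => none
            | some j => some (.univ (bif Nat.ble i j then j else i))
    | .lam A b => match r Γ A none with
      | none => none
      | some V => match toUniv E V with
        | none => none
        | some _ => match r (A :: Γ) b none with
          | none => none
          | some B => some (.pi A B)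
    | .app f a => match r Γ f none with
      | none => none
      | some F => match toPi E F with
        | none => none
        | some (fresh, A, B) =>
          match (bif fresh then r Γ (.pi A B) none else some F) with
          | none => none
          | some _ => match r Γ a (some A) with
            | none => none
            | some _ => some (instAt a B 0)
    | .const c i j => bif constOk E c i j then some (ofTm (famLevel i j c) (c.type i j)) else none
    | .ref k => match lookupDecl E.decls k with
      | none => none
      | some d => some d.ty

/-- Type checking, with recursion depth `n`. -/
def tc (E : Env) (n : ℕ) : List Ex → Ex → Option Ex → Option Ex :=
  Nat.rec (motive := fun _ => List Ex → Ex → Option Ex → Option Ex) (fun _ _ _ => none)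
    (fun _ r => tcStep E r) n

/-- Whether there is a value. -/
def isSome' {α} : Option α → Bool
  | none => false
  | some _ => true

/-- `T` is a closed type. -/
def checkTy (E : Env) (T : Ex) : Bool :=
  match tc E 200 [] T none with
  | none => false
  | some V => isSome' (toUniv E V)

/-- The declaration `d` is correct. -/
def checkDecl (E : Env) (d : Decl) : Bool :=
  checkTy E d.ty && isSome' (tc E 200 [] d.tm (some d.ty))

/-- The type of `c` is a type, given the first `n` constants. -/
def checkConst (n : ℕ) (c : Const) : Bool :=
  [0, 1].all fun i => [0, 1].all fun j =>
    bif constOk ⟨n + 1, []⟩ c i j then checkTy ⟨n, []⟩ (ofTm (famLevel i j c) (c.type i j)) else true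

end
end HoTT

namespace HoTT
open Ex
open Tm (upSub)

/-! ### Erasure -/

/-- The raw term of a core term, given those of the references. -/
def Ex.erase (ρ : ℕ → Tm) : Ex → Tm
  | var n => .var n
  | univ i => .univ i
  | pi A B => .pi (erase ρ A) (erase ρ B)
  | lam A b => .lam (erase ρ A) (erase ρ b)
  | app f a => erase ρ f ⬝ erase ρ a
  | const c _ _ => .const c
  | ref k => ρ k

theorem erase_ofTm (ρ : ℕ → Tm) (l : ℕ) (t : Tm) : (ofTm l t).erase ρ = t := by
  induction t with
  | const c => cases c <;> rfl
  | _ => simp_all [ofTm, erase]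

/-- The renaming which adds `k` to the variables from `c` on. -/
def shiftFrom (k c n : ℕ) : Tm := if n < c then .var n else .var (n + k)

theorem upSub_shiftFrom (k c : ℕ) : upSub (shiftFrom k c) = shiftFrom k (c + 1) := by
  funext n
  cases n with
  | zero => simp [upSub, shiftFrom]
  | succ n =>
    by_cases h : n < c
    · simp [upSub, shiftFrom, h, Tm.lift, Tm.rename]
    · simp [upSub, shiftFrom, h, Tm.lift, Tm.rename, Nat.add_right_comm]

/-- The substitution which replaces the variable `c` by `a`. -/
def substAt (a : Tm) (c n : ℕ) : Tm :=
  if n < c then .var n else if n = c then Tm.lift c a else .var (n - 1)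

theorem upSub_substAt (a : Tm) (c : ℕ) : upSub (substAt a c) = substAt a (c + 1) := by
  funext n
  cases n with
  | zero => simp [upSub, substAt]
  | succ n =>
    rcases lt_trichotomy n c with h | rfl | h
    · simp [upSub, substAt, h, Tm.lift, Tm.rename]
    · simp [upSub, substAt, Tm.lift, Tm.rename_rename]
    · have h₁ : ¬ n < c := by omega
      have h₂ : n ≠ c := by omega
      simp only [upSub, substAt, h₁, h₂, Tm.lift, Tm.rename, if_false, Nat.add_lt_add_iff_right,
        Nat.add_right_cancel_iff, Tm.var.injEq]
      omega

theorem substAt_zero (a : Tm) : substAt a 0 = Tm.single a := by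
  funext n
  cases n with
  | zero =>
    simp only [substAt, Tm.single, lt_irrefl, if_false, if_true, Tm.lift]
    rw [Tm.rename_eq_subst]; exact Tm.subst_var a
  | succ n => simp [substAt, Tm.single]

theorem shiftFrom_zero (k : ℕ) (t : Tm) : Tm.subst (shiftFrom k 0) t = Tm.lift k t := by
  rw [Tm.lift, Tm.rename_eq_subst]
  congr 1

theorem blt_of_lt {n c : ℕ} (h : n < c) : Nat.blt n c = true := by rw [Nat.blt_eq]; exact h

theorem blt_of_not_lt {n c : ℕ} (h : ¬n < c) : Nat.blt n c = false := by
  rw [← Bool.not_eq_true, Nat.blt_eq]; exact h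

section Erase

variable {ρ : ℕ → Tm} (hρ : ∀ k σ, Tm.subst σ (ρ k) = ρ k)
include hρ

theorem erase_liftAt (k : ℕ) (t : Ex) (c : ℕ) :
    (liftAt k t c).erase ρ = Tm.subst (shiftFrom k c) (t.erase ρ) := by
  induction t generalizing c with
  | var n =>
    have e : liftAt k (var n) c = bif Nat.blt n c then var n else var (Nat.add n k) := rfl
    rw [e]
    by_cases h : n < c
    · rw [blt_of_lt h]; simp [erase, Tm.subst, shiftFrom, h]
    · rw [blt_of_not_lt h]; simp [erase, Tm.subst, shiftFrom, h]
  | ref r => exact (hρ _ _).symm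
  | univ | const => rfl
  | pi A B ih ih' => exact congrArg₂ Tm.pi (ih c) ((ih' (c + 1)).trans (by rw [upSub_shiftFrom]))
  | lam A B ih ih' => exact congrArg₂ Tm.lam (ih c) ((ih' (c + 1)).trans (by rw [upSub_shiftFrom]))
  | app A B ih ih' => exact congrArg₂ Tm.app (ih c) (ih' c)

theorem erase_liftAt_zero (k : ℕ) (t : Ex) : (liftAt k t 0).erase ρ = Tm.lift k (t.erase ρ) := by
  rw [erase_liftAt hρ, shiftFrom_zero]

theorem erase_instAt (s t : Ex) (c : ℕ) :
    (instAt s t c).erase ρ = Tm.subst (substAt (s.erase ρ) c) (t.erase ρ) := by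
  induction t generalizing c with
  | var n =>
    have e : instAt s (var n) c = bif Nat.blt n c then var n else
      bif Nat.beq n c then liftAt c s 0 else var (Nat.pred n) := rfl
    rw [e]
    by_cases h : n < c
    · rw [blt_of_lt h]; simp [erase, Tm.subst, substAt, h]
    · rw [blt_of_not_lt h]
      by_cases h' : n = c
      · subst h'; simp [erase, Tm.subst, substAt, erase_liftAt_zero hρ]
      · have : Nat.beq n c = false := by
          rw [← Bool.not_eq_true, Nat.beq_eq]; exact h'
        simp [this, erase, Tm.subst, substAt, h, h']
  | ref r => exact (hρ _ _).symm
  | univ | const => rfl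
  | pi A B ih ih' => exact congrArg₂ Tm.pi (ih c) ((ih' (c + 1)).trans (by rw [upSub_substAt]))
  | lam A B ih ih' => exact congrArg₂ Tm.lam (ih c) ((ih' (c + 1)).trans (by rw [upSub_substAt]))
  | app A B ih ih' => exact congrArg₂ Tm.app (ih c) (ih' c)

theorem erase_instAt_zero (b a : Ex) : (instAt a b 0).erase ρ = (b.erase ρ).inst (a.erase ρ) := by
  rw [erase_instAt hρ, substAt_zero]; rfl

end Erase

theorem Const.ctorIdx_inj {c c' : Const} (h : c.ctorIdx = c'.ctorIdx) : c = c' := by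
  have : ∀ c : Const, ∀ n, n = c.ctorIdx → c = Const.ofNat n := by
    intro c n h; subst h; cases c <;> rfl
  rw [this c _ rfl, h, ← this c' _ rfl]

theorem erase_eq_of_eqb (ρ : ℕ → Tm) (a b : Ex) (h : eqb a b = true) : a.erase ρ = b.erase ρ := by
  induction a generalizing b with
  | var n => cases b <;> first | exact congrArg Tm.var (Nat.eq_of_beq_eq_true h) | cases h
  | univ n => cases b <;> first | exact congrArg Tm.univ (Nat.eq_of_beq_eq_true h) | cases h
  | ref n => cases b <;> first | exact congrArg ρ (Nat.eq_of_beq_eq_true h) | cases h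
  | const c i j =>
    cases b <;> first
      | exact congrArg Tm.const (Const.ctorIdx_inj (Nat.eq_of_beq_eq_true h)) | cases h
  | pi A B ih ih' | lam A B ih ih' | app A B ih ih' =>
    cases b <;> try cases h
    obtain ⟨h₁, h₂⟩ := Bool.and_eq_true_iff.1 h
    simp only [erase, ih _ h₁, ih' _ h₂]

/-! ### Soundness of convertibility -/

/-- The raw term of an application to a list of arguments. -/
def eraseApps (ρ : ℕ → Tm) (h : Ex) (st : List Ex) : Tm :=
  (st.map (erase ρ)).foldl (· ⬝ ·) (h.erase ρ)

theorem Conv.foldl {f g : Tm} (h : Conv f g) {l m : List Tm} (hl : List.Forall₂ Conv l m) :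
    Conv (l.foldl (· ⬝ ·) f) (m.foldl (· ⬝ ·) g) := by
  induction hl generalizing f g with
  | nil => exact h
  | cons h' _ ih => exact ih (.app h h')

theorem Conv.foldl_left {f g : Tm} (h : Conv f g) (l : List Tm) :
    Conv (l.foldl (· ⬝ ·) f) (l.foldl (· ⬝ ·) g) :=
  h.foldl (List.forall₂_same.2 fun _ _ => .refl _)

theorem erase_apps (ρ : ℕ → Tm) (h : Ex) (st : List Ex) : (apps h st).erase ρ = eraseApps ρ h st := by
  induction st generalizing h with
  | nil => rfl
  | cons a st ih => exact ih _

/-- The computation rules in `Conv` do not relate the parameters of an eliminator to those of the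
constructor. It therefore suffices to replace the scrutinee by its weak head normal form and to
apply the rule. -/
theorem iota_sound (ρ : ℕ → Tm) {w : Ex → List Ex → Ex × List Ex}
    (hw : ∀ h st, Conv (eraseApps ρ h st) (eraseApps ρ (w h st).1 (w h st).2))
    {c : Const} {i j : ℕ} {st : List Ex} {r : Ex × List Ex} (h : iota c st w = some r) :
    Conv (eraseApps ρ (const c i j) st) (eraseApps ρ r.1 r.2) := by
  have key {p h : Ex} {st : List Ex} (e : w p [] = (h, st)) : Conv (p.erase ρ) (eraseApps ρ h st) := by
    have := hw p []
    rwa [e] at this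
  unfold iota at h
  split at h
  · split at h <;> [skip; cases h]
    split at h <;> cases h
    exact Conv.foldl_left (.trans (.app (.refl _) (key (by assumption))) (.sigmaInd ..)) _
  · split at h <;> [skip; cases h]
    split at h <;> cases h
    · exact Conv.foldl_left (.trans (.app (.refl _) (key (by assumption))) (.sumInd_inl ..)) _
    · exact Conv.foldl_left (.trans (.app (.refl _) (key (by assumption))) (.sumInd_inr ..)) _
  · split at h <;> [skip; cases h]
    split at h <;> cases h
    exact Conv.foldl_left (.trans (.app (.refl _) (key (by assumption))) (.unitInd ..)) _
  · split at h <;> [skip; cases h]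
    split at h <;> cases h
    · exact Conv.foldl_left (.trans (.app (.refl _) (key (by assumption))) (.natInd_zero ..)) _
    · exact Conv.foldl_left (.trans (.app (.refl _) (key (by assumption))) (.natInd_succ ..)) _
  · split at h <;> [skip; cases h]
    split at h <;> cases h
    exact Conv.foldl_left (.trans (.app (.refl _) (key (by assumption))) (.idInd ..)) _
  · split at h <;> [skip; cases h]
    split at h <;> cases h
    exact Conv.foldl_left (.trans (.app (.refl _) (key (by assumption))) (.s1Ind ..)) _
  · cases h

section Sound

variable {ρ : ℕ → Tm} {E : Env} (hρ : ∀ k σ, Tm.subst σ (ρ k) = ρ k)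
  (hE : ∀ k t, unfoldRef E k = some t → ρ k = t.erase ρ)
include hρ hE

theorem whnfStep_sound {w : Bool → Ex → List Ex → Ex × List Ex}
    (hw : ∀ δ h st, Conv (eraseApps ρ h st) (eraseApps ρ (w δ h st).1 (w δ h st).2))
    (δ : Bool) (h : Ex) (st : List Ex) :
    Conv (eraseApps ρ h st) (eraseApps ρ (whnfStep E w δ h st).1 (whnfStep E w δ h st).2) := by
  unfold whnfStep
  split
  · exact hw _ _ (_ :: _)
  · split
    · exact .refl _
    · refine .trans ?_ (hw _ _ _)
      unfold eraseApps
      rw [erase_instAt_zero hρ]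
      exact Conv.foldl_left (.beta ..) _
  · cases δ
    · exact .refl _
    · simp only [cond_true]
      split
      · rename_i k _ t ht
        refine .trans ?_ (hw _ _ _)
        rw [eraseApps, eraseApps, erase, hE k t ht]
        exact .refl _
      · exact .refl _
  · split
    · rename_i hi
      exact .trans (iota_sound ρ (hw true) hi) (hw _ _ _)
    · exact .refl _
  · exact .refl _

theorem whnf_sound (n : ℕ) (δ : Bool) (h : Ex) (st : List Ex) :
    Conv (eraseApps ρ h st) (eraseApps ρ (whnf E n δ h st).1 (whnf E n δ h st).2) := by
  induction n generalizing δ h st with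
  | zero => exact .refl _
  | succ n ih => exact whnfStep_sound hρ hE ih δ h st

omit hρ hE in
theorem all2_sound {r : Ex → Ex → Bool} (hr : ∀ a b, r a b = true → Conv (a.erase ρ) (b.erase ρ)) :
    ∀ {l m : List Ex}, all2 r l m = true →
      List.Forall₂ Conv (l.map (erase ρ)) (m.map (erase ρ))
  | [], [], _ => .nil
  | a :: l, b :: m, h => by
    obtain ⟨h₁, h₂⟩ := Bool.and_eq_true_iff.1 h
    exact .cons (hr _ _ h₁) (all2_sound hr h₂)

theorem convStep_sound {r : Ex → Ex → Bool}
    (hr : ∀ a b, r a b = true → Conv (a.erase ρ) (b.erase ρ)) (a b : Ex)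
    (h : convStep E r a b = true) : Conv (a.erase ρ) (b.erase ρ) := by
  rw [convStep, Bool.or_eq_true] at h
  rcases h with h | h
  · rw [erase_eq_of_eqb ρ _ _ h]; exact .refl _
  have ha : Conv (a.erase ρ) _ := whnf_sound hρ hE 200 false a []
  have hb : Conv (b.erase ρ) _ := whnf_sound hρ hE 200 false b []
  have unf {k : ℕ} {t : Ex} (hk : unfoldRef E k = some t) (s : List Ex) :
      eraseApps ρ (.ref k) s = (apps t s).erase ρ := by
    rw [erase_apps, eraseApps, eraseApps, erase, hE k t hk]
  generalize whnf E 200 false a [] = u at h ha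
  generalize whnf E 200 false b [] = v at h hb
  obtain ⟨h₁, s₁⟩ := u
  obtain ⟨h₂, s₂⟩ := v
  refine .trans ha (.trans ?_ hb.symm)
  clear ha hb
  dsimp only at h ⊢
  -- Unfolding leaves the raw term as it is, because `ρ k` is the erasure of the definition of `k`.
  have H (k : ℕ) (t : Ex) (hk : unfoldRef E k = some t) (x : Ex) (s s' : List Ex) :
      (r (apps t s) (apps x s') = true → Conv (eraseApps ρ (.ref k) s) (eraseApps ρ x s')) ∧
      (r (apps x s') (apps t s) = true → Conv (eraseApps ρ x s') (eraseApps ρ (.ref k) s)) := by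
    rw [unf hk, ← erase_apps]
    exact ⟨hr _ _, hr _ _⟩
  split at h
  · simp only [Bool.and_eq_true] at h
    exact .foldl (.lam (hr _ _ h.1.1) (hr _ _ h.1.2)) (all2_sound hr h.2)
  · simp only [Bool.and_eq_true] at h
    exact .foldl (.pi (hr _ _ h.1.1) (hr _ _ h.1.2)) (all2_sound hr h.2)
  · simp only [Bool.and_eq_true] at h
    rw [Nat.eq_of_beq_eq_true h.1]
    exact .foldl (.refl _) (all2_sound hr h.2)
  · simp only [Bool.and_eq_true] at h
    rw [Nat.eq_of_beq_eq_true h.1]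
    exact .foldl (.refl _) (all2_sound hr h.2)
  · simp only [Bool.and_eq_true] at h
    cases Const.ctorIdx_inj (Nat.eq_of_beq_eq_true h.1)
    exact .foldl (.refl _) (all2_sound hr h.2)
  · rename_i k k'
    cases hk : Nat.beq k k' with
    | true =>
      rw [hk, cond_true, Bool.or_eq_true] at h
      obtain rfl := Nat.eq_of_beq_eq_true hk
      rcases h with h | h
      · exact .foldl (.refl _) (all2_sound hr h)
      · split at h
        · rename_i ht
          rw [unf ht, unf ht]
          exact hr _ _ h
        · cases h
    | false =>
      rw [hk, cond_false] at h
      cases hl : Nat.blt k k' with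
      | true =>
        rw [hl, cond_true] at h
        split at h
        · exact (H _ _ (by assumption) _ _ _).2 h
        · split at h
          · exact (H _ _ (by assumption) _ _ _).1 h
          · cases h
      | false =>
        rw [hl, cond_false] at h
        split at h
        · exact (H _ _ (by assumption) _ _ _).1 h
        · split at h
          · exact (H _ _ (by assumption) _ _ _).2 h
          · cases h
  · split at h
    · exact (H _ _ (by assumption) _ _ _).1 h
    · cases h
  · split at h
    · exact (H _ _ (by assumption) _ _ _).2 h
    · cases h
  · cases h

theorem conv_sound (n : ℕ) (a b : Ex) (h : conv E n a b = true) : Conv (a.erase ρ) (b.erase ρ) := by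
  induction n generalizing a b with
  | zero => cases h
  | succ n ih => exact convStep_sound hρ hE ih a b h

/-! ### Soundness of type checking -/

theorem whnf_sound_of_eq {n : ℕ} {δ : Bool} {t h : Ex} {st : List Ex}
    (e : whnf E n δ t [] = (h, st)) : Conv (t.erase ρ) (eraseApps ρ h st) := by
  have := whnf_sound hρ hE n δ t []
  rwa [e] at this

theorem toPi_sound {T A B : Ex} {f : Bool} (h : toPi E T = some (f, A, B)) :
    Conv (T.erase ρ) (.pi (A.erase ρ) (B.erase ρ)) ∧ (f = false → T = .pi A B) := by
  unfold toPi at h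
  split at h
  · cases h; exact ⟨.refl _, fun _ => rfl⟩
  · split at h
    · rename_i hw
      cases h
      exact ⟨whnf_sound_of_eq hρ hE hw, by simp⟩
    · cases h

theorem toUniv_sound {T : Ex} {i : ℕ} (h : toUniv E T = some i) : Conv (T.erase ρ) (.univ i) := by
  unfold toUniv at h
  split at h
  · cases h; exact .refl _
  · split at h
    · rename_i hw
      cases h
      exact whnf_sound_of_eq hρ hE hw
    · cases h

/-- `A` is a type in the context `Γ`. -/
def IsType (Γ : List Tm) (A : Tm) : Prop := ∃ i, Typed Γ A (.univ i)

theorem Typed.toUniv {Γ : List Tm} {t : Tm} {V : Ex} {i : ℕ} (h : Typed Γ t (V.erase ρ))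
    (hV : toUniv E V = some i) : Typed Γ t (.univ i) :=
  .conv h (h.wf.univ i) (toUniv_sound hρ hE hV)

theorem Typed.sub {Γ : List Tm} {t : Tm} {A B : Ex} (h : Typed Γ t (A.erase ρ))
    (hB : IsType Γ (B.erase ρ)) (hs : sub E A B = true) : Typed Γ t (B.erase ρ) := by
  unfold HoTT.sub at hs
  split at hs
  · exact h.cumul_le (Nat.le_of_ble_eq_true hs)
  · obtain ⟨i, hB⟩ := hB
    exact .conv h hB (conv_sound hρ hE 200 _ _ hs)

omit hE in
theorem lookupVar_sound {Γ : List Ex} (hΓ : Wf (Γ.map (erase ρ))) {n l : ℕ} {A : Ex}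
    (h : lookupVar Γ n l = some A) :
    ∃ B, (Γ.map (erase ρ))[n]? = some B ∧ A.erase ρ = Tm.lift (l + n + 1) B := by
  induction Γ generalizing n l with
  | nil => cases h
  | cons C Γ ih =>
    cases n with
    | zero =>
      cases h
      exact ⟨_, rfl, erase_liftAt_zero hρ _ _⟩
    | succ n =>
      cases hΓ with
      | cons hΓ _ =>
      obtain ⟨B, h₁, h₂⟩ := ih hΓ (n := n) (l := l + 1) h
      refine ⟨B, by simpa using h₁, ?_⟩
      rw [h₂]; congr 1; omega

omit hρ hE in
theorem Wf.isType_of_mem {Γ : List Tm} (h : Wf Γ) {n : ℕ} {B : Tm} (hB : Γ[n]? = some B) :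
    IsType Γ (Tm.lift (n + 1) B) := by
  induction h generalizing n with
  | nil => simp at hB
  | cons hΓ hA ih =>
    cases n with
    | zero =>
      obtain rfl : _ = B := by simpa using hB
      exact ⟨_, .weaken hA hA⟩
    | succ n =>
      obtain ⟨i, hi⟩ := ih (by simpa using hB)
      refine ⟨i, ?_⟩
      have := Typed.weaken hA hi
      rwa [Tm.lift, Tm.lift, Tm.rename_rename] at this

omit hρ hE in
theorem Typed.pi_bif {Γ : List Tm} {A B : Tm} {i j : ℕ} (hA : Typed Γ A (.univ i))
    (hB : Typed (A :: Γ) B (.univ j)) :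
    Typed Γ (.pi A B) (.univ (bif Nat.ble i j then j else i)) := by
  cases hij : Nat.ble i j with
  | true => exact .pi (hA.cumul_le (Nat.le_of_ble_eq_true hij)) hB
  | false =>
    have : ¬i ≤ j := fun h => by rw [Nat.ble_eq_true_of_le h] at hij; cases hij
    exact .pi hA (hB.cumul_le (by rw [cond_false]; omega))

omit hρ hE in
theorem Typed.isType_pi {Γ : List Tm} {A B V : Tm} (h : Typed Γ (.pi A B) V) :
    IsType Γ (.pi A B) := by
  obtain ⟨⟨i, hA⟩, ⟨j, hB⟩⟩ := h.pi_inv rfl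
  exact ⟨_, .pi (hA.cumul_le (le_max_left i j)) (hB.cumul_le (le_max_right i j))⟩

omit hρ hE in
theorem IsType.wf {Γ : List Tm} {A : Tm} (h : IsType Γ A) : Wf Γ :=
  h.elim fun _ h => h.wf

omit hρ hE in
-- The identity is a substitution between the two contexts: the last variable has type `A`, hence
-- also `A'` by conversion. This admits abstractions whose annotation is only convertible to the
-- expected domain.
theorem Typed.conv_context {Γ : List Tm} {A A' b B : Tm} (h : Typed (A' :: Γ) b B)
    (hA : IsType Γ A) (hA' : IsType Γ A') (hc : Conv A A') : Typed (A :: Γ) b B := by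
  obtain ⟨i, hA⟩ := hA
  obtain ⟨j, hA'⟩ := hA'
  have hw : Wf (A :: Γ) := .cons hA.wf hA
  have := h.subst hw (σ := Tm.var) fun n C hC => by
    cases n with
    | zero =>
      obtain rfl : A' = C := by simpa using hC
      rw [Tm.subst_var]
      exact .conv (.var hA) (.weaken hA hA') (by
        rw [Tm.lift, Tm.lift, Tm.rename_eq_subst, Tm.rename_eq_subst]; exact hc.subst _)
    | succ n => exact hw.subTyped_var (n + 1) C (by simpa using hC)
  rwa [Tm.subst_var, Tm.subst_var] at this

/-- The two modes have different invariants. Inference assumes a well-formed context and guarantees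
that its result is a type; checking takes for granted that the given `T` is a type. -/
theorem tcStep_sound
    (hc : ∀ c i j, constOk E c i j = true → ∃ l, Typed [] (c.type i j) (.univ l))
    (hd : ∀ k d, lookupDecl E.decls k = some d →
      Typed [] (ρ k) (d.ty.erase ρ) ∧ ∃ l, Typed [] (d.ty.erase ρ) (.univ l))
    {r : List Ex → Ex → Option Ex → Option Ex}
    (hi : ∀ Γ t A, r Γ t none = some A → Wf (Γ.map (erase ρ)) →
      Typed (Γ.map (erase ρ)) (t.erase ρ) (A.erase ρ) ∧ IsType (Γ.map (erase ρ)) (A.erase ρ))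
    (hk : ∀ Γ t T A, r Γ t (some T) = some A → IsType (Γ.map (erase ρ)) (T.erase ρ) →
      Typed (Γ.map (erase ρ)) (t.erase ρ) (T.erase ρ)) :
    (∀ Γ t A, tcStep E r Γ t none = some A → Wf (Γ.map (erase ρ)) →
      Typed (Γ.map (erase ρ)) (t.erase ρ) (A.erase ρ) ∧ IsType (Γ.map (erase ρ)) (A.erase ρ)) ∧
    (∀ Γ t T A, tcStep E r Γ t (some T) = some A → IsType (Γ.map (erase ρ)) (T.erase ρ) →
      Typed (Γ.map (erase ρ)) (t.erase ρ) (T.erase ρ)) := by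
  constructor
  · intro Γ t A h hΓ
    unfold tcStep at h
    dsimp only at h
    split at h
    · rename_i k
      obtain ⟨B, h₁, h₂⟩ := lookupVar_sound hρ hΓ h
      rw [Nat.zero_add] at h₂
      have := hΓ.subTyped_var _ _ h₁
      rw [Tm.subst_var] at this
      rw [h₂]
      exact ⟨this, hΓ.isType_of_mem h₁⟩
    · cases h
      exact ⟨hΓ.univ _, _, hΓ.univ _⟩
    · split at h <;> [cases h; skip]
      split at h <;> [cases h; skip]
      split at h <;> [cases h; skip]
      split at h <;> [cases h; skip]
      rename_i hA _ _ hV _ _ hB _ _ hW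
      cases h
      have hA' := Typed.toUniv hρ hE (hi _ _ _ hA hΓ).1 hV
      have hB' := Typed.toUniv hρ hE (hi _ _ _ hB (.cons hΓ hA')).1 hW
      exact ⟨hA'.pi_bif hB', _, hΓ.univ _⟩
    · split at h <;> [cases h; skip]
      split at h <;> [cases h; skip]
      split at h <;> [cases h; skip]
      rename_i hA _ _ hV _ _ hB
      cases h
      have hA' := Typed.toUniv hρ hE (hi _ _ _ hA hΓ).1 hV
      obtain ⟨hb, j, hB'⟩ := hi _ _ _ hB (.cons hΓ hA')
      have := Typed.pi (hA'.cumul_le (le_max_left _ j)) (hB'.cumul_le (le_max_right _ j))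
      exact ⟨.lam this hb, _, this⟩
    · split at h <;> [cases h; skip]
      split at h <;> [cases h; skip]
      split at h <;> [cases h; skip]
      split at h <;> [cases h; skip]
      rename_i F hF _ fresh A B hP _ _ hf _ _ ha
      cases h
      obtain ⟨hF, j, hFt⟩ := hi _ _ _ hF hΓ
      have hP := toPi_sound hρ hE hP
      -- Either the product is the inferred type of the function itself, or it came from reduction
      -- and was checked again.
      have hpi : IsType (Γ.map (erase ρ)) (Tm.pi (A.erase ρ) (B.erase ρ)) := by
        cases fresh
        · rw [hP.2 rfl] at hFt
          exact ⟨j, hFt⟩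
        · exact (hi _ _ _ hf hΓ).1.isType_pi
      obtain ⟨j, hpi⟩ := hpi
      obtain ⟨⟨_, hA⟩, ⟨_, hB⟩⟩ := hpi.pi_inv rfl
      have ha' := hk _ _ _ _ ha ⟨_, hA⟩
      rw [erase_instAt_zero hρ]
      exact ⟨.app (.conv hF hpi hP.1) ha', _, hB.inst ha'⟩
    · rename_i c i j
      cases ho : constOk E c i j with
      | false => rw [ho] at h; cases h
      | true =>
        rw [ho] at h; cases h
        obtain ⟨l, hl⟩ := hc c i j ho
        rw [erase_ofTm]
        exact ⟨hΓ.typed_of_closed (.const c i j) (fun _ => rfl) (fun _ => Const.subst_type ..), l,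
          hΓ.typed_of_closed hl (fun _ => Const.subst_type ..) (fun _ => rfl)⟩
    · split at h <;> [cases h; skip]
      rename_i hl
      cases h
      obtain ⟨h₁, l, h₂⟩ := hd _ _ hl
      exact ⟨hΓ.typed_of_closed h₁ h₁.subst_closed h₂.subst_closed, l,
        hΓ.typed_of_closed h₂ h₂.subst_closed (fun _ => rfl)⟩
  · intro Γ t T A h hT
    have hΓ := hT.wf
    unfold tcStep at h
    dsimp only at h
    split at h
    · rename_i A₁ b
      split at h <;> [cases h; skip]
      split at h <;> [cases h; skip]
      split at h <;> [cases h; skip]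
      split at h <;> [cases h; skip]
      rename_i fresh A' B' hP _ _ hf _ _ hA _ _ hb
      cases h
      have hP := toPi_sound hρ hE hP
      have hpi : IsType (Γ.map (erase ρ)) (Tm.pi (A'.erase ρ) (B'.erase ρ)) := by
        cases fresh
        · rw [hP.2 rfl] at hT
          exact hT
        · exact (hi _ _ _ hf hΓ).1.isType_pi
      obtain ⟨k, hpi⟩ := hpi
      obtain ⟨hA', ⟨j, hB'⟩⟩ := hpi.pi_inv rfl
      have hA₁ : IsType (Γ.map (erase ρ)) (A₁.erase ρ) ∧ Conv (A₁.erase ρ) (A'.erase ρ) := by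
        cases he : eqb A₁ A' with
        | true =>
          rw [erase_eq_of_eqb ρ _ _ he]
          exact ⟨hA', .refl _⟩
        | false =>
          rw [he, cond_false] at hA
          split at hA <;> [cases hA; skip]
          split at hA <;> [cases hA; skip]
          rename_i hV _ _ hu
          cases hcv : conv E 200 A₁ A' with
          | true => exact ⟨⟨_, Typed.toUniv hρ hE (hi _ _ _ hV hΓ).1 hu⟩, conv_sound hρ hE _ _ _ hcv⟩
          | false => rw [hcv] at hA; cases hA
      obtain ⟨hA₁, hc⟩ := hA₁
      have hB₁ := hB'.conv_context hA₁ hA' hc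
      have hb := hk (A₁ :: Γ) _ _ _ hb ⟨j, hB₁⟩
      obtain ⟨l, hA₁⟩ := hA₁
      have hpi₁ := Typed.pi (hA₁.cumul_le (le_max_left l j)) (hB₁.cumul_le (le_max_right l j))
      obtain ⟨_, hT⟩ := hT
      -- The abstraction is typed over its own annotation `A₁` and then converted to `T`.
      exact .conv (.lam hpi₁ hb) hT (.trans (.pi hc (.refl _)) hP.1.symm)
    · split at h <;> [cases h; skip]
      rename_i hA
      cases hs : sub E _ T with
      | true => exact Typed.sub hρ hE (hi _ _ _ hA hΓ).1 hT hs
      | false => rw [hs] at h; cases h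

theorem tc_sound
    (hc : ∀ c i j, constOk E c i j = true → ∃ l, Typed [] (c.type i j) (.univ l))
    (hd : ∀ k d, lookupDecl E.decls k = some d →
      Typed [] (ρ k) (d.ty.erase ρ) ∧ ∃ l, Typed [] (d.ty.erase ρ) (.univ l)) (n : ℕ) :
    (∀ Γ t A, tc E n Γ t none = some A → Wf (Γ.map (erase ρ)) →
      Typed (Γ.map (erase ρ)) (t.erase ρ) (A.erase ρ) ∧ IsType (Γ.map (erase ρ)) (A.erase ρ)) ∧
    (∀ Γ t T A, tc E n Γ t (some T) = some A → IsType (Γ.map (erase ρ)) (T.erase ρ) →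
      Typed (Γ.map (erase ρ)) (t.erase ρ) (T.erase ρ)) := by
  induction n with
  | zero => exact ⟨fun _ _ _ h => (nomatch h), fun _ _ _ _ h => (nomatch h)⟩
  | succ n ih => exact tcStep_sound hρ hE hc hd ih.1 ih.2

theorem checkTy_sound
    (hc : ∀ c i j, constOk E c i j = true → ∃ l, Typed [] (c.type i j) (.univ l))
    (hd : ∀ k d, lookupDecl E.decls k = some d →
      Typed [] (ρ k) (d.ty.erase ρ) ∧ ∃ l, Typed [] (d.ty.erase ρ) (.univ l))
    {T : Ex} (h : checkTy E T = true) : ∃ l, Typed [] (T.erase ρ) (.univ l) := by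
  unfold checkTy at h
  split at h <;> [cases h; skip]
  rename_i V hV
  cases hu : toUniv E V with
  | none => rw [hu] at h; cases h
  | some l => exact ⟨l, Typed.toUniv hρ hE ((tc_sound hρ hE hc hd _).1 _ _ _ hV .nil).1 hu⟩

end Sound

/-! ### The types of the constants -/

theorem constOk_succ {n : ℕ} {c : Const} {i j : ℕ} (h : constOk ⟨n + 1, []⟩ c i j = true) :
    constOk ⟨n, []⟩ c i j = true ∨ c.ctorIdx = n := by
  simp only [constOk, Bool.and_eq_true, Nat.blt_eq] at h ⊢
  by_cases hn : c.ctorIdx = n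
  · exact .inr hn
  · exact .inl ⟨⟨⟨by omega, h.1.1.2⟩, h.1.2⟩, h.2⟩

/-- The rule for constants does not say that their types are types, while the checker relies on it.
The type of a constant mentions only constants listed before it, so the checker can be bootstrapped
by induction on the number of known constants. -/
theorem constType_isType (hall : ∀ c : Const, checkConst c.ctorIdx c = true) (n : ℕ) :
    ∀ c i j, constOk ⟨n, []⟩ c i j = true → ∃ l, Typed [] (c.type i j) (.univ l) := by
  induction n with
  | zero => intro c i j h; simp [constOk] at h
  | succ n ih =>
    intro c i j h
    rcases constOk_succ h with h' | rfl
    · exact ih c i j h'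
    have hc := hall c
    simp only [checkConst, List.all_cons, List.all_nil] at hc
    have key : checkTy ⟨c.ctorIdx, []⟩ (ofTm (famLevel i j c) (c.type i j)) = true := by
      have : i ≤ 1 ∧ j ≤ 1 := by
        simp only [constOk, Bool.and_eq_true] at h
        exact ⟨Nat.le_of_ble_eq_true h.1.1.2, Nat.le_of_ble_eq_true h.1.2⟩
      obtain ⟨hi, hj⟩ := this
      simp only [Bool.and_eq_true, Bool.and_true] at hc
      interval_cases i <;> interval_cases j <;> simp_all
    have := checkTy_sound (ρ := fun _ => .univ 0) (fun _ _ => rfl) (fun _ _ h => by cases h) ih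
      (fun _ _ h => by cases h) key
    rwa [erase_ofTm] at this

/-! ### Global declarations -/

/-- All references in `t` are smaller than `n`. -/
def Ex.bounded (n : ℕ) : Ex → Bool
  | pi A B | lam A B | app A B => bounded n A && bounded n B
  | ref k => Nat.blt k n
  | _ => true

theorem erase_congr {n : ℕ} {ρ ρ' : ℕ → Tm} (h : ∀ k < n, ρ k = ρ' k) {t : Ex}
    (ht : t.bounded n = true) : t.erase ρ = t.erase ρ' := by
  induction t with
  | ref k => exact h k (by rwa [bounded, Nat.blt_eq] at ht)
  | pi A B ih ih' | lam A B ih ih' | app A B ih ih' =>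
    obtain ⟨h₁, h₂⟩ := Bool.and_eq_true_iff.1 ht
    simp only [erase, ih h₁, ih' h₂]
  | _ => rfl

/-- The reference `k < n` stands for the closed term `ρ k`, and the declarations are correct. -/
structure Valid (ρ : ℕ → Tm) (E : Env) (n : ℕ) : Prop where
  closed : ∀ k σ, Tm.subst σ (ρ k) = ρ k
  bounded : ∀ k d, lookupDecl E.decls k = some d →
    k < n ∧ d.ty.bounded n = true ∧ d.tm.bounded n = true
  tm : ∀ k d, lookupDecl E.decls k = some d → ρ k = d.tm.erase ρ
  typed : ∀ k d, lookupDecl E.decls k = some d →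
    Typed [] (ρ k) (d.ty.erase ρ) ∧ ∃ l, Typed [] (d.ty.erase ρ) (.univ l)
  const : ∀ c i j, constOk E c i j = true → ∃ l, Typed [] (c.type i j) (.univ l)

namespace Valid

variable {ρ : ℕ → Tm} {E : Env} {n : ℕ}

theorem unfold (h : Valid ρ E n) {k : ℕ} {t : Ex} (ht : unfoldRef E k = some t) :
    ρ k = t.erase ρ := by
  unfold unfoldRef at ht
  split at ht <;> [cases ht; skip]
  rename_i d hd
  rw [h.tm k d hd]
  cases hb : d.opq <;> rw [hb] at ht <;> cases ht
  rfl

theorem checkDecl_sound (h : Valid ρ E n) {d : Decl} (hd : checkDecl E d = true) :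
    Typed [] (d.tm.erase ρ) (d.ty.erase ρ) ∧ ∃ l, Typed [] (d.ty.erase ρ) (.univ l) := by
  obtain ⟨h₁, h₂⟩ := Bool.and_eq_true_iff.1 hd
  have hu := fun k t => h.unfold (k := k) (t := t)
  have hT := checkTy_sound h.closed hu h.const h.typed h₁
  refine ⟨?_, hT⟩
  cases ht : tc E 200 [] d.tm (some d.ty) with
  | none => rw [ht] at h₂; cases h₂
  | some A => exact (tc_sound h.closed hu h.const h.typed 200).2 _ _ _ _ ht hT

end Valid

theorem bounded_succ {n : ℕ} {t : Ex} (ht : t.bounded n = true) : t.bounded (n + 1) = true := by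
  induction t with
  | ref k =>
    rw [Ex.bounded, Nat.blt_eq] at ht ⊢; omega
  | pi A B ih ih' | lam A B ih ih' | app A B ih ih' =>
    obtain ⟨h₁, h₂⟩ := Bool.and_eq_true_iff.1 ht
    exact Bool.and_eq_true_iff.2 ⟨ih h₁, ih' h₂⟩
  | _ => rfl

/-- Extend an environment by a declaration. -/
def Env.add (E : Env) (d : Decl) : Env := ⟨E.consts, d :: E.decls⟩

/-- The reference `n` is interpreted by the erasure of the new definition. All earlier declarations,
and the new one itself, refer only to numbers below `n`, so this changes none of their erasures. -/
theorem Valid.add {ρ : ℕ → Tm} {E : Env} {n : ℕ} (h : Valid ρ E n) {d : Decl}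
    (hn : d.id = n) (hb : d.ty.bounded n = true ∧ d.tm.bounded n = true)
    (hd : checkDecl E d = true) : ∃ ρ', Valid ρ' (E.add d) (n + 1) := by
  obtain ⟨h₁, h₂⟩ := h.checkDecl_sound hd
  have hlt : ∀ k < n, Function.update ρ n (d.tm.erase ρ) k = ρ k := fun k hk =>
    Function.update_of_ne hk.ne _ _
  generalize hρ : Function.update ρ n (d.tm.erase ρ) = ρ' at hlt
  have hself : ρ' n = d.tm.erase ρ' := by
    rw [erase_congr hlt hb.2, ← hρ, Function.update_self]
  have hold {t : Ex} (ht : t.bounded n = true) : t.erase ρ' = t.erase ρ := erase_congr hlt ht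
  have key : ∀ k d', lookupDecl (E.add d).decls k = some d' →
      (k = n ∧ d' = d) ∨ lookupDecl E.decls k = some d' := by
    intro k d' hk
    have e : lookupDecl (E.add d).decls k =
      bif Nat.beq d.id k then some d else lookupDecl E.decls k := rfl
    rw [e] at hk
    cases hq : Nat.beq d.id k with
    | true =>
      rw [hq] at hk
      cases hk
      exact .inl ⟨(Nat.eq_of_beq_eq_true hq).symm.trans hn, rfl⟩
    | false => rw [hq] at hk; exact .inr hk
  refine ⟨ρ', ?_, ?_, ?_, ?_, h.const⟩
  · intro k σ
    by_cases hk : k = n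
    · subst hk
      rw [hself, hold hb.2]
      exact h₁.subst_closed σ
    · rw [← hρ, Function.update_of_ne hk]
      exact h.closed k σ
  · intro k d' hk
    rcases key k d' hk with ⟨rfl, rfl⟩ | hk
    · exact ⟨k.lt_succ_self, bounded_succ hb.1, bounded_succ hb.2⟩
    · obtain ⟨h₁, h₂, h₃⟩ := h.bounded k d' hk
      exact ⟨by omega, bounded_succ h₂, bounded_succ h₃⟩
  · intro k d' hk
    rcases key k d' hk with ⟨rfl, rfl⟩ | hk
    · exact hself
    · obtain ⟨h₁, h₂, h₃⟩ := h.bounded k d' hk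
      rw [hlt k h₁, hold h₃, h.tm k d' hk]
  · intro k d' hk
    rcases key k d' hk with ⟨rfl, rfl⟩ | hk
    · rw [hself, hold hb.1, hold hb.2]
      exact ⟨h₁, h₂⟩
    · obtain ⟨h₁, h₂, h₃⟩ := h.bounded k d' hk
      rw [hlt k h₁, hold h₂]
      exact h.typed k d' hk

/-- Check a list of declarations, numbered from `n` on. -/
noncomputable def checkDecls (E : Env) (n : ℕ) : List Decl → Bool
  | [] => true
  | d :: l => Nat.beq d.id n && (d.ty.bounded n && d.tm.bounded n) && checkDecl E d &&
      checkDecls (E.add d) (n + 1) l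

theorem Valid.addList {E : Env} {n : ℕ} (h : ∃ ρ, Valid ρ E n) {l : List Decl}
    (hl : checkDecls E n l = true) : ∃ ρ, Valid ρ (l.foldl Env.add E) (n + l.length) := by
  induction l generalizing E n with
  | nil => exact h
  | cons d l ih =>
    obtain ⟨ρ, h⟩ := h
    simp only [checkDecls, Bool.and_eq_true] at hl
    rw [List.length_cons, add_comm l.length, ← add_assoc]
    exact ih (h.add (Nat.eq_of_beq_eq_true hl.1.1.1) hl.1.1.2 hl.1.2) hl.2

theorem valid_nil (hall : ∀ c : Const, checkConst c.ctorIdx c = true) (n : ℕ) :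
    ∃ ρ, Valid ρ ⟨n, []⟩ 0 :=
  ⟨fun _ => .univ 0, fun _ _ => rfl, fun _ _ h => (nomatch h), fun _ _ h => (nomatch h),
    fun _ _ h => (nomatch h), constType_isType hall n⟩

end HoTT

namespace HoTT
noncomputable section

/-! ### A typed syntax for the object theory

A term is represented by its value at each number of variables in scope.  The index of `El` is not
part of the term: it lets unification find the implicit arguments, and is verified by the checker. -/

/-- Types, as functions of the number of variables in scope. -/
abbrev Ty : Type := ℕ → Ex

/-- Terms which are meant to have the type `A`. -/
structure El (A : Ty) : Type where
  tm : ℕ → Ex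

/-- The variable bound under `n` other ones. -/
def hvar (A : Ty) (n : ℕ) : El A := ⟨fun m => .var (Nat.sub m (Nat.succ n))⟩

/-- Application. -/
def rapp (f a : ℕ → Ex) : ℕ → Ex := fun n => .app (f n) (a n)

infixl:100 " ▷ " => rapp

/-- Abstraction. -/
def rlam {A : Ty} (f : El A → ℕ → Ex) : ℕ → Ex := fun n => .lam (A n) (f (hvar A n) (Nat.succ n))

/-- A constant at level `1`. -/
def cst (c : Const) : ℕ → Ex := fun _ => .const c 1 1
/-- A constant which is about types at level `0`. -/
def cst0 (c : Const) : ℕ → Ex := fun _ => .const c 0 1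
/-- A reference to a global declaration. -/
def ref (k : ℕ) : ℕ → Ex := fun _ => .ref k

/-- The same term at a convertible type. -/
def cast {A B : Ty} (a : El A) : El B := ⟨a.tm⟩
prefix:max "↟" => cast

-- The type formers are irreducible so that the implicit indices of `El` are found by matching
-- object types and not by unfolding them to terms.
@[irreducible] def U (i : ℕ) : Ty := fun _ => .univ i
@[irreducible] def Pi (A : Ty) (B : El A → Ty) : Ty :=
  fun n => .pi (A n) (B (hvar A n) (Nat.succ n))
abbrev arr' (A B : Ty) : Ty := Pi A fun _ => B
infixr:30 " ⇒ " => arr'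

def fn {A : Ty} {B : El A → Ty} (f : (x : El A) → El (B x)) : El (Pi A B) :=
  ⟨rlam fun x => (f x).tm⟩
def ap' {A : Ty} {B : El A → Ty} (f : El (Pi A B)) (a : El A) : El (B a) := ⟨f.tm ▷ a.tm⟩
instance {A : Ty} {B : El A → Ty} : CoeFun (El (Pi A B)) fun _ => (a : El A) → El (B a) := ⟨ap'⟩

abbrev El.ty {i : ℕ} (A : El (U i)) : Ty := A.tm
abbrev quo {i : ℕ} (A : Ty) : El (U i) := ⟨A⟩

@[irreducible] def Id (A : Ty) (x y : El A) : Ty := cst .Id ▷ A ▷ x.tm ▷ y.tm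
def refl {A : Ty} (x : El A) : El (Id A x x) := ⟨cst .refl ▷ A ▷ x.tm⟩
def J {A : Ty} (C : (x y : El A) → El (Id A x y) → Ty) (d : (x : El A) → El (C x x (refl x)))
    {x y : El A} (p : El (Id A x y)) : El (C x y p) :=
  ⟨cst .idInd ▷ A ▷ (rlam fun x => rlam fun y => rlam fun p => C x y p) ▷
    (rlam fun x => (d x).tm) ▷ x.tm ▷ y.tm ▷ p.tm⟩

@[irreducible] def Sig (A : Ty) (B : El A → Ty) : Ty := cst .Sigma ▷ A ▷ rlam B
abbrev Prod (A B : Ty) : Ty := Sig A fun _ => B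
def pair {A : Ty} (B : El A → Ty) (a : El A) (b : El (B a)) : El (Sig A B) :=
  ⟨cst .pair ▷ A ▷ rlam B ▷ a.tm ▷ b.tm⟩
def sigInd {A : Ty} {B : El A → Ty} (C : El (Sig A B) → Ty)
    (d : (a : El A) → (b : El (B a)) → El (C (pair B a b))) (w : El (Sig A B)) : El (C w) :=
  ⟨cst .sigmaInd ▷ A ▷ rlam B ▷ rlam C ▷ (rlam fun a => rlam fun b => (d a b).tm) ▷ w.tm⟩

-- Level `0` is needed here: the integers have to be an element of `U_0` to serve as the fibre of
-- the universal cover.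
@[irreducible] def Sum (A B : Ty) : Ty := cst0 .Sum ▷ A ▷ B
def inl {A : Ty} (B : Ty) (a : El A) : El (Sum A B) := ⟨cst0 .inl ▷ A ▷ B ▷ a.tm⟩
def inr (A : Ty) {B : Ty} (b : El B) : El (Sum A B) := ⟨cst0 .inr ▷ A ▷ B ▷ b.tm⟩
def sumInd {A B : Ty} (C : El (Sum A B) → Ty) (l : (a : El A) → El (C (inl B a)))
    (r : (b : El B) → El (C (inr A b))) (s : El (Sum A B)) : El (C s) :=
  ⟨cst0 .sumInd ▷ A ▷ B ▷ rlam C ▷ (rlam fun a => (l a).tm) ▷ (rlam fun b => (r b).tm) ▷ s.tm⟩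

@[irreducible] def Empty : Ty := cst .Empty
def absurd (C : Ty) (e : El Empty) : El C := ⟨cst .emptyInd ▷ (rlam fun (_ : El Empty) => C) ▷ e.tm⟩
@[irreducible] def Unit : Ty := cst .Unit
def star : El Unit := ⟨cst .star⟩
def unitInd (C : El Unit → Ty) (c : El (C star)) (x : El Unit) : El (C x) :=
  ⟨cst .unitInd ▷ rlam C ▷ c.tm ▷ x.tm⟩
@[irreducible] def Nat' : Ty := cst .Nat
def zero : El Nat' := ⟨cst .zero⟩
def succ (n : El Nat') : El Nat' := ⟨cst .succ ▷ n.tm⟩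
def natInd (C : El Nat' → Ty) (z : El (C zero)) (s : (n : El Nat') → El (C n) → El (C (succ n)))
    (n : El Nat') : El (C n) :=
  ⟨cst .natInd ▷ rlam C ▷ z.tm ▷ (rlam fun n => rlam fun c => (s n c).tm) ▷ n.tm⟩

@[irreducible] def S1 : Ty := cst .S1
def base : El S1 := ⟨cst .base⟩
def loop : El (Id S1 base base) := ⟨cst .loop⟩

/-- The declaration of a closed term. -/
def decl (id : ℕ) (opq : Bool) {T : Ty} (t : El T) : Decl := ⟨id, opq, T 0, t.tm 0⟩

end
end HoTT

set_option linter.unusedVariables false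

namespace HoTT.Obj
noncomputable section

/-! ### Paths -/

/-- Most results come in two parts: a closed declaration, checked once, and an application of the
reference to it, numbered by its position in `development`. This keeps later terms small. -/
def trDef : El (Pi (U 1) fun A => Pi (A.ty ⇒ U 1) fun C => Pi A.ty fun x => Pi A.ty fun y =>
    Id A.ty x y ⇒ (C x).ty ⇒ (C y).ty) :=
  fn fun _ => fn fun C => fn fun _ => fn fun _ => fn fun p => fn fun u =>
    J (fun x y _ => (C x).ty ⇒ (C y).ty) (fun _ => fn fun u => u) p u
def tr {A : Ty} (C : El A → Ty) {x y : El A} (p : El (Id A x y)) (u : El (C x)) : El (C y) :=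
  ⟨ref 0 ▷ A ▷ rlam C ▷ x.tm ▷ y.tm ▷ p.tm ▷ u.tm⟩

def symDef : El (Pi (U 1) fun A => Pi A.ty fun x => Pi A.ty fun y =>
    Id A.ty x y ⇒ Id A.ty y x) :=
  fn fun _ => fn fun _ => fn fun _ => fn fun p => J (fun x y _ => Id _ y x) (fun x => refl x) p
def sym {A : Ty} {x y : El A} (p : El (Id A x y)) : El (Id A y x) :=
  ⟨ref 1 ▷ A ▷ x.tm ▷ y.tm ▷ p.tm⟩

/-- Induction on the first path makes `refl x ⊙ q` convertible to `q`. The other unit law holds only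
up to a path, `transRefl`. -/
def transDef : El (Pi (U 1) fun A => Pi A.ty fun x => Pi A.ty fun y => Pi A.ty fun z =>
    Id A.ty x y ⇒ Id A.ty y z ⇒ Id A.ty x z) :=
  fn fun A => fn fun _ => fn fun _ => fn fun z => fn fun p => fn fun q =>
    J (fun x y _ => Id A.ty y z ⇒ Id A.ty x z) (fun _ => fn fun q => q) p q
def trans {A : Ty} {x y z : El A} (p : El (Id A x y)) (q : El (Id A y z)) : El (Id A x z) :=
  ⟨ref 2 ▷ A ▷ x.tm ▷ y.tm ▷ z.tm ▷ p.tm ▷ q.tm⟩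
infixl:70 " ⊙ " => trans

/-- Composition of paths through `y`, up to conversion of the endpoints. -/
def via {A : Ty} {x z : El A} (y : El A) {P : Ty} (p : El P) (q : El (Id A y z)) :
    El (Id A x z) :=
  trans (x := x) (y := y) (z := z) ↟p q
/-- A path between convertible terms. -/
def conv {A : Ty} {x y : El A} : El (Id A x y) := ↟(refl x)

def apDef : El (Pi (U 1) fun A => Pi (U 1) fun B => Pi (A.ty ⇒ B.ty) fun f => Pi A.ty fun x =>
    Pi A.ty fun y => Id A.ty x y ⇒ Id B.ty (f x) (f y)) :=
  fn fun _ => fn fun _ => fn fun f => fn fun _ => fn fun _ => fn fun p =>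
    J (fun x y _ => Id _ (f x) (f y)) (fun x => refl (f x)) p
def ap {A B : Ty} (f : El A → El B) {x y : El A} (p : El (Id A x y)) : El (Id B (f x) (f y)) :=
  ⟨ref 3 ▷ A ▷ B ▷ (rlam fun x => (f x).tm) ▷ x.tm ▷ y.tm ▷ p.tm⟩

def apIdDef : El (Pi (U 1) fun A => Pi A.ty fun x => Pi A.ty fun y => Pi (Id A.ty x y) fun p =>
    Id (Id A.ty x y) (ap (fun x => x) p) p) :=
  fn fun _ => fn fun _ => fn fun _ => fn fun p =>
    J (fun x y p => Id (Id _ x y) (ap (fun x => x) p) p) (fun x => ↟(refl (refl x))) p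
def apId {A : Ty} {x y : El A} (p : El (Id A x y)) : El (Id (Id A x y) (ap (fun x => x) p) p) :=
  ⟨ref 4 ▷ A ▷ x.tm ▷ y.tm ▷ p.tm⟩

def transReflDef : El (Pi (U 1) fun A => Pi A.ty fun x => Pi A.ty fun y =>
    Pi (Id A.ty x y) fun p => Id (Id A.ty x y) (p ⊙ refl y) p) :=
  fn fun _ => fn fun _ => fn fun _ => fn fun p =>
    J (fun x y p => Id (Id _ x y) (p ⊙ refl y) p) (fun x => ↟(refl (refl x))) p
def transRefl {A : Ty} {x y : El A} (p : El (Id A x y)) : El (Id (Id A x y) (p ⊙ refl y) p) :=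
  ⟨ref 5 ▷ A ▷ x.tm ▷ y.tm ▷ p.tm⟩

def transSymCancelDef : El (Pi (U 1) fun A => Pi A.ty fun x => Pi A.ty fun y => Pi A.ty fun z =>
    Pi (Id A.ty x y) fun q => Pi (Id A.ty z y) fun p => Id (Id A.ty z y) (p ⊙ sym q ⊙ q) p) :=
  fn fun A => fn fun _ => fn fun _ => fn fun z => fn fun q => fn fun p =>
    J (fun x y q => Pi (Id A.ty z y) fun p => Id (Id A.ty z y) (p ⊙ sym q ⊙ q) p)
      (fun x => fn fun p => ↟(ap (fun r => r ⊙ refl x) (transRefl p) ⊙ transRefl p)) q p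
def transSymCancel {A : Ty} {x y z : El A} (p : El (Id A z y)) (q : El (Id A x y)) :
    El (Id (Id A z y) (p ⊙ sym q ⊙ q) p) :=
  ⟨ref 6 ▷ A ▷ x.tm ▷ y.tm ▷ z.tm ▷ q.tm ▷ p.tm⟩

def transCancelDef : El (Pi (U 1) fun A => Pi A.ty fun x => Pi A.ty fun y => Pi A.ty fun z =>
    Pi (Id A.ty x y) fun p => Pi (Id A.ty y z) fun q => Pi (Id A.ty y z) fun r =>
      Id (Id A.ty x z) (p ⊙ q) (p ⊙ r) ⇒ Id (Id A.ty y z) q r) :=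
  fn fun A => fn fun _ => fn fun _ => fn fun z => fn fun p =>
    J (fun x y p => Pi (Id A.ty y z) fun q => Pi (Id A.ty y z) fun r =>
      Id (Id A.ty x z) (p ⊙ q) (p ⊙ r) ⇒ Id (Id A.ty y z) q r)
      (fun _ => fn fun _ => fn fun _ => fn fun h => ↟h) p
def transCancel {A : Ty} {x y z : El A} (p : El (Id A x y)) {q r : El (Id A y z)}
    (h : El (Id (Id A x z) (p ⊙ q) (p ⊙ r))) : El (Id (Id A y z) q r) :=
  ⟨ref 7 ▷ A ▷ x.tm ▷ y.tm ▷ z.tm ▷ p.tm ▷ q.tm ▷ r.tm ▷ h.tm⟩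

def transAssocDef : El (Pi (U 1) fun A => Pi A.ty fun w => Pi A.ty fun x => Pi A.ty fun y =>
    Pi A.ty fun z => Pi (Id A.ty w x) fun p => Pi (Id A.ty x y) fun q => Pi (Id A.ty y z) fun r =>
      Id (Id A.ty w z) (p ⊙ q ⊙ r) (p ⊙ (q ⊙ r))) :=
  fn fun A => fn fun _ => fn fun _ => fn fun y => fn fun z => fn fun p =>
    J (fun w x p => Pi (Id A.ty x y) fun q => Pi (Id A.ty y z) fun r =>
      Id (Id A.ty w z) (p ⊙ q ⊙ r) (p ⊙ (q ⊙ r)))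
      (fun _ => fn fun q => fn fun r => ↟(refl (q ⊙ r))) p
def transAssoc {A : Ty} {w x y z : El A} (p : El (Id A w x)) (q : El (Id A x y))
    (r : El (Id A y z)) : El (Id (Id A w z) (p ⊙ q ⊙ r) (p ⊙ (q ⊙ r))) :=
  ⟨ref 8 ▷ A ▷ w.tm ▷ x.tm ▷ y.tm ▷ z.tm ▷ p.tm ▷ q.tm ▷ r.tm⟩

def symSymDef : El (Pi (U 1) fun A => Pi A.ty fun x => Pi A.ty fun y =>
    Pi (Id A.ty x y) fun p => Id (Id A.ty x y) (sym (sym p)) p) :=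
  fn fun _ => fn fun _ => fn fun _ => fn fun p =>
    J (fun x y p => Id (Id _ x y) (sym (sym p)) p) (fun x => ↟(refl (refl x))) p
def symSym {A : Ty} {x y : El A} (p : El (Id A x y)) : El (Id (Id A x y) (sym (sym p)) p) :=
  ⟨ref 9 ▷ A ▷ x.tm ▷ y.tm ▷ p.tm⟩

def apSymDef : El (Pi (U 1) fun A => Pi (U 1) fun B => Pi (A.ty ⇒ B.ty) fun f =>
    Pi A.ty fun x => Pi A.ty fun y => Pi (Id A.ty x y) fun p =>
      Id (Id B.ty (f y) (f x)) (ap (fun x => f x) (sym p)) (sym (ap (fun x => f x) p))) :=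
  fn fun _ => fn fun B => fn fun f => fn fun _ => fn fun _ => fn fun p =>
    J (fun x y p => Id (Id B.ty (f y) (f x)) (ap (fun x => f x) (sym p)) (sym (ap (fun x => f x) p)))
      (fun x => ↟(refl (refl (f x)))) p
def apSym {A B : Ty} (f : El A → El B) {x y : El A} (p : El (Id A x y)) :
    El (Id (Id B (f y) (f x)) (ap f (sym p)) (sym (ap f p))) :=
  ⟨ref 10 ▷ A ▷ B ▷ (rlam fun x => (f x).tm) ▷ x.tm ▷ y.tm ▷ p.tm⟩

def apTransDef : El (Pi (U 1) fun A => Pi (U 1) fun B => Pi (A.ty ⇒ B.ty) fun f =>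
    Pi A.ty fun x => Pi A.ty fun y => Pi A.ty fun z => Pi (Id A.ty x y) fun p =>
    Pi (Id A.ty y z) fun q => Id (Id B.ty (f x) (f z))
      (ap (fun x => f x) (p ⊙ q)) (ap (fun x => f x) p ⊙ ap (fun x => f x) q)) :=
  fn fun A => fn fun B => fn fun f => fn fun _ => fn fun _ => fn fun z => fn fun p =>
    J (fun x y p => Pi (Id A.ty y z) fun q => Id (Id B.ty (f x) (f z))
      (ap (fun x => f x) (p ⊙ q)) (ap (fun x => f x) p ⊙ ap (fun x => f x) q))
      (fun _ => fn fun q => ↟(refl (ap (fun x => f x) q))) p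
def apTrans {A B : Ty} (f : El A → El B) {x y z : El A} (p : El (Id A x y)) (q : El (Id A y z)) :
    El (Id (Id B (f x) (f z)) (ap f (p ⊙ q)) (ap f p ⊙ ap f q)) :=
  ⟨ref 11 ▷ A ▷ B ▷ (rlam fun x => (f x).tm) ▷ x.tm ▷ y.tm ▷ z.tm ▷ p.tm ▷ q.tm⟩

def apCompDef : El (Pi (U 1) fun A => Pi (U 1) fun B => Pi (U 1) fun C => Pi (A.ty ⇒ B.ty) fun f =>
    Pi (B.ty ⇒ C.ty) fun g => Pi A.ty fun x => Pi A.ty fun y => Pi (Id A.ty x y) fun p =>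
    Id (Id C.ty (g (f x)) (g (f y))) (ap (fun x => g (f x)) p)
      (ap (fun y => g y) (ap (fun x => f x) p))) :=
  fn fun _ => fn fun _ => fn fun C => fn fun f => fn fun g => fn fun _ => fn fun _ => fn fun p =>
    J (fun x y p => Id (Id C.ty (g (f x)) (g (f y))) (ap (fun x => g (f x)) p)
      (ap (fun y => g y) (ap (fun x => f x) p))) (fun x => ↟(refl (refl (g (f x))))) p
def apComp {A B C : Ty} (f : El A → El B) (g : El B → El C) {x y : El A} (p : El (Id A x y)) :
    El (Id (Id C (g (f x)) (g (f y))) (ap (fun x => g (f x)) p) (ap g (ap f p))) :=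
  ⟨ref 12 ▷ A ▷ B ▷ C ▷ (rlam fun x => (f x).tm) ▷ (rlam fun x => (g x).tm) ▷ x.tm ▷ y.tm ▷ p.tm⟩

/-! ### Transport -/

def trTransDef : El (Pi (U 1) fun A => Pi (A.ty ⇒ U 1) fun C => Pi A.ty fun x => Pi A.ty fun y =>
    Pi A.ty fun z => Pi (Id A.ty x y) fun p => Pi (Id A.ty y z) fun q => Pi (C x).ty fun u =>
    Id (C z).ty (tr (fun x => (C x).ty) (p ⊙ q) u)
      (tr (fun x => (C x).ty) q (tr (fun x => (C x).ty) p u))) :=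
  fn fun A => fn fun C => fn fun _ => fn fun _ => fn fun z => fn fun p =>
    J (fun x y p => Pi (Id A.ty y z) fun q => Pi (C x).ty fun u =>
      Id (C z).ty (tr (fun x => (C x).ty) (p ⊙ q) u)
        (tr (fun x => (C x).ty) q (tr (fun x => (C x).ty) p u)))
      (fun _ => fn fun q => fn fun u => ↟(refl (tr (fun x => (C x).ty) q u))) p
def trTrans {A : Ty} (C : El A → Ty) {x y z : El A} (p : El (Id A x y)) (q : El (Id A y z))
    (u : El (C x)) : El (Id (C z) (tr C (p ⊙ q) u) (tr C q (tr C p u))) :=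
  ⟨ref 13 ▷ A ▷ rlam C ▷ x.tm ▷ y.tm ▷ z.tm ▷ p.tm ▷ q.tm ▷ u.tm⟩

def trSymDef : El (Pi (U 1) fun A => Pi (A.ty ⇒ U 1) fun C => Pi A.ty fun x => Pi A.ty fun y =>
    Pi (Id A.ty x y) fun p => Pi (C x).ty fun u =>
    Id (C x).ty (tr (fun x => (C x).ty) (sym p) (tr (fun x => (C x).ty) p u)) u) :=
  fn fun _ => fn fun C => fn fun _ => fn fun _ => fn fun p =>
    J (fun x _ p => Pi (C x).ty fun u =>
      Id (C x).ty (tr (fun x => (C x).ty) (sym p) (tr (fun x => (C x).ty) p u)) u)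
      (fun _ => fn fun u => ↟(refl u)) p
def trSym {A : Ty} (C : El A → Ty) {x y : El A} (p : El (Id A x y)) (u : El (C x)) :
    El (Id (C x) (tr C (sym p) (tr C p u)) u) :=
  ⟨ref 14 ▷ A ▷ rlam C ▷ x.tm ▷ y.tm ▷ p.tm ▷ u.tm⟩

/-- This trades the transport that circle induction asks for against a commuting square. For
reflexivity the square says `r = p ⊙ refl`. -/
def trEqDef : El (Pi (U 1) fun A => Pi (U 1) fun B => Pi (A.ty ⇒ B.ty) fun f =>
    Pi (A.ty ⇒ B.ty) fun g => Pi A.ty fun x => Pi A.ty fun y => Pi (Id A.ty x y) fun q =>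
    Pi (Id B.ty (f x) (g x)) fun p => Pi (Id B.ty (f y) (g y)) fun r =>
    Id (Id B.ty (f x) (g y)) (ap (fun x => f x) q ⊙ r) (p ⊙ ap (fun x => g x) q) ⇒
    Id (Id B.ty (f y) (g y)) (tr (fun x => Id B.ty (f x) (g x)) q p) r) :=
  fn fun _ => fn fun B => fn fun f => fn fun g => fn fun _ => fn fun _ => fn fun q =>
    J (fun x y q => Pi (Id B.ty (f x) (g x)) fun p => Pi (Id B.ty (f y) (g y)) fun r =>
      Id (Id B.ty (f x) (g y)) (ap (fun x => f x) q ⊙ r) (p ⊙ ap (fun x => g x) q) ⇒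
      Id (Id B.ty (f y) (g y)) (tr (fun x => Id B.ty (f x) (g x)) q p) r)
      (fun x => fn fun p => fn fun r => fn fun h =>
        ↟(sym ((↟h : El (Id (Id B.ty (f x) (g x)) r (p ⊙ refl (g x)))) ⊙ transRefl p))) q
def trEq {A B : Ty} (f g : El A → El B) {x y : El A} (q : El (Id A x y))
    (p : El (Id B (f x) (g x))) (r : El (Id B (f y) (g y)))
    (h : El (Id (Id B (f x) (g y)) (ap f q ⊙ r) (p ⊙ ap g q))) :
    El (Id (Id B (f y) (g y)) (tr (fun x => Id B (f x) (g x)) q p) r) :=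
  ⟨ref 15 ▷ A ▷ B ▷ (rlam fun x => (f x).tm) ▷ (rlam fun x => (g x).tm) ▷ x.tm ▷ y.tm ▷ q.tm ▷
    p.tm ▷ r.tm ▷ h.tm⟩

def trPathDef : El (Pi (U 1) fun A => Pi A.ty fun a => Pi A.ty fun x => Pi A.ty fun y =>
    Pi (Id A.ty x y) fun q => Pi (Id A.ty a x) fun p =>
    Id (Id A.ty a y) (tr (fun x => Id A.ty a x) q p) (p ⊙ q)) :=
  fn fun A => fn fun a => fn fun _ => fn fun _ => fn fun q =>
    J (fun x y q => Pi (Id A.ty a x) fun p =>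
      Id (Id A.ty a y) (tr (fun x => Id A.ty a x) q p) (p ⊙ q))
      (fun _ => fn fun p => ↟(sym (transRefl p))) q
def trPath {A : Ty} {a x y : El A} (q : El (Id A x y)) (p : El (Id A a x)) :
    El (Id (Id A a y) (tr (fun x => Id A a x) q p) (p ⊙ q)) :=
  ⟨ref 16 ▷ A ▷ a.tm ▷ x.tm ▷ y.tm ▷ q.tm ▷ p.tm⟩

def trConstDef : El (Pi (U 1) fun A => Pi (U 1) fun B => Pi A.ty fun x => Pi A.ty fun y =>
    Pi (Id A.ty x y) fun p => Pi B.ty fun b => Id B.ty (tr (fun _ => B.ty) p b) b) :=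
  fn fun _ => fn fun B => fn fun _ => fn fun _ => fn fun p =>
    J (fun _ _ p => Pi B.ty fun b => Id B.ty (tr (fun _ => B.ty) p b) b)
      (fun _ => fn fun b => ↟(refl b)) p
def trConst {A B : Ty} {x y : El A} (p : El (Id A x y)) (b : El B) :
    El (Id B (tr (fun _ => B) p b) b) :=
  ⟨ref 17 ▷ A ▷ B ▷ x.tm ▷ y.tm ▷ p.tm ▷ b.tm⟩

def apDDef : El (Pi (U 1) fun A => Pi (A.ty ⇒ U 1) fun C => Pi (Pi A.ty fun x => (C x).ty) fun f =>
    Pi A.ty fun x => Pi A.ty fun y => Pi (Id A.ty x y) fun p =>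
    Id (C y).ty (tr (fun x => (C x).ty) p (f x)) (f y)) :=
  fn fun _ => fn fun C => fn fun f => fn fun _ => fn fun _ => fn fun p =>
    J (fun x y p => Id (C y).ty (tr (fun x => (C x).ty) p (f x)) (f y)) (fun x => ↟(refl (f x))) p
def apD {A : Ty} {C : El A → Ty} (f : (x : El A) → El (C x)) {x y : El A} (p : El (Id A x y)) :
    El (Id (C y) (tr C p (f x)) (f y)) :=
  ⟨ref 18 ▷ A ▷ rlam C ▷ (rlam fun x => (f x).tm) ▷ x.tm ▷ y.tm ▷ p.tm⟩

def apDConstDef : El (Pi (U 1) fun A => Pi (U 1) fun B => Pi (A.ty ⇒ B.ty) fun f =>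
    Pi A.ty fun x => Pi A.ty fun y => Pi (Id A.ty x y) fun p =>
    Id (Id B.ty (tr (fun _ => B.ty) p (f x)) (f y)) (apD (fun x => f x) p)
      (trConst p (f x) ⊙ ap (fun x => f x) p)) :=
  fn fun _ => fn fun B => fn fun f => fn fun _ => fn fun _ => fn fun p =>
    J (fun x y p => Id (Id B.ty (tr (fun _ => B.ty) p (f x)) (f y)) (apD (fun x => f x) p)
      (trConst p (f x) ⊙ ap (fun x => f x) p)) (fun x => ↟(refl (refl (f x)))) p
def apDConst {A B : Ty} (f : El A → El B) {x y : El A} (p : El (Id A x y)) :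
    El (Id (Id B (tr (fun _ => B) p (f x)) (f y)) (apD f p) (trConst p (f x) ⊙ ap f p)) :=
  ⟨ref 19 ▷ A ▷ B ▷ (rlam fun x => (f x).tm) ▷ x.tm ▷ y.tm ▷ p.tm⟩

/-! ### Function extensionality -/

def fstDef : El (Pi (U 1) fun A => Pi (A.ty ⇒ U 1) fun B => (Sig A.ty fun x => (B x).ty) ⇒ A.ty) :=
  fn fun A => fn fun _ => fn fun w => sigInd (fun _ => A.ty) (fun a _ => a) w
def fst {A : Ty} {B : El A → Ty} (w : El (Sig A B)) : El A := ⟨ref 20 ▷ A ▷ rlam B ▷ w.tm⟩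

def sndDef : El (Pi (U 1) fun A => Pi (A.ty ⇒ U 1) fun B =>
    Pi (Sig A.ty fun x => (B x).ty) fun w => (B (fst w)).ty) :=
  fn fun _ => fn fun B => fn fun w => sigInd (fun w => (B (fst w)).ty) (fun _ b => ↟b) w
def snd {A : Ty} {B : El A → Ty} (w : El (Sig A B)) : El (B (fst w)) :=
  ⟨ref 21 ▷ A ▷ rlam B ▷ w.tm⟩

/-! ### Equivalences as maps with a section and a retraction. -/

def Rinv (A B : Ty) (f : El (A ⇒ B)) : Ty := Sig (B ⇒ A) fun g => Pi B fun y => Id B (f (g y)) y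
def Linv (A B : Ty) (f : El (A ⇒ B)) : Ty := Sig (B ⇒ A) fun h => Pi A fun x => Id A (h (f x)) x
def IsEqv (A B : Ty) (f : El (A ⇒ B)) : Ty := Prod (Rinv A B f) (Linv A B f)
def Eqv (A B : Ty) : Ty := Sig (A ⇒ B) fun f => IsEqv A B f

def isEqvOfInv {A B : Ty} {f : El (A ⇒ B)} (g : El (B ⇒ A)) (ε : El (Pi B fun y => Id B (f (g y)) y))
    (η : El (Pi A fun x => Id A (g (f x)) x)) : El (IsEqv A B f) :=
  pair (fun _ => Linv A B f) (pair (A := B ⇒ A) (fun g => Pi B fun y => Id B (f (g y)) y) g ε)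
    (pair (A := B ⇒ A) (fun h => Pi A fun x => Id A (h (f x)) x) g η)

def happlyDef : El (Pi (U 1) fun A => Pi (A.ty ⇒ U 1) fun B => Pi (Pi A.ty fun x => (B x).ty) fun f =>
    Pi (Pi A.ty fun x => (B x).ty) fun g => Id (Pi A.ty fun x => (B x).ty) f g ⇒
    Pi A.ty fun x => Id (B x).ty (f x) (g x)) :=
  fn fun A => fn fun B => fn fun _ => fn fun _ => fn fun p =>
    J (A := Pi A.ty fun x => (B x).ty) (fun f g _ => Pi A.ty fun x => Id (B x).ty (f x) (g x))
      (fun f => fn fun x => refl (f x)) p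
def happly {A : Ty} {B : El A → Ty} {f g : El (Pi A B)} (p : El (Id (Pi A B) f g)) :
    El (Pi A fun x => Id (B x) (f x) (g x)) :=
  ⟨ref 22 ▷ A ▷ rlam B ▷ f.tm ▷ g.tm ▷ p.tm⟩

def funextEqv {A : Ty} {B : El A → Ty} (f g : El (Pi A B)) :
    El (IsEqv (Id (Pi A B) f g) (Pi A fun x => Id (B x) (f x) (g x)) (fn fun p => happly p)) :=
  ⟨cst .funext ▷ A ▷ rlam B ▷ f.tm ▷ g.tm⟩

def funextDef : El (Pi (U 1) fun A => Pi (A.ty ⇒ U 1) fun B => Pi (Pi A.ty fun x => (B x).ty) fun f =>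
    Pi (Pi A.ty fun x => (B x).ty) fun g => (Pi A.ty fun x => Id (B x).ty (f x) (g x)) ⇒
    Id (Pi A.ty fun x => (B x).ty) f g) :=
  fn fun _ => fn fun _ => fn fun f => fn fun g => fst (fst (funextEqv f g))
def funext {A : Ty} {B : El A → Ty} {f g : El (Pi A B)}
    (h : El (Pi A fun x => Id (B x) (f x) (g x))) : El (Id (Pi A B) f g) :=
  ⟨ref 23 ▷ A ▷ rlam B ▷ f.tm ▷ g.tm ▷ h.tm⟩

def happlyFunextDef : El (Pi (U 1) fun A => Pi (A.ty ⇒ U 1) fun B =>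
    Pi (Pi A.ty fun x => (B x).ty) fun f => Pi (Pi A.ty fun x => (B x).ty) fun g =>
    Pi (Pi A.ty fun x => Id (B x).ty (f x) (g x)) fun h =>
    Id (Pi A.ty fun x => Id (B x).ty (f x) (g x)) (happly (funext h)) h) :=
  fn fun _ => fn fun _ => fn fun f => fn fun g => fn fun h => ↟(snd (fst (funextEqv f g)) h)
def happlyFunext {A : Ty} {B : El A → Ty} {f g : El (Pi A B)}
    (h : El (Pi A fun x => Id (B x) (f x) (g x))) :
    El (Id (Pi A fun x => Id (B x) (f x) (g x)) (happly (funext h)) h) :=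
  ⟨ref 24 ▷ A ▷ rlam B ▷ f.tm ▷ g.tm ▷ h.tm⟩

def trFunDef : El (Pi (U 1) fun A => Pi (A.ty ⇒ U 1) fun C => Pi (A.ty ⇒ U 1) fun D =>
    Pi A.ty fun x => Pi A.ty fun y => Pi (Id A.ty x y) fun p =>
    Pi ((C x).ty ⇒ (D x).ty) fun f => Pi ((C y).ty ⇒ (D y).ty) fun g =>
    (Pi (C x).ty fun z => Id (D y).ty (tr (fun x => (D x).ty) p (f z))
      (g (tr (fun x => (C x).ty) p z))) ⇒
    Id ((C y).ty ⇒ (D y).ty) (tr (fun x => (C x).ty ⇒ (D x).ty) p f) g) :=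
  fn fun _ => fn fun C => fn fun D => fn fun _ => fn fun _ => fn fun p =>
    J (fun x y p => Pi ((C x).ty ⇒ (D x).ty) fun f => Pi ((C y).ty ⇒ (D y).ty) fun g =>
      (Pi (C x).ty fun z => Id (D y).ty (tr (fun x => (D x).ty) p (f z))
        (g (tr (fun x => (C x).ty) p z))) ⇒
      Id ((C y).ty ⇒ (D y).ty) (tr (fun x => (C x).ty ⇒ (D x).ty) p f) g)
      (fun x => fn fun f => fn fun g => fn fun h => ↟(funext (f := f) (g := g) ↟h)) p
def trFun {A : Ty} (C D : El A → Ty) {x y : El A} (p : El (Id A x y)) (f : El (C x ⇒ D x))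
    (g : El (C y ⇒ D y)) (h : El (Pi (C x) fun z => Id (D y) (tr D p (f z)) (g (tr C p z)))) :
    El (Id (C y ⇒ D y) (tr (fun x => C x ⇒ D x) p f) g) :=
  ⟨ref 25 ▷ A ▷ rlam C ▷ rlam D ▷ x.tm ▷ y.tm ▷ p.tm ▷ f.tm ▷ g.tm ▷ h.tm⟩

/-! ### Propositions -/

abbrev IsProp (A : Ty) : Ty := Pi A fun x => Pi A fun y => Id A x y

def isPropPiDef : El (Pi (U 1) fun A => Pi (A.ty ⇒ U 1) fun B =>
    (Pi A.ty fun x => IsProp (B x).ty) ⇒ IsProp (Pi A.ty fun x => (B x).ty)) :=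
  fn fun _ => fn fun _ => fn fun h => fn fun f => fn fun g => funext (fn fun x => h x (f x) (g x))
def isPropPi {A : Ty} {B : El A → Ty} (h : (x : El A) → El (IsProp (B x))) :
    El (IsProp (Pi A B)) :=
  ⟨ref 26 ▷ A ▷ rlam B ▷ rlam fun x => (h x).tm⟩

def isPropEmpty : El (IsProp Empty) := fn fun x => fn fun _ => absurd _ x

def isPropUnitDef : El (IsProp Unit) :=
  fn fun x => fn fun y => unitInd (fun x => Id Unit x y) (unitInd (fun y => Id Unit star y) (refl star) y) x
def isPropUnit : El (IsProp Unit) := ⟨ref 27⟩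

def isPropNeg {A : Ty} (B : El A → Ty) : El (IsProp (Pi A fun x => B x ⇒ Empty)) :=
  isPropPi fun _ => isPropPi fun _ => isPropEmpty

def pairEqDef : El (Pi (U 1) fun A => Pi (U 1) fun B => Pi A.ty fun a => Pi A.ty fun a' =>
    Pi B.ty fun b => Pi B.ty fun b' => Id A.ty a a' ⇒ Id B.ty b b' ⇒
    Id (Prod A.ty B.ty) (pair (fun _ => B.ty) a b) (pair (fun _ => B.ty) a' b')) :=
  fn fun _ => fn fun B => fn fun _ => fn fun a' => fn fun b => fn fun _ => fn fun p => fn fun q =>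
    ap (fun a => pair (fun _ => B.ty) a b) p ⊙ ap (fun b => pair (fun _ => B.ty) a' b) q
def pairEq {A B : Ty} {a a' : El A} {b b' : El B} (p : El (Id A a a')) (q : El (Id B b b')) :
    El (Id (Prod A B) (pair (fun _ => B) a b) (pair (fun _ => B) a' b')) :=
  ⟨ref 28 ▷ A ▷ B ▷ a.tm ▷ a'.tm ▷ b.tm ▷ b'.tm ▷ p.tm ▷ q.tm⟩

def pairEqPropDef : El (Pi (U 1) fun A => Pi (A.ty ⇒ U 1) fun B =>
    (Pi A.ty fun x => IsProp (B x).ty) ⇒ Pi A.ty fun a => Pi A.ty fun a' => Id A.ty a a' ⇒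
    Pi (B a).ty fun b => Pi (B a').ty fun b' => Id (Sig A.ty fun x => (B x).ty)
      (pair (fun x => (B x).ty) a b) (pair (fun x => (B x).ty) a' b')) :=
  fn fun A => fn fun B => fn fun h => fn fun _ => fn fun _ => fn fun p =>
    J (fun a a' _ => Pi (B a).ty fun b => Pi (B a').ty fun b' => Id (Sig A.ty fun x => (B x).ty)
      (pair (fun x => (B x).ty) a b) (pair (fun x => (B x).ty) a' b'))
      (fun a => fn fun b => fn fun b' => ap (fun b => pair (fun x => (B x).ty) a b) (h a b b')) p
def pairEqProp {A : Ty} (B : El A → Ty) (h : (x : El A) → El (IsProp (B x))) {a a' : El A}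
    (p : El (Id A a a')) (b : El (B a)) (b' : El (B a')) :
    El (Id (Sig A B) (pair B a b) (pair B a' b')) :=
  ⟨ref 29 ▷ A ▷ rlam B ▷ (rlam fun x => (h x).tm) ▷ a.tm ▷ a'.tm ▷ p.tm ▷ b.tm ▷ b'.tm⟩

/-- A reflexive family of propositions which implies identity makes a type a set. -/
def isSetOfRelDef : El (Pi (U 1) fun A => Pi (A.ty ⇒ A.ty ⇒ U 1) fun R =>
    (Pi A.ty fun x => (R x x).ty) ⇒ (Pi A.ty fun x => Pi A.ty fun y => IsProp (R x y).ty) ⇒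
    (Pi A.ty fun x => Pi A.ty fun y => (R x y).ty ⇒ Id A.ty x y) ⇒
    Pi A.ty fun x => Pi A.ty fun y => IsProp (Id A.ty x y)) :=
  fn fun A => fn fun R => fn fun ρ => fn fun h => fn fun i => fn fun x => fn fun y =>
    fn fun p => fn fun q =>
    -- Each path `p` is equal to one that depends on `p` only through an element of the proposition
    -- `R x y`, so any two paths agree.
    let e (p : El (Id A.ty x y)) :
        El (Id (Id A.ty x y) p (sym (i x x (ρ x)) ⊙ i x y (tr (fun y => (R x y).ty) p (ρ x)))) :=
      J (fun x y p => Id (Id A.ty x y) p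
        (sym (i x x (ρ x)) ⊙ i x y (tr (fun y => (R x y).ty) p (ρ x))))
        (fun x => ↟(sym (transSymCancel (refl x) (i x x (ρ x))))) p
    e p ⊙ ap (fun r => sym (i x x (ρ x)) ⊙ i x y r)
      (h x y (tr (fun y => (R x y).ty) p (ρ x)) (tr (fun y => (R x y).ty) q (ρ x))) ⊙ sym (e q)
def isSetOfRel {A : Ty} (R : El A → El A → Ty) (ρ : (x : El A) → El (R x x))
    (h : (x y : El A) → El (IsProp (R x y))) (i : (x y : El A) → El (R x y) → El (Id A x y))
    (x y : El A) : El (IsProp (Id A x y)) :=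
  ⟨ref 30 ▷ A ▷ (rlam fun x => rlam fun y => R x y) ▷ (rlam fun x => (ρ x).tm) ▷
    (rlam fun x => rlam fun y => (h x y).tm) ▷ (rlam fun x => rlam fun y => rlam fun r => (i x y r).tm) ▷
    x.tm ▷ y.tm⟩

/-! ### Equivalences and univalence -/

def isEqvId (A : Ty) : El (IsEqv A A (fn fun x => x)) :=
  isEqvOfInv (fn fun x => x) (fn fun x => ↟(refl x)) (fn fun x => ↟(refl x))

def idEqv (A : Ty) : El (Eqv A A) := pair (A := A ⇒ A) (fun f => IsEqv A A f) (fn fun x => x) (isEqvId A)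

def happlyPairDef : El (Pi (U 1) fun A => Pi (A.ty ⇒ A.ty) fun f => Pi (A.ty ⇒ A.ty) fun g =>
    Pi (Id (A.ty ⇒ A.ty) f g) fun p =>
    Id (Sig (A.ty ⇒ A.ty) fun h => Pi A.ty fun x => Id A.ty (h x) (g x))
      (pair (A := A.ty ⇒ A.ty) (fun h => Pi A.ty fun x => Id A.ty (h x) (g x)) f (happly p))
      (pair (A := A.ty ⇒ A.ty) (fun h => Pi A.ty fun x => Id A.ty (h x) (g x)) g
        (fn fun x => refl (g x)))) :=
  fn fun A => fn fun _ => fn fun _ => fn fun p => J (A := A.ty ⇒ A.ty)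
    (fun f g p => Id (Sig (A.ty ⇒ A.ty) fun h => Pi A.ty fun x => Id A.ty (h x) (g x))
      (pair (A := A.ty ⇒ A.ty) (fun h => Pi A.ty fun x => Id A.ty (h x) (g x)) f (happly p))
      (pair (A := A.ty ⇒ A.ty) (fun h => Pi A.ty fun x => Id A.ty (h x) (g x)) g
        (fn fun x => refl (g x)))) (fun _ => conv) p
def happlyPair {A : Ty} {f g : El (A ⇒ A)} (p : El (Id (A ⇒ A) f g)) :
    El (Id (Sig (A ⇒ A) fun h => Pi A fun x => Id A (h x) (g x))
      (pair (A := A ⇒ A) (fun h => Pi A fun x => Id A (h x) (g x)) f (happly p))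
      (pair (A := A ⇒ A) (fun h => Pi A fun x => Id A (h x) (g x)) g (fn fun x => refl (g x)))) :=
  ⟨ref 31 ▷ A ▷ f.tm ▷ g.tm ▷ p.tm⟩

/-- The functions homotopic to the identity form a contractible type. -/
def homotopyIdCenterDef : El (Pi (U 1) fun A =>
    Pi (Sig (A.ty ⇒ A.ty) fun h => Pi A.ty fun x => Id A.ty (h x) x) fun w =>
    Id (Sig (A.ty ⇒ A.ty) fun h => Pi A.ty fun x => Id A.ty (h x) x) w
      (pair (A := A.ty ⇒ A.ty) (fun h => Pi A.ty fun x => Id A.ty (h x) x) (fn fun x => x)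
        (fn fun _ => conv))) :=
  fn fun A => fn fun w =>
    let P (h : El (A.ty ⇒ A.ty)) : Ty := Pi A.ty fun x => Id A.ty (h x) x
    let i : El (A.ty ⇒ A.ty) := fn fun x => x
    sigInd (fun w => Id (Sig (A.ty ⇒ A.ty) P) w (pair P i (fn fun _ => conv)))
      -- The homotopy `h` is replaced by `happly (funext h)`, to which path induction applies in the
      -- form of `happlyPair`.
      (fun f h => via (pair P f ↟(happly (funext (f := f) (g := i) ↟h)))
        (ap (A := P f) (fun h => pair P f h) (sym (x := ↟(happly (funext (f := f) (g := i) ↟h))) (y := h)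
          ↟(happlyFunext (f := f) (g := i) ↟h)))
        ↟(happlyPair (funext (f := f) (g := i) ↟h))) w
def homotopyIdCenter {A : Ty} (w : El (Sig (A ⇒ A) fun h => Pi A fun x => Id A (h x) x)) :
    El (Id (Sig (A ⇒ A) fun h => Pi A fun x => Id A (h x) x) w
      (pair (A := A ⇒ A) (fun h => Pi A fun x => Id A (h x) x) (fn fun x => x)
        (fn fun _ => conv))) :=
  ⟨ref 32 ▷ A ▷ w.tm⟩

/-- For the identity map, sections and retractions are, up to conversion, functions homotopic to the
identity. Both factors are therefore contractible. -/
def isEqvIdCenterDef : El (Pi (U 1) fun A => Pi (IsEqv A.ty A.ty (fn fun x => x)) fun e =>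
    Id (IsEqv A.ty A.ty (fn fun x => x)) e (isEqvId A.ty)) :=
  fn fun A => fn fun e =>
    sigInd (fun e => Id (IsEqv A.ty A.ty (fn fun x => x)) e (isEqvId A.ty))
      (fun r l => ↟(pairEq (homotopyIdCenter (A := A.ty) ↟r) (homotopyIdCenter (A := A.ty) ↟l))) e
def isEqvIdCenter {A : Ty} (e : El (IsEqv A A (fn fun x => x))) :
    El (Id (IsEqv A A (fn fun x => x)) e (isEqvId A)) :=
  ⟨ref 33 ▷ A ▷ e.tm⟩

def idToEqvDef : El (Pi (U 0) fun A => Pi (U 0) fun B => Id (U 0) A B ⇒ Eqv A.ty B.ty) :=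
  fn fun _ => fn fun _ => fn fun p => J (fun A B _ => Eqv A.ty B.ty) (fun A => idEqv A.ty) p
def idToEqv {A B : El (U 0)} (p : El (Id (U 0) A B)) : El (Eqv A.ty B.ty) :=
  ⟨ref 34 ▷ A.tm ▷ B.tm ▷ p.tm⟩

def eqvFun {A B : Ty} (e : El (Eqv A B)) : El (A ⇒ B) := fst (A := A ⇒ B) (B := fun f => IsEqv A B f) e
def coe {A B : El (U 0)} (p : El (Id (U 0) A B)) : El (A.ty ⇒ B.ty) := eqvFun (idToEqv p)

def univalence (A B : El (U 0)) :
    El (IsEqv (Id (U 0) A B) (Eqv A.ty B.ty) (fn fun p => idToEqv p)) :=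
  ⟨cst0 .univalence ▷ A.tm ▷ B.tm⟩

def uaDef : El (Pi (U 0) fun A => Pi (U 0) fun B => Eqv A.ty B.ty ⇒ Id (U 0) A B) :=
  fn fun A => fn fun B => fst (fst (univalence A B))
def ua {A B : El (U 0)} (e : El (Eqv A.ty B.ty)) : El (Id (U 0) A B) :=
  ⟨ref 35 ▷ A.tm ▷ B.tm ▷ e.tm⟩

def idToEqvUaDef : El (Pi (U 0) fun A => Pi (U 0) fun B => Pi (Eqv A.ty B.ty) fun e =>
    Id (Eqv A.ty B.ty) (idToEqv (ua e)) e) :=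
  fn fun A => fn fun B => fn fun e => ↟(snd (fst (univalence A B)) e)
def idToEqvUa {A B : El (U 0)} (e : El (Eqv A.ty B.ty)) :
    El (Id (Eqv A.ty B.ty) (idToEqv (ua e)) e) :=
  ⟨ref 36 ▷ A.tm ▷ B.tm ▷ e.tm⟩

/-- A map with a retraction is injective; univalence supplies the retraction `k`. -/
def idToEqvInjDef : El (Pi (U 0) fun A => Pi (U 0) fun B => Pi (Id (U 0) A B) fun p =>
    Pi (Id (U 0) A B) fun q => Id (Eqv A.ty B.ty) (idToEqv p) (idToEqv q) ⇒
    Id (Id (U 0) A B) p q) :=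
  fn fun A => fn fun B => fn fun p => fn fun q => fn fun h =>
    let k : El (Eqv A.ty B.ty ⇒ Id (U 0) A B) := fst (snd (univalence A B))
    let η (p : El (Id (U 0) A B)) : El (Id (Id (U 0) A B) (k (idToEqv p)) p) :=
      ↟(snd (snd (univalence A B)) p)
    sym (η p) ⊙ ap (fun e => k e) h ⊙ η q
def idToEqvInj {A B : El (U 0)} {p q : El (Id (U 0) A B)}
    (h : El (Id (Eqv A.ty B.ty) (idToEqv p) (idToEqv q))) : El (Id (Id (U 0) A B) p q) :=
  ⟨ref 37 ▷ A.tm ▷ B.tm ▷ p.tm ▷ q.tm ▷ h.tm⟩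

/-- Function extensionality reduces to the case where the underlying map is the identity. There the
remaining component is unique by `isEqvIdCenter`; the statement is transported for all such
components at once. -/
def eqvEqIdDef : El (Pi (U 0) fun A => Pi (Eqv A.ty A.ty) fun w =>
    (Pi A.ty fun x => Id A.ty x (eqvFun w x)) ⇒ Id (Eqv A.ty A.ty) (idEqv A.ty) w) :=
  fn fun A => fn fun w =>
    sigInd (A := A.ty ⇒ A.ty) (B := fun f => IsEqv A.ty A.ty f)
      (fun w => (Pi A.ty fun x => Id A.ty x (eqvFun w x)) ⇒ Id (Eqv A.ty A.ty) (idEqv A.ty) w)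
      (fun f e => fn fun h =>
        tr (fun f => Pi (IsEqv A.ty A.ty f) fun e => Id (Eqv A.ty A.ty) (idEqv A.ty)
            (pair (A := A.ty ⇒ A.ty) (fun f => IsEqv A.ty A.ty f) f e))
          (funext (f := fn fun x => x) (g := f) ↟h)
          (fn fun e => ap (fun e => pair (A := A.ty ⇒ A.ty) (fun f => IsEqv A.ty A.ty f) (fn fun x => x) e)
            (sym (isEqvIdCenter e))) e) w
def eqvEqId {A : El (U 0)} {w : El (Eqv A.ty A.ty)}
    (h : El (Pi A.ty fun x => Id A.ty x (eqvFun w x))) : El (Id (Eqv A.ty A.ty) (idEqv A.ty) w) :=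
  ⟨ref 38 ▷ A.tm ▷ w.tm ▷ h.tm⟩

/-- Identifications of types are determined by their coercions. -/
def eqOfCoeDef : El (Pi (U 0) fun A => Pi (U 0) fun B => Pi (Id (U 0) A B) fun p =>
    Pi (Id (U 0) A B) fun q => (Pi A.ty fun x => Id B.ty (coe p x) (coe q x)) ⇒
    Id (Id (U 0) A B) p q) :=
  fn fun _ => fn fun _ => fn fun p =>
    J (fun A B p => Pi (Id (U 0) A B) fun q => (Pi A.ty fun x => Id B.ty (coe p x) (coe q x)) ⇒
      Id (Id (U 0) A B) p q)
      -- Once `p` is reflexivity, the hypothesis says that `q` coerces like the identity.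
      (fun A => fn fun q => fn fun h => idToEqvInj (p := refl A) (q := q) ↟(eqvEqId (w := idToEqv q) ↟h)) p
def eqOfCoe {A B : El (U 0)} {p q : El (Id (U 0) A B)}
    (h : El (Pi A.ty fun x => Id B.ty (coe p x) (coe q x))) : El (Id (Id (U 0) A B) p q) :=
  ⟨ref 39 ▷ A.tm ▷ B.tm ▷ p.tm ▷ q.tm ▷ h.tm⟩

def isPropIsEqvCoeDef : El (Pi (U 0) fun A => Pi (U 0) fun B => Pi (Id (U 0) A B) fun p =>
    IsProp (IsEqv A.ty B.ty (coe p))) :=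
  fn fun _ => fn fun _ => fn fun p =>
    J (fun A B p => IsProp (IsEqv A.ty B.ty (coe p)))
      (fun A => fn fun e => fn fun e' => ↟(isEqvIdCenter (A := A.ty) ↟e ⊙ sym (isEqvIdCenter ↟e'))) p
def isPropIsEqvCoe {A B : El (U 0)} (p : El (Id (U 0) A B)) :
    El (IsProp (IsEqv A.ty B.ty (coe p))) :=
  ⟨ref 40 ▷ A.tm ▷ B.tm ▷ p.tm⟩

/-- An element `e` makes `f` an equivalence, hence by univalence a coercion. For coercions path
induction reduces the claim to the identity. -/
def isPropIsEqvDef : El (Pi (U 0) fun A => Pi (U 0) fun B => Pi (A.ty ⇒ B.ty) fun f =>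
    IsProp (IsEqv A.ty B.ty f)) :=
  fn fun A => fn fun B => fn fun f => fn fun e =>
    let w : El (Eqv A.ty B.ty) := pair (A := A.ty ⇒ B.ty) (fun f => IsEqv A.ty B.ty f) f e
    tr (fun f => IsProp (IsEqv A.ty B.ty f))
      (↟(ap (fun w => eqvFun w) (idToEqvUa (A := A) (B := B) w)) : El (Id (A.ty ⇒ B.ty) (coe (ua w)) f))
      (isPropIsEqvCoe (ua w)) e
def isPropIsEqv {A B : El (U 0)} (f : El (A.ty ⇒ B.ty)) : El (IsProp (IsEqv A.ty B.ty f)) :=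
  ⟨ref 41 ▷ A.tm ▷ B.tm ▷ f.tm⟩

def coeUaDef : El (Pi (U 0) fun A => Pi (U 0) fun B => Pi (Eqv A.ty B.ty) fun e => Pi A.ty fun x =>
    Id B.ty (coe (ua e) x) (eqvFun e x)) :=
  fn fun _ => fn fun _ => fn fun e => fn fun x => ap (fun w => eqvFun w x) (idToEqvUa e)
def coeUa {A B : El (U 0)} (e : El (Eqv A.ty B.ty)) (x : El A.ty) :
    El (Id B.ty (coe (ua e) x) (eqvFun e x)) :=
  ⟨ref 42 ▷ A.tm ▷ B.tm ▷ e.tm ▷ x.tm⟩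

/-- This links transport in a family of types to coercion, the form in which `ua` computes. -/
def trCoeDef : El (Pi (U 1) fun A => Pi (A.ty ⇒ U 0) fun C => Pi A.ty fun x => Pi A.ty fun y =>
    Pi (Id A.ty x y) fun p => Pi (C x).ty fun u =>
    Id (C y).ty (tr (fun x => (C x).ty) p u) (coe (ap (fun x => C x) p) u)) :=
  fn fun _ => fn fun C => fn fun _ => fn fun _ => fn fun p =>
    J (fun x y p => Pi (C x).ty fun u =>
      Id (C y).ty (tr (fun x => (C x).ty) p u) (coe (ap (fun x => C x) p) u))
      (fun _ => fn fun u => ↟(refl u)) p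
def trCoe {A : Ty} (C : El A → El (U 0)) {x y : El A} (p : El (Id A x y)) (u : El (C x).ty) :
    El (Id (C y).ty (tr (fun x => (C x).ty) p u) (coe (ap C p) u)) :=
  ⟨ref 43 ▷ A ▷ (rlam fun x => (C x).tm) ▷ x.tm ▷ y.tm ▷ p.tm ▷ u.tm⟩

/-! ### The circle -/

def s1Ind (C : El S1 → Ty) (b : El (C base)) (l : El (Id (C base) (tr C loop b) b)) (x : El S1) :
    El (C x) :=
  ⟨cst .s1Ind ▷ rlam C ▷ b.tm ▷ l.tm ▷ x.tm⟩
def s1LoopComp (C : El S1 → Ty) (b : El (C base)) (l : El (Id (C base) (tr C loop b) b)) :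
    El (Id (Id (C base) (tr C loop (s1Ind C b l base)) (s1Ind C b l base))
      (apD (s1Ind C b l) loop) ↟l) :=
  ⟨cst .s1LoopComp ▷ rlam C ▷ b.tm ▷ l.tm⟩

def s1RecDef : El (Pi (U 1) fun B => Pi B.ty fun b => Id B.ty b b ⇒ S1 ⇒ B.ty) :=
  fn fun B => fn fun b => fn fun l => fn fun x =>
    s1Ind (fun _ => B.ty) b (trConst loop b ⊙ l) x
def s1Rec {B : Ty} {b : El B} (l : El (Id B b b)) : El (S1 ⇒ B) := ⟨ref 44 ▷ B ▷ b.tm ▷ l.tm⟩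

/-- The recursor is the inductor of a constant family. Its dependent action on `loop` is `trConst ⊙
ap` by `apDConst` and `trConst ⊙ l` by the computation rule, and the common factor cancels. -/
def s1RecLoopDef : El (Pi (U 1) fun B => Pi B.ty fun b => Pi (Id B.ty b b) fun l =>
    Id (Id B.ty b b) ↟(ap (fun x => s1Rec l x) loop) l) :=
  fn fun B => fn fun b => fn fun l =>
    transCancel (trConst loop b) (via ↟(apD (fun x => s1Rec l x) loop)
      (sym (apDConst (fun x => s1Rec l x) loop))
      ↟(s1LoopComp (fun _ => B.ty) b (trConst loop b ⊙ l)))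
def s1RecLoop {B : Ty} {b : El B} (l : El (Id B b b)) :
    El (Id (Id B b b) ↟(ap (fun x => s1Rec l x) loop) l) :=
  ⟨ref 45 ▷ B ▷ b.tm ▷ l.tm⟩

/-- The circle is connected. -/
def s1PropIndDef : El (Pi (S1 ⇒ U 1) fun C => IsProp (C base).ty ⇒ (C base).ty ⇒
    Pi S1 fun x => (C x).ty) :=
  fn fun C => fn fun h => fn fun b => fn fun x => s1Ind (fun x => (C x).ty) b (h _ _) x
def s1PropInd (C : El S1 → Ty) (h : El (IsProp (C base))) (b : El (C base)) (x : El S1) :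
    El (C x) :=
  ⟨ref 46 ▷ rlam C ▷ h.tm ▷ b.tm ▷ x.tm⟩

def s1HomotopyDef : El (Pi (U 1) fun A => Pi (S1 ⇒ A.ty) fun f => Pi (S1 ⇒ A.ty) fun g =>
    Pi (Id A.ty (f base) (g base)) fun p =>
    Id (Id A.ty (f base) (g base)) (ap (fun x => f x) loop ⊙ p) (p ⊙ ap (fun x => g x) loop) ⇒
    Pi S1 fun x => Id A.ty (f x) (g x)) :=
  fn fun A => fn fun f => fn fun g => fn fun p => fn fun h => fn fun x =>
    s1Ind (fun x => Id A.ty (f x) (g x)) p (trEq (fun x => f x) (fun x => g x) loop p p h) x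
def s1Homotopy {A : Ty} (f g : El S1 → El A) (p : El (Id A (f base) (g base)))
    (h : El (Id (Id A (f base) (g base)) (ap f loop ⊙ p) (p ⊙ ap g loop))) :
    El (Pi S1 fun x => Id A (f x) (g x)) :=
  ⟨ref 47 ▷ A ▷ (rlam fun x => (f x).tm) ▷ (rlam fun x => (g x).tm) ▷ p.tm ▷ h.tm⟩

/-- The square to be filled over `loop` says that `loop` commutes with itself, up to replacing `ap`
of the identity by the identity. -/
def ellDef : El (Pi S1 fun x => Id S1 x x) :=
  fn fun x => s1Ind (fun x => Id S1 x x) loop (trEq (fun x => x) (fun x => x) loop loop loop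
    (ap (fun p => p ⊙ loop) (apId loop) ⊙ ap (fun p => loop ⊙ p) (sym (apId loop)))) x
/-- The loop at each point of the circle. -/
def ell (x : El S1) : El (Id S1 x x) := ⟨ref 48 ▷ x.tm⟩

/-! ### Integers and powers -/

def powNDef : El (Pi (U 1) fun A => Pi A.ty fun x => Id A.ty x x ⇒ Nat' ⇒ Id A.ty x x) :=
  fn fun A => fn fun x => fn fun q => fn fun n =>
    natInd (fun _ => Id A.ty x x) (refl x) (fun _ r => r ⊙ q) n
def powN {A : Ty} {x : El A} (q : El (Id A x x)) (n : El Nat') : El (Id A x x) :=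
  ⟨ref 49 ▷ A ▷ x.tm ▷ q.tm ▷ n.tm⟩

/-- The integers: `inl n` is `n` and `inr n` is `-(n + 1)`. -/
abbrev Z : Ty := Sum Nat' Nat'

def powDef : El (Pi (U 1) fun A => Pi A.ty fun x => Id A.ty x x ⇒ Z ⇒ Id A.ty x x) :=
  fn fun A => fn fun x => fn fun q => fn fun n =>
    sumInd (fun _ => Id A.ty x x) (fun n => powN q n) (fun n => powN (sym q) (succ n)) n
def pow {A : Ty} {x : El A} (q : El (Id A x x)) (n : El Z) : El (Id A x x) :=
  ⟨ref 50 ▷ A ▷ x.tm ▷ q.tm ▷ n.tm⟩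

def succZDef : El (Z ⇒ Z) := fn fun z => sumInd (fun _ => Z) (fun n => inl Nat' (succ n))
  (fun n => natInd (fun _ => Z) (inl Nat' zero) (fun n _ => inr Nat' n) n) z
def succZ (z : El Z) : El Z := ⟨ref 51 ▷ z.tm⟩

def predZDef : El (Z ⇒ Z) := fn fun z => sumInd (fun _ => Z)
  (fun n => natInd (fun _ => Z) (inr Nat' zero) (fun n _ => inl Nat' n) n)
  (fun n => inr Nat' (succ n)) z
def predZ (z : El Z) : El Z := ⟨ref 52 ▷ z.tm⟩

def succPredDef : El (Pi Z fun z => Id Z (succZ (predZ z)) z) :=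
  fn fun z => sumInd (fun z => Id Z (succZ (predZ z)) z)
    (fun n => natInd (fun n => Id Z (succZ (predZ (inl Nat' n))) (inl Nat' n))
      ↟(refl (inl Nat' zero)) (fun n _ => ↟(refl (inl Nat' (succ n)))) n)
    (fun n => ↟(refl (inr Nat' n))) z
def succPred (z : El Z) : El (Id Z (succZ (predZ z)) z) := ⟨ref 53 ▷ z.tm⟩

def predSuccDef : El (Pi Z fun z => Id Z (predZ (succZ z)) z) :=
  fn fun z => sumInd (fun z => Id Z (predZ (succZ z)) z)
    (fun n => ↟(refl (inl Nat' n)))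
    (fun n => natInd (fun n => Id Z (predZ (succZ (inr Nat' n))) (inr Nat' n))
      ↟(refl (inr Nat' zero)) (fun n _ => ↟(refl (inr Nat' (succ n)))) n) z
def predSucc (z : El Z) : El (Id Z (predZ (succZ z)) z) := ⟨ref 54 ▷ z.tm⟩

def succEqv : El (Eqv Z Z) := pair (A := Z ⇒ Z) (fun f => IsEqv Z Z f) (fn fun z => succZ z)
  (isEqvOfInv (fn fun z => predZ z) (fn fun z => ↟(succPred z)) (fn fun z => ↟(predSucc z)))

/-! ### The universal cover of the circle and its monodromy. -/

def codeDef : El (S1 ⇒ U 0) := fn fun x => s1Rec (b := quo Z) (ua succEqv) x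
/-- The universal cover of the circle. -/
def code (x : El S1) : El (U 0) := ⟨ref 55 ▷ x.tm⟩

/-- Transport is coercion along `ap code loop`. This path is `ua succEqv` by the recursor's
computation rule, and coercion along it is the successor. -/
def trCodeLoopDef : El (Pi Z fun z => Id Z ↟(tr (fun x => (code x).ty) loop ↟z) (succZ z)) :=
  fn fun z =>
    via (coe (A := quo Z) (B := quo Z) ↟(ap code loop) z) (trCoe code loop ↟z)
      (via (coe (A := quo Z) (B := quo Z) (ua succEqv) z)
        (ap (fun p => coe (A := quo Z) (B := quo Z) p z) (s1RecLoop (b := quo Z) (ua succEqv)))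
        ↟(coeUa (A := quo Z) (B := quo Z) succEqv z))
def trCodeLoop (z : El Z) : El (Id Z ↟(tr (fun x => (code x).ty) loop ↟z) (succZ z)) :=
  ⟨ref 56 ▷ z.tm⟩

/-! ### The loop space of the circle -/

def powSuccZDef : El (Pi Z fun z => Id (Id S1 base base) (pow loop (succZ z)) (pow loop z ⊙ loop)) :=
  fn fun z => sumInd (fun z => Id (Id S1 base base) (pow loop (succZ z)) (pow loop z ⊙ loop))
    (fun _ => conv)
    (fun n => natInd
      (fun n => Id (Id S1 base base) (pow loop (succZ (inr Nat' n))) (pow loop (inr Nat' n) ⊙ loop))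
      ↟(sym (transSymCancel (refl base) loop))
      (fun n _ => ↟(sym (transSymCancel (powN (sym loop) (succ n)) loop))) n) z
def powSuccZ (z : El Z) : El (Id (Id S1 base base) (pow loop (succZ z)) (pow loop z ⊙ loop)) :=
  ⟨ref 57 ▷ z.tm⟩

/-- Write `z` as the successor of `predZ z`, that is, as a transport along `loop`, which the inverse
transport undoes. -/
def trCodeSymLoopDef : El (Pi Z fun z =>
    Id Z ↟(tr (fun x => (code x).ty) (sym loop) ↟z) (predZ z)) :=
  fn fun z => via ↟(tr (fun x => (code x).ty) (sym loop) (tr (fun x => (code x).ty) loop ↟(predZ z)))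
    (ap (A := Z) (B := Z) (fun z => ↟(tr (fun x => (code x).ty) (sym loop) ↟z))
      (sym (trCodeLoop (predZ z) ⊙ succPred z)))
    ↟(trSym (fun x => (code x).ty) loop ↟(predZ z))
def trCodeSymLoop (z : El Z) : El (Id Z ↟(tr (fun x => (code x).ty) (sym loop) ↟z) (predZ z)) :=
  ⟨ref 58 ▷ z.tm⟩

def encDef : El (Pi S1 fun x => Id S1 base x ⇒ (code x).ty) :=
  fn fun _ => fn fun p => tr (fun x => (code x).ty) p ↟(inl Nat' zero)
def enc {x : El S1} (p : El (Id S1 base x)) : El (code x).ty := ⟨ref 59 ▷ x.tm ▷ p.tm⟩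
def encΩ (p : El (Id S1 base base)) : El Z := ↟(enc p)

/-- Over the base point decoding is `pow loop`. Compatibility with `loop` amounts to `powSuccZ`: one
more turn raises the exponent by one. -/
def decDef : El (Pi S1 fun x => (code x).ty ⇒ Id S1 base x) :=
  fn fun x => s1Ind (fun x => (code x).ty ⇒ Id S1 base x) (fn fun z => pow loop ↟z)
    (trFun (fun x => (code x).ty) (fun x => Id S1 base x) loop _ _ (fn fun z =>
      via (pow loop ↟z ⊙ loop) (trPath loop (pow loop ↟z))
        (via (pow loop (succZ ↟z)) (sym (powSuccZ ↟z))
          ↟(ap (fun z => pow loop z) (sym (trCodeLoop ↟z)))))) x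
def dec (x : El S1) (c : El (code x).ty) : El (Id S1 base x) := ⟨ref 60 ▷ x.tm ▷ c.tm⟩

/-- This is the half "decode after encode" for an arbitrary family: by path induction only
reflexivity has to be decoded correctly. -/
def trSectionDef : El (Pi (U 1) fun A => Pi (A.ty ⇒ U 1) fun C => Pi A.ty fun x => Pi A.ty fun y =>
    Pi (Id A.ty x y) fun p => Pi (Pi A.ty fun y => (C y).ty ⇒ Id A.ty x y) fun d =>
    Pi (C x).ty fun c => Id (Id A.ty x x) (d x c) (refl x) ⇒
    Id (Id A.ty x y) (d y (tr (fun x => (C x).ty) p c)) p) :=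
  fn fun A => fn fun C => fn fun _ => fn fun _ => fn fun p =>
    J (fun x y p => Pi (Pi A.ty fun y => (C y).ty ⇒ Id A.ty x y) fun d =>
      Pi (C x).ty fun c => Id (Id A.ty x x) (d x c) (refl x) ⇒
      Id (Id A.ty x y) (d y (tr (fun x => (C x).ty) p c)) p)
      (fun _ => fn fun _ => fn fun _ => fn fun h => ↟h) p
def trSection {A : Ty} (C : El A → Ty) {x y : El A} (p : El (Id A x y))
    (d : (y : El A) → El (C y) → El (Id A x y)) (c : El (C x))
    (h : El (Id (Id A x x) (d x c) (refl x))) : El (Id (Id A x y) (d y (tr C p c)) p) :=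
  ⟨ref 61 ▷ A ▷ rlam C ▷ x.tm ▷ y.tm ▷ p.tm ▷ (rlam fun y => rlam fun c => (d y c).tm) ▷ c.tm ▷ h.tm⟩

def powEncDef : El (Pi (Id S1 base base) fun q => Id (Id S1 base base) (pow loop (encΩ q)) q) :=
  fn fun q => ↟(trSection (fun x => (code x).ty) q (fun x c => dec x c) ↟(inl Nat' zero) conv)
def powEnc (q : El (Id S1 base base)) : El (Id (Id S1 base base) (pow loop (encΩ q)) q) :=
  ⟨ref 62 ▷ q.tm⟩

/-- By induction on the exponent: each further factor `loop` acts on the fibre as the successor,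
each inverse factor as the predecessor. -/
def encPowDef : El (Pi Z fun z => Id Z (encΩ (pow loop z)) z) :=
  fn fun z =>
    let t (p : El (Id S1 base base)) (z : El Z) : El Z := ↟(tr (fun x => (code x).ty) p ↟z)
    let o : El Z := inl Nat' zero
    sumInd (fun z => Id Z (encΩ (pow loop z)) z)
      (fun n => natInd (fun n => Id Z (encΩ (pow loop (inl Nat' n))) (inl Nat' n)) conv
        (fun n h => via (t loop (t (powN loop n) o))
          (trTrans (fun x => (code x).ty) (powN loop n) loop ↟o)
          (trCodeLoop (t (powN loop n) o) ⊙ ap (fun z => succZ z) ↟h ⊙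
            (conv : El (Id Z (succZ (inl Nat' n)) (inl Nat' (succ n)))))) n)
      (fun n => natInd (fun n => Id Z (encΩ (pow loop (inr Nat' n))) (inr Nat' n))
        ↟(trCodeSymLoop o)
        (fun n h => via (t (sym loop) (t (powN (sym loop) (succ n)) o))
          (trTrans (fun x => (code x).ty) (powN (sym loop) (succ n)) (sym loop) ↟o)
          (trCodeSymLoop (t (powN (sym loop) (succ n)) o) ⊙ ap (fun z => predZ z) ↟h ⊙
            (conv : El (Id Z (predZ (inr Nat' n)) (inr Nat' (succ n)))))) n) z
def encPow (z : El Z) : El (Id Z (encΩ (pow loop z)) z) := ⟨ref 63 ▷ z.tm⟩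

def powLoopInjDef : El (Pi Z fun m => Pi Z fun n =>
    Id (Id S1 base base) (pow loop m) (pow loop n) ⇒ Id Z m n) :=
  fn fun m => fn fun n => fn fun h => sym (encPow m) ⊙ ap (fun q => encΩ q) h ⊙ encPow n
def powLoopInj {m n : El Z} (h : El (Id (Id S1 base base) (pow loop m) (pow loop n))) :
    El (Id Z m n) :=
  ⟨ref 64 ▷ m.tm ▷ n.tm ▷ h.tm⟩

/-! ### Identity of natural numbers and integers -/

/-- Equality as a type that computes on constructors. It gives disjointness of constructors by
computation and makes the integers a set through `isSetOfRel`. -/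
def eqNDef : El (Nat' ⇒ Nat' ⇒ U 0) :=
  fn fun m => natInd (fun _ => Nat' ⇒ U 0)
    (fn fun n => natInd (fun _ => U 0) (quo Unit) (fun _ _ => quo Empty) n)
    (fun _ r => fn fun n => natInd (fun _ => U 0) (quo Empty) (fun n _ => r n) n) m
def eqN (m n : El Nat') : Ty := ref 65 ▷ m.tm ▷ n.tm

def eqNReflDef : El (Pi Nat' fun n => eqN n n) :=
  fn fun n => natInd (fun n => eqN n n) ↟star (fun _ h => ↟h) n
def eqNRefl (n : El Nat') : El (eqN n n) := ⟨ref 66 ▷ n.tm⟩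

def isPropEqNDef : El (Pi Nat' fun m => Pi Nat' fun n => IsProp (eqN m n)) :=
  fn fun m => natInd (fun m => Pi Nat' fun n => IsProp (eqN m n))
    (fn fun n => natInd (fun n => IsProp (eqN zero n)) ↟isPropUnit (fun _ _ => ↟isPropEmpty) n)
    (fun m h => fn fun n => natInd (fun n => IsProp (eqN (succ m) n)) ↟isPropEmpty
      (fun n _ => ↟(h n)) n) m
def isPropEqN (m n : El Nat') : El (IsProp (eqN m n)) := ⟨ref 67 ▷ m.tm ▷ n.tm⟩

def eqOfEqNDef : El (Pi Nat' fun m => Pi Nat' fun n => eqN m n ⇒ Id Nat' m n) :=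
  fn fun m => natInd (fun m => Pi Nat' fun n => eqN m n ⇒ Id Nat' m n)
    (fn fun n => natInd (fun n => eqN zero n ⇒ Id Nat' zero n) (fn fun _ => refl zero)
      (fun _ _ => fn fun e => absurd _ ↟e) n)
    (fun m h => fn fun n => natInd (fun n => eqN (succ m) n ⇒ Id Nat' (succ m) n)
      (fn fun e => absurd _ ↟e) (fun n _ => fn fun e => ap (fun n => succ n) (h n ↟e)) n) m
def eqOfEqN {m n : El Nat'} (e : El (eqN m n)) : El (Id Nat' m n) := ⟨ref 68 ▷ m.tm ▷ n.tm ▷ e.tm⟩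

def eqZDef : El (Z ⇒ Z ⇒ U 0) :=
  fn fun m => fn fun n => sumInd (fun _ => U 0)
    (fun a => sumInd (fun _ => U 0) (fun b => quo (eqN a b)) (fun _ => quo Empty) n)
    (fun a => sumInd (fun _ => U 0) (fun _ => quo Empty) (fun b => quo (eqN a b)) n) m
def eqZ (m n : El Z) : Ty := ref 69 ▷ m.tm ▷ n.tm

def eqZReflDef : El (Pi Z fun z => eqZ z z) :=
  fn fun z => sumInd (fun z => eqZ z z) (fun n => ↟(eqNRefl n)) (fun n => ↟(eqNRefl n)) z
def eqZRefl (z : El Z) : El (eqZ z z) := ⟨ref 70 ▷ z.tm⟩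

def isPropEqZDef : El (Pi Z fun m => Pi Z fun n => IsProp (eqZ m n)) :=
  fn fun m => fn fun n => sumInd (fun m => IsProp (eqZ m n))
    (fun a => sumInd (fun n => IsProp (eqZ (inl Nat' a) n)) (fun b => ↟(isPropEqN a b))
      (fun _ => ↟isPropEmpty) n)
    (fun a => sumInd (fun n => IsProp (eqZ (inr Nat' a) n)) (fun _ => ↟isPropEmpty)
      (fun b => ↟(isPropEqN a b)) n) m
def isPropEqZ (m n : El Z) : El (IsProp (eqZ m n)) := ⟨ref 71 ▷ m.tm ▷ n.tm⟩

def eqOfEqZDef : El (Pi Z fun m => Pi Z fun n => eqZ m n ⇒ Id Z m n) :=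
  fn fun m => fn fun n => sumInd (fun m => eqZ m n ⇒ Id Z m n)
    (fun a => sumInd (fun n => eqZ (inl Nat' a) n ⇒ Id Z (inl Nat' a) n)
      (fun b => fn fun e => ap (fun n => inl Nat' n) (eqOfEqN (m := a) (n := b) ↟e))
      (fun _ => fn fun e => absurd _ ↟e) n)
    (fun a => sumInd (fun n => eqZ (inr Nat' a) n ⇒ Id Z (inr Nat' a) n)
      (fun _ => fn fun e => absurd _ ↟e)
      (fun b => fn fun e => ap (fun n => inr Nat' n) (eqOfEqN (m := a) (n := b) ↟e)) n) m
def eqOfEqZ {m n : El Z} (e : El (eqZ m n)) : El (Id Z m n) := ⟨ref 72 ▷ m.tm ▷ n.tm ▷ e.tm⟩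

def eqZOfEqDef : El (Pi Z fun m => Pi Z fun n => Id Z m n ⇒ eqZ m n) :=
  fn fun m => fn fun _ => fn fun p => tr (fun n => eqZ m n) p (eqZRefl m)
def eqZOfEq {m n : El Z} (p : El (Id Z m n)) : El (eqZ m n) := ⟨ref 73 ▷ m.tm ▷ n.tm ▷ p.tm⟩

def isSetZDef : El (Pi Z fun m => Pi Z fun n => IsProp (Id Z m n)) :=
  fn fun m => fn fun n =>
    isSetOfRel (fun m n => eqZ m n) (fun m => eqZRefl m) (fun m n => isPropEqZ m n)
      (fun _ _ e => eqOfEqZ e) m n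
def isSetZ (m n : El Z) : El (IsProp (Id Z m n)) := ⟨ref 74 ▷ m.tm ▷ n.tm⟩

/-- Equality of the encodings is a proposition, and it implies identity because a loop is the power
of `loop` given by its encoding. -/
def isSetΩDef : El (Pi (Id S1 base base) fun p => Pi (Id S1 base base) fun q =>
    IsProp (Id (Id S1 base base) p q)) :=
  fn fun p => fn fun q =>
    isSetOfRel (fun p q => eqZ (encΩ p) (encΩ q)) (fun p => eqZRefl (encΩ p))
      (fun p q => isPropEqZ (encΩ p) (encΩ q))
      (fun p q e => sym (powEnc p) ⊙ ap (fun z => pow loop z) (eqOfEqZ e) ⊙ powEnc q) p q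
def isSetΩ (p q : El (Id S1 base base)) : El (IsProp (Id (Id S1 base base) p q)) :=
  ⟨ref 75 ▷ p.tm ▷ q.tm⟩

/-! ### Powers which are not the loop -/

def addNDef : El (Nat' ⇒ Nat' ⇒ Nat') :=
  fn fun m => fn fun n => natInd (fun _ => Nat') m (fun _ r => succ r) n
def addN (m n : El Nat') : El Nat' := ⟨ref 76 ▷ m.tm ▷ n.tm⟩

/-- The product of `j` and `a`, by recursion on `j`. -/
def mulNDef : El (Nat' ⇒ Nat' ⇒ Nat') :=
  fn fun j => fn fun a => natInd (fun _ => Nat') zero (fun _ r => addN r a) j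
def mulN (j a : El Nat') : El Nat' := ⟨ref 77 ▷ j.tm ▷ a.tm⟩

def powNAddDef : El (Pi (U 1) fun A => Pi A.ty fun x => Pi (Id A.ty x x) fun q => Pi Nat' fun m =>
    Pi Nat' fun n => Id (Id A.ty x x) (powN q (addN m n)) (powN q m ⊙ powN q n)) :=
  fn fun A => fn fun x => fn fun q => fn fun m => fn fun n =>
    natInd (fun n => Id (Id A.ty x x) (powN q (addN m n)) (powN q m ⊙ powN q n))
      ↟(sym (transRefl (powN q m)))
      (fun n h => ↟(ap (fun r => r ⊙ q) h ⊙ transAssoc (powN q m) (powN q n) q)) n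
def powNAdd {A : Ty} {x : El A} (q : El (Id A x x)) (m n : El Nat') :
    El (Id (Id A x x) (powN q (addN m n)) (powN q m ⊙ powN q n)) :=
  ⟨ref 78 ▷ A ▷ x.tm ▷ q.tm ▷ m.tm ▷ n.tm⟩

def powNMulDef : El (Pi (U 1) fun A => Pi A.ty fun x => Pi (Id A.ty x x) fun q => Pi Nat' fun a =>
    Pi Nat' fun j => Id (Id A.ty x x) (powN (powN q a) j) (powN q (mulN j a))) :=
  fn fun A => fn fun x => fn fun q => fn fun a => fn fun j =>
    natInd (fun j => Id (Id A.ty x x) (powN (powN q a) j) (powN q (mulN j a))) conv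
      (fun j h => ↟(ap (fun r => r ⊙ powN q a) h ⊙ sym (powNAdd q (mulN j a) a))) j
def powNMul {A : Ty} {x : El A} (q : El (Id A x x)) (a j : El Nat') :
    El (Id (Id A x x) (powN (powN q a) j) (powN q (mulN j a))) :=
  ⟨ref 79 ▷ A ▷ x.tm ▷ q.tm ▷ a.tm ▷ j.tm⟩

def succAddNeDef : El (Pi Nat' fun m => Pi Nat' fun n => eqN (addN (succ m) n) zero ⇒ Empty) :=
  fn fun m => fn fun n => natInd (fun n => eqN (addN (succ m) n) zero ⇒ Empty)
    (fn fun e => ↟e) (fun _ _ => fn fun e => ↟e) n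
def succAddNe (m n : El Nat') (e : El (eqN (addN (succ m) n) zero)) : El Empty :=
  ⟨ref 80 ▷ m.tm ▷ n.tm ▷ e.tm⟩

def mulNNeDef : El (Pi Nat' fun j => Pi Nat' fun a =>
    eqN (mulN (succ (succ j)) a) (succ zero) ⇒ Empty) :=
  fn fun j => fn fun a =>
    natInd (fun a => eqN (mulN (succ (succ j)) a) (succ zero) ⇒ Empty)
      (natInd (fun j => eqN (mulN (succ (succ j)) zero) (succ zero) ⇒ Empty)
        (fn fun e => ↟e) (fun _ h => fn fun e => h ↟e) j)
      -- The product `(j + 2)(a + 1)` computes to the successor of `(m + 1) + a` with `m = j(a + 1)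
      -- + a`; if it were one, that sum would vanish.
      (fun a _ => fn fun e => succAddNe (addN (mulN j (succ a)) a) a ↟e) a
def mulNNe (j a : El Nat') (e : El (eqN (mulN (succ (succ j)) a) (succ zero))) : El Empty :=
  ⟨ref 81 ▷ j.tm ▷ a.tm ▷ e.tm⟩

def powPowNeLoopDef : El (Pi Nat' fun j => Pi Z fun m =>
    Id (Id S1 base base) (powN (pow loop m) (succ (succ j))) loop ⇒ Empty) :=
  fn fun j => fn fun m =>
    sumInd (fun m => Id (Id S1 base base) (powN (pow loop m) (succ (succ j))) loop ⇒ Empty)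
      (fun a => fn fun h => mulNNe j a
        ↟(eqZOfEq (m := inl Nat' (mulN (succ (succ j)) a)) (n := inl Nat' (succ zero))
          (powLoopInj (via (powN (powN loop a) (succ (succ j)))
            (sym (powNMul loop a (succ (succ j)))) ↟h))))
      (fun a => fn fun h =>
        -- The exponent is `-(j + 2)(a + 1)`. Since `inr k` is `-(k + 1)`, its index is one less
        -- than the product.
        ↟(eqZOfEq (m := inr Nat' (addN (mulN (succ j) (succ a)) a)) (n := inl Nat' (succ zero))
          (powLoopInj (via (powN (powN (sym loop) (succ a)) (succ (succ j)))
            (sym (powNMul (sym loop) (succ a) (succ (succ j)))) ↟h)))) m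
def powPowNeLoop (j : El Nat') (m : El Z)
    (h : El (Id (Id S1 base base) (powN (pow loop m) (succ (succ j))) loop)) : El Empty :=
  ⟨ref 82 ▷ j.tm ▷ m.tm ▷ h.tm⟩

/-- A negation is a proposition, so connectedness reduces the claim to the base point, where `q` is
a power of `loop`. -/
def powNNeEllDef : El (Pi Nat' fun j => Pi S1 fun z => Pi (Id S1 z z) fun q =>
    Id (Id S1 z z) (powN q (succ (succ j))) (ell z) ⇒ Empty) :=
  fn fun j => fn fun z =>
    s1PropInd (fun z => Pi (Id S1 z z) fun q =>
        Id (Id S1 z z) (powN q (succ (succ j))) (ell z) ⇒ Empty)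
      (isPropNeg _)
      (fn fun q => fn fun h => powPowNeLoop j (encΩ q)
        (via (powN q (succ (succ j))) (ap (fun q => powN q (succ (succ j))) (powEnc q)) ↟h)) z
def powNNeEll (j : El Nat') {z : El S1} (q : El (Id S1 z z))
    (h : El (Id (Id S1 z z) (powN q (succ (succ j))) (ell z))) : El Empty :=
  ⟨ref 83 ▷ j.tm ▷ z.tm ▷ q.tm ▷ h.tm⟩

def reflNeEllDef : El (Pi S1 fun z => Pi (Id S1 z z) fun _ =>
    Id (Id S1 z z) (refl z) (ell z) ⇒ Empty) :=
  fn fun z =>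
    s1PropInd (fun z => Pi (Id S1 z z) fun _ => Id (Id S1 z z) (refl z) (ell z) ⇒ Empty)
      (isPropNeg _)
      (fn fun _ => fn fun h =>
        ↟(eqZOfEq (m := inl Nat' zero) (n := inl Nat' (succ zero)) (powLoopInj ↟h))) z
def reflNeEll {z : El S1} (q : El (Id S1 z z)) (h : El (Id (Id S1 z z) (refl z) (ell z))) : El Empty :=
  ⟨ref 84 ▷ z.tm ▷ q.tm ▷ h.tm⟩

/-! ### Degrees of equivalences -/

/-- The integer is `1` or `-1`. -/
def unitDef : El (Z ⇒ U 0) :=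
  fn fun z => sumInd (fun _ => U 0)
    (fun n => natInd (fun _ => U 0) (quo Empty)
      (fun n _ => natInd (fun _ => U 0) (quo Unit) (fun _ _ => quo Empty) n) n)
    (fun n => natInd (fun _ => U 0) (quo Unit) (fun _ _ => quo Empty) n) z
def unit (z : El Z) : Ty := ref 85 ▷ z.tm

/-- Exponent zero is excluded by `reflNeEll`, and exponents of absolute value at least two by
`powNNeEll`, applied to `q` or to its inverse. -/
def unitOfPowEqDef : El (Pi S1 fun x => Pi (Id S1 x x) fun q => Pi Z fun n =>
    Id (Id S1 x x) (pow q n) (ell x) ⇒ unit n) :=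
  fn fun x => fn fun q => fn fun n => sumInd (fun n => Id (Id S1 x x) (pow q n) (ell x) ⇒ unit n)
    (fun n => natInd (fun n => Id (Id S1 x x) (pow q (inl Nat' n)) (ell x) ⇒ unit (inl Nat' n))
      (fn fun h => absurd _ (reflNeEll q ↟h))
      (fun n _ => natInd
        (fun n => Id (Id S1 x x) (pow q (inl Nat' (succ n))) (ell x) ⇒ unit (inl Nat' (succ n)))
        (fn fun _ => ↟star) (fun n _ => fn fun h => absurd _ (powNNeEll n q ↟h)) n) n)
    (fun n => natInd (fun n => Id (Id S1 x x) (pow q (inr Nat' n)) (ell x) ⇒ unit (inr Nat' n))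
      (fn fun _ => ↟star) (fun n _ => fn fun h => absurd _ (powNNeEll n (sym q) ↟h)) n) n
def unitOfPowEq {x : El S1} {q : El (Id S1 x x)} {n : El Z}
    (h : El (Id (Id S1 x x) (pow q n) (ell x))) : El (unit n) :=
  ⟨ref 86 ▷ x.tm ▷ q.tm ▷ n.tm ▷ h.tm⟩

def apPowNDef : El (Pi (U 1) fun A => Pi (U 1) fun B => Pi (A.ty ⇒ B.ty) fun f => Pi A.ty fun x =>
    Pi (Id A.ty x x) fun q => Pi Nat' fun n => Id (Id B.ty (f x) (f x))
      (ap (fun x => f x) (powN q n)) (powN (ap (fun x => f x) q) n)) :=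
  fn fun _ => fn fun B => fn fun f => fn fun x => fn fun q => fn fun n =>
    natInd (fun n => Id (Id B.ty (f x) (f x))
      (ap (fun x => f x) (powN q n)) (powN (ap (fun x => f x) q) n)) conv
      (fun n h => ↟(apTrans (fun x => f x) (powN q n) q ⊙ ap (fun r => r ⊙ ap (fun x => f x) q) h)) n
def apPowN {A B : Ty} (f : El A → El B) {x : El A} (q : El (Id A x x)) (n : El Nat') :
    El (Id (Id B (f x) (f x)) (ap f (powN q n)) (powN (ap f q) n)) :=
  ⟨ref 87 ▷ A ▷ B ▷ (rlam fun x => (f x).tm) ▷ x.tm ▷ q.tm ▷ n.tm⟩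

def apPowDef : El (Pi (U 1) fun A => Pi (U 1) fun B => Pi (A.ty ⇒ B.ty) fun f => Pi A.ty fun x =>
    Pi (Id A.ty x x) fun q => Pi Z fun n => Id (Id B.ty (f x) (f x))
      (ap (fun x => f x) (pow q n)) (pow (ap (fun x => f x) q) n)) :=
  fn fun _ => fn fun B => fn fun f => fn fun x => fn fun q => fn fun n =>
    sumInd (fun n => Id (Id B.ty (f x) (f x))
      (ap (fun x => f x) (pow q n)) (pow (ap (fun x => f x) q) n))
      (fun n => ↟(apPowN (fun x => f x) q n))
      (fun n => ↟(apPowN (fun x => f x) (sym q) (succ n) ⊙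
        ap (fun r => powN r (succ n)) (apSym (fun x => f x) q))) n
def apPow {A B : Ty} (f : El A → El B) {x : El A} (q : El (Id A x x)) (n : El Z) :
    El (Id (Id B (f x) (f x)) (ap f (pow q n)) (pow (ap f q) n)) :=
  ⟨ref 88 ▷ A ▷ B ▷ (rlam fun x => (f x).tm) ▷ x.tm ▷ q.tm ▷ n.tm⟩

def rotDef : El (Z ⇒ S1 ⇒ S1 ⇒ S1) :=
  fn fun n => fn fun x => fn fun y => s1Rec (pow (ell x) n) y
/-- The map of degree `n` which sends the base point to `x`. -/
def rot (n : El Z) (x : El S1) : El (S1 ⇒ S1) := ⟨ref 89 ▷ n.tm ▷ x.tm⟩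

def apRotLoopDef : El (Pi Z fun n => Pi S1 fun x =>
    Id (Id S1 x x) ↟(ap (fun y => rot n x y) loop) (pow (ell x) n)) :=
  fn fun n => fn fun x => ↟(s1RecLoop (pow (ell x) n))
def apRotLoop (n : El Z) (x : El S1) :
    El (Id (Id S1 x x) ↟(ap (fun y => rot n x y) loop) (pow (ell x) n)) :=
  ⟨ref 90 ▷ n.tm ▷ x.tm⟩

/-- Apply a left inverse `g` to the image of `loop`. The result is the `n`-th power of `ap g (ell
x)`, and it is also `ell (g x)` because the composite is the identity. -/
def unitOfIsEqvDef : El (Pi Z fun n => Pi S1 fun x => IsEqv S1 S1 (rot n x) ⇒ unit n) :=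
  fn fun n => fn fun x => fn fun e =>
    let l : El (Linv S1 S1 (rot n x)) := snd e
    let g : El (S1 ⇒ S1) := fst (A := S1 ⇒ S1) (B := fun h => Pi S1 fun y => Id S1 (h (rot n x y)) y) l
    let k : El (Pi S1 fun y => Id S1 (g (rot n x y)) y) := snd (A := S1 ⇒ S1) (B := fun h => Pi S1 fun y => Id S1 (h (rot n x y)) y) l
    let c : El (S1 ⇒ S1) := fn fun y => g (rot n x y)
    let i : El (S1 ⇒ S1) := fn fun y => y
    unitOfPowEq (x := g x) (q := ap (fun y => g y) (ell x))
      (via (ap (fun y => g y) (pow (ell x) n)) (sym (apPow (fun y => g y) (ell x) n))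
        (via (ap (fun y => g y) ↟(ap (fun y => rot n x y) loop))
          (ap (fun r => ap (fun y => g y) r) (sym (apRotLoop n x)))
          (via ↟(ap (fun y => g (rot n x y)) loop)
            (sym (apComp (fun y => rot n x y) (fun y => g y) loop))
            -- The equation `ap f loop = ell (f base)` holds for the identity. Transporting it to
            -- the composite takes care of the change of base point.
            ↟(tr (fun f : El (S1 ⇒ S1) => Id (Id S1 (f base) (f base)) (ap (fun y => f y) loop) (ell (f base)))
              (sym (funext (f := c) (g := i) ↟k)) ↟(apId loop)))))
def unitOfIsEqv {n : El Z} {x : El S1} (e : El (IsEqv S1 S1 (rot n x))) : El (unit n) :=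
  ⟨ref 91 ▷ n.tm ▷ x.tm ▷ e.tm⟩

/-! ### The degree of a self-map -/

/-- At the base point the exponent is unique because powers of `loop` are distinct and loops form a
set. The claim is thus a proposition there, which lets connectedness extend it to all points. -/
def degDef : El (Pi S1 fun x => Pi (Id S1 x x) fun p =>
    Sig Z fun n => Id (Id S1 x x) (pow (ell x) n) p) :=
  fn fun x =>
    let Q (x : El S1) : Ty := Pi (Id S1 x x) fun p => Sig Z fun n => Id (Id S1 x x) (pow (ell x) n) p
    let P (p : El (Id S1 base base)) (n : El Z) : Ty := Id (Id S1 base base) (pow (ell base) n) p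
    s1PropInd Q
      (isPropPi fun p => fn fun v => fn fun w =>
        sigInd (A := Z) (B := P p) (fun v => Id (Sig Z (P p)) v w)
          (fun m h => sigInd (A := Z) (B := P p) (fun w => Id (Sig Z (P p)) (pair (P p) m h) w)
            (fun n k => pairEqProp (P p) (fun n => isSetΩ (pow (ell base) n) p)
              (powLoopInj (m := m) (n := n) ↟(h ⊙ sym k)) h k) w) v)
      (fn fun p => pair (P p) (encΩ p) ↟(powEnc p)) x
def deg {x : El S1} (p : El (Id S1 x x)) :
    El (Sig Z fun n => Id (Id S1 x x) (pow (ell x) n) p) :=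
  ⟨ref 92 ▷ x.tm ▷ p.tm⟩

/-- Identity of integers is a proposition, so the base point suffices; there both exponents give the
same power of `loop`. -/
def degRotDef : El (Pi Z fun n => Pi S1 fun x =>
    Id Z (fst (deg (x := x) ↟(ap (fun y => rot n x y) loop))) n) :=
  fn fun n => fn fun x => s1PropInd
    (fun x => Id Z (fst (deg (x := x) ↟(ap (fun y => rot n x y) loop))) n) (isSetZ _ n)
    (powLoopInj ↟(snd (deg (x := base) ↟(ap (fun y => rot n base y) loop)) ⊙ apRotLoop n base)) x
def degRot (n : El Z) (x : El S1) :
    El (Id Z (fst (deg (x := x) ↟(ap (fun y => rot n x y) loop))) n) :=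
  ⟨ref 93 ▷ n.tm ▷ x.tm⟩

/-- Both maps send `base` to the same point and `loop` to the same loop, which determines a map out
of the circle. -/
def rotUniqueDef : El (Pi (S1 ⇒ S1) fun f => Pi Z fun n =>
    Id (Id S1 (f base) (f base)) (pow (ell (f base)) n) (ap (fun y => f y) loop) ⇒
    Pi S1 fun y => Id S1 (rot n (f base) y) (f y)) :=
  fn fun f => fn fun n => fn fun h =>
    s1Homotopy (fun y => rot n (f base) y) (fun y => f y) ↟(refl (f base))
      ↟(transRefl (↟(ap (fun y => rot n (f base) y) loop) : El (Id S1 (f base) (f base))) ⊙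
        apRotLoop n (f base) ⊙ h)
def rotUnique {f : El (S1 ⇒ S1)} {n : El Z}
    (h : El (Id (Id S1 (f base) (f base)) (pow (ell (f base)) n) (ap (fun y => f y) loop))) :
    El (Pi S1 fun y => Id S1 (rot n (f base) y) (f y)) :=
  ⟨ref 94 ▷ f.tm ▷ n.tm ▷ h.tm⟩

abbrev pos : El Z := inl Nat' (succ zero)
abbrev neg : El Z := inr Nat' zero

/-- By connectedness `x` may be taken to be `base`; that map is homotopic to the identity, which is
therefore its inverse. -/
def isEqvRotPosDef : El (Pi S1 fun x => IsEqv S1 S1 (rot pos x)) :=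
  fn fun x => s1PropInd (fun x => IsEqv S1 S1 (rot pos x))
    (isPropIsEqv (A := quo S1) (B := quo S1) (rot pos base))
    (isEqvOfInv (fn fun y => y)
      ↟(rotUnique (f := fn fun y => y) (n := pos) ↟(sym (apId loop)))
      ↟(rotUnique (f := fn fun y => y) (n := pos) ↟(sym (apId loop)))) x
def isEqvRotPos (x : El S1) : El (IsEqv S1 S1 (rot pos x)) := ⟨ref 95 ▷ x.tm⟩

/-- The map inverts `loop`, so applying it twice gives the inverse of the inverse. -/
def rotNegRotNegDef : El (Pi S1 fun y => Id S1 (rot neg base (rot neg base y)) y) :=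
  let i (y : El S1) : El S1 := rot neg base y
  let a {x y : El S1} (p : El (Id S1 x y)) : El (Id S1 (i x) (i y)) := ap i p
  let l : El (Id S1 (i base) (i base)) := a loop
  let m : El (Id S1 base base) := ↟(ap (fun y => i (i y)) loop)
  let h : El (Id (Id S1 base base) ↟l (sym loop)) := ↟(apRotLoop neg base)
  s1Homotopy (fun y => i (i y)) (fun y => y) ↟(refl base)
    ↟(transRefl m ⊙
      via (A := Id S1 base base) ↟(a l) (apComp i i loop)
        (via (A := Id S1 base base) ↟(a (sym loop))
          (ap (fun r => a r) h)
          (via (A := Id S1 base base) ↟(sym l) (apSym i loop)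
            (via (sym (sym loop)) (ap (fun r => sym r) h)
              (symSym loop ⊙ sym (apId loop))))))
def rotNegRotNeg : El (Pi S1 fun y => Id S1 (rot neg base (rot neg base y)) y) := ⟨ref 96⟩

def isEqvRotNegDef : El (Pi S1 fun x => IsEqv S1 S1 (rot neg x)) :=
  fn fun x => s1PropInd (fun x => IsEqv S1 S1 (rot neg x))
    (isPropIsEqv (A := quo S1) (B := quo S1) (rot neg base))
    (isEqvOfInv (rot neg base) rotNegRotNeg rotNegRotNeg) x
def isEqvRotNeg (x : El S1) : El (IsEqv S1 S1 (rot neg x)) := ⟨ref 97 ▷ x.tm⟩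

/-! ### The main equivalence -/

abbrev Loops : Ty := Id (U 0) (quo S1) (quo S1)
abbrev Circles : Ty := Sum S1 S1

/-- Only `1` and `-1` are degrees of equivalences; for the other integers `inr` is a default value.
-/
def chooseDef : El (Z ⇒ S1 ⇒ Circles) :=
  fn fun n => fn fun x => sumInd (fun _ => Circles)
    (fun n => natInd (fun _ => Circles) (inr S1 x)
      (fun n _ => natInd (fun _ => Circles) (inl S1 x) (fun _ _ => inr S1 x) n) n)
    (fun _ => inr S1 x) n
def choose (n : El Z) (x : El S1) : El Circles := ⟨ref 98 ▷ n.tm ▷ x.tm⟩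

def classifyDef : El ((S1 ⇒ S1) ⇒ Circles) :=
  fn fun f => choose (fst (deg (x := f base) (ap (fun y => f y) loop))) (f base)
def classify (f : El (S1 ⇒ S1)) : El Circles := ⟨ref 99 ▷ f.tm⟩

def realizeDef : El (Circles ⇒ Loops) :=
  fn fun s => sumInd (fun _ => Loops)
    (fun x => ua (A := quo S1) (B := quo S1)
      (pair (A := S1 ⇒ S1) (fun f => IsEqv S1 S1 f) (rot pos x) (isEqvRotPos x)))
    (fun x => ua (A := quo S1) (B := quo S1)
      (pair (A := S1 ⇒ S1) (fun f => IsEqv S1 S1 f) (rot neg x) (isEqvRotNeg x))) s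
def realize (s : El Circles) : El Loops := ⟨ref 100 ▷ s.tm⟩

/-- Coercion along `ua` of a standard map is that map. Its degree is known from `degRot`, and it
sends `base` to `x` by computation. -/
def classifyRealizeDef : El (Pi Circles fun s => Id Circles (classify (coe (realize s))) s) :=
  fn fun s => sumInd (fun s => Id Circles (classify (coe (realize s))) s)
    (fun x => via (classify (rot pos x))
      (ap (fun w => classify (eqvFun w)) (idToEqvUa (A := quo S1) (B := quo S1)
        (pair (A := S1 ⇒ S1) (fun f => IsEqv S1 S1 f) (rot pos x) (isEqvRotPos x))))
      ↟(ap (fun n => choose n x) (degRot pos x)))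
    (fun x => via (classify (rot neg x))
      (ap (fun w => classify (eqvFun w)) (idToEqvUa (A := quo S1) (B := quo S1)
        (pair (A := S1 ⇒ S1) (fun f => IsEqv S1 S1 f) (rot neg x) (isEqvRotNeg x))))
      ↟(ap (fun n => choose n x) (degRot neg x))) s
def classifyRealize (s : El Circles) : El (Id Circles (classify (coe (realize s))) s) :=
  ⟨ref 101 ▷ s.tm⟩

/-- The hypothesis on `n` removes the default values of `choose`; in the two remaining cases this is
the computation of `ua`. -/
def coeRealizeDef : El (Pi Z fun n => Pi S1 fun x => Pi (unit n) fun _ => Pi S1 fun y =>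
    Id S1 (coe (realize (choose n x)) y) (rot n x y)) :=
  fn fun n => fn fun x =>
    let C (n : El Z) : Ty := Pi (unit n) fun _ => Pi S1 fun y =>
      Id S1 (coe (A := quo S1) (B := quo S1) (realize (choose n x)) y) (rot n x y)
    sumInd C
      (fun n => natInd (fun n => C (inl Nat' n)) (fn fun u => absurd _ ↟u)
        (fun n _ => natInd (fun n => C (inl Nat' (succ n)))
          (fn fun _ => fn fun y => ↟(coeUa (A := quo S1) (B := quo S1)
            (pair (A := S1 ⇒ S1) (fun f => IsEqv S1 S1 f) (rot pos x) (isEqvRotPos x)) y))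
          (fun _ _ => fn fun u => absurd _ ↟u) n) n)
      (fun n => natInd (fun n => C (inr Nat' n))
        (fn fun _ => fn fun y => ↟(coeUa (A := quo S1) (B := quo S1)
          (pair (A := S1 ⇒ S1) (fun f => IsEqv S1 S1 f) (rot neg x) (isEqvRotNeg x)) y))
        (fun _ _ => fn fun u => absurd _ ↟u) n) n
def coeRealize {n : El Z} (x : El S1) (u : El (unit n)) :
    El (Pi S1 fun y => Id S1 (coe (A := quo S1) (B := quo S1) (realize (choose n x)) y) (rot n x y)) :=
  ⟨ref 102 ▷ n.tm ▷ x.tm ▷ u.tm⟩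

def realizeClassifyDef : El (Pi Loops fun p => Id Loops (realize (classify (coe p))) p) :=
  fn fun p =>
    let f : El (S1 ⇒ S1) := coe (A := quo S1) (B := quo S1) p
    let d : El (Sig Z fun n => Id (Id S1 (f base) (f base)) (pow (ell (f base)) n)
      (ap (fun y => f y) loop)) := deg (ap (fun y => f y) loop)
    let r : El (Pi S1 fun y => Id S1 (rot (fst d) (f base) y) (f y)) := rotUnique (snd d)
    let e : El (IsEqv S1 S1 f) :=
      ↟(snd (A := S1 ⇒ S1) (B := fun f => IsEqv S1 S1 f) (idToEqv (A := quo S1) (B := quo S1) p))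
    -- By `r` the equivalence `f` is equal to the standard map of its degree, so the latter is an
    -- equivalence too.
    let u : El (unit (fst d)) := unitOfIsEqv (x := f base) (tr (fun f => IsEqv S1 S1 f) (sym (funext ↟r)) e)
    eqOfCoe (A := quo S1) (B := quo S1)
      (fn fun y => via (rot (fst d) (f base) y) (coeRealize (f base) u y) (r y))
def realizeClassify (p : El Loops) : El (Id Loops (realize (classify (coe p))) p) :=
  ⟨ref 103 ▷ p.tm⟩

def loopsEqvCirclesDef : El (Eqv Loops Circles) :=
  pair (A := Loops ⇒ Circles) (fun f => IsEqv Loops Circles f)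
    (fn fun p => classify (coe (A := quo S1) (B := quo S1) p))
    (isEqvOfInv (fn fun s => realize s) (fn fun s => ↟(classifyRealize s))
      (fn fun p => ↟(realizeClassify p)))

/-! ### Checking the development -/

/-- The declarations of the development, in order. -/
def development : List Decl :=
  [decl 0 false trDef, decl 1 false symDef, decl 2 false transDef, decl 3 false apDef, decl 4
   true apIdDef, decl 5 true transReflDef, decl 6 true transSymCancelDef, decl 7 true
   transCancelDef, decl 8 true transAssocDef, decl 9 true symSymDef, decl 10 true apSymDef, decl
   11 true apTransDef, decl 12 true apCompDef, decl 13 true trTransDef, decl 14 true trSymDef,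
   decl 15 true trEqDef, decl 16 true trPathDef, decl 17 false trConstDef, decl 18 false apDDef,
   decl 19 true apDConstDef, decl 20 false fstDef, decl 21 false sndDef, decl 22 false
   happlyDef, decl 23 false funextDef, decl 24 true happlyFunextDef, decl 25 true trFunDef, decl
   26 true isPropPiDef, decl 27 true isPropUnitDef, decl 28 true pairEqDef, decl 29 true
   pairEqPropDef, decl 30 true isSetOfRelDef, decl 31 true happlyPairDef, decl 32 true
   homotopyIdCenterDef, decl 33 true isEqvIdCenterDef, decl 34 false idToEqvDef, decl 35 false
   uaDef, decl 36 true idToEqvUaDef, decl 37 true idToEqvInjDef, decl 38 true eqvEqIdDef, decl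
   39 true eqOfCoeDef, decl 40 true isPropIsEqvCoeDef, decl 41 true isPropIsEqvDef, decl 42 true
   coeUaDef, decl 43 true trCoeDef, decl 44 false s1RecDef, decl 45 true s1RecLoopDef, decl 46
   true s1PropIndDef, decl 47 true s1HomotopyDef, decl 48 false ellDef, decl 49 false powNDef,
   decl 50 false powDef, decl 51 false succZDef, decl 52 false predZDef, decl 53 false
   succPredDef, decl 54 false predSuccDef, decl 55 false codeDef, decl 56 true trCodeLoopDef,
   decl 57 true powSuccZDef, decl 58 true trCodeSymLoopDef, decl 59 false encDef, decl 60 false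
   decDef, decl 61 true trSectionDef, decl 62 true powEncDef, decl 63 true encPowDef, decl 64
   true powLoopInjDef, decl 65 false eqNDef, decl 66 true eqNReflDef, decl 67 true isPropEqNDef,
   decl 68 true eqOfEqNDef, decl 69 false eqZDef, decl 70 true eqZReflDef, decl 71 true
   isPropEqZDef, decl 72 true eqOfEqZDef, decl 73 true eqZOfEqDef, decl 74 true isSetZDef, decl
   75 true isSetΩDef, decl 76 false addNDef, decl 77 false mulNDef, decl 78 true powNAddDef,
   decl 79 true powNMulDef, decl 80 true succAddNeDef, decl 81 true mulNNeDef, decl 82 true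
   powPowNeLoopDef, decl 83 true powNNeEllDef, decl 84 true reflNeEllDef, decl 85 false unitDef,
   decl 86 true unitOfPowEqDef, decl 87 true apPowNDef, decl 88 true apPowDef, decl 89 false
   rotDef, decl 90 true apRotLoopDef, decl 91 true unitOfIsEqvDef, decl 92 true degDef, decl 93
   true degRotDef, decl 94 true rotUniqueDef, decl 95 true isEqvRotPosDef, decl 96 true
   rotNegRotNegDef, decl 97 true isEqvRotNegDef, decl 98 false chooseDef, decl 99 false
   classifyDef, decl 100 false realizeDef, decl 101 true classifyRealizeDef, decl 102 true
   coeRealizeDef, decl 103 true realizeClassifyDef]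

/-- The environment with all constants and no declarations. -/
def emptyEnv : Env := ⟨27, []⟩

/-- The environment of the development. -/
def fullEnv : Env := development.foldl Env.add emptyEnv

set_option maxRecDepth 100000

theorem checkConst_all (c : Const) : checkConst c.ctorIdx c = true := by
  cases c <;> decide +kernel

theorem checkDecls_development : checkDecls emptyEnv 0 development = true := by decide +kernel

theorem checkDecl_loopsEqvCircles :
    checkDecl fullEnv (decl 104 true loopsEqvCirclesDef) = true := by
  decide +kernel

/-- The type contains no reference to a declaration, so the interpretation `ρ` plays no role. -/
theorem erase_loopsEqvCircles (ρ : ℕ → Tm) :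
    (decl 104 true loopsEqvCirclesDef).ty.erase ρ =
      equiv (idt (.univ 0) circle circle) (sum circle circle) := by
  with_unfolding_all rfl

end
end HoTT.Obj

/-! ### The equivalence in every universe. -/

theorem mainTheorem4 (i : ℕ) :
    HoTT.IsInhabited
      (HoTT.equiv (HoTT.idt (HoTT.Tm.univ i) HoTT.circle HoTT.circle)
        (HoTT.sum HoTT.circle HoTT.circle)) := by
  -- There are 26 constants, so the bound 27 makes all of them known.
  obtain ⟨ρ, h⟩ := HoTT.Valid.addList (HoTT.valid_nil HoTT.Obj.checkConst_all 27)
    HoTT.Obj.checkDecls_development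
  -- Every universe in the type is `U_0`, so the shift by `i` gives the same statement for `U_(0 +
  -- i)`.
  have := (h.checkDecl_sound HoTT.Obj.checkDecl_loopsEqvCircles).1.shift i
  rw [HoTT.Obj.erase_loopsEqvCircles] at this
  rw [← Nat.zero_add i]
  exact ⟨_, this⟩
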